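/- Let $\mathbb{F}_q$ be a finite field with $q$ elements, $q$ odd, let $A=\mathbb{F}_q[T]$, $F_\infty=\mathbb{F}_q((1/T))$, $\mathcal{O}_\infty=\mathbb{F}_q[[1/T]]$, and let $\mathcal{T}$ be the Bruhat--Tits tree of $\mathrm{PGL}_2(F_\infty)$: its vertices are the cosets $\mathrm{GL}_2(F_\infty)/\mathrm{GL}_2(\mathcal{O}_\infty)Z(F_\infty)$ and its oriented edges are the cosets $\mathrm{GL}_2(F_\infty)/\mathcal{I}Z(F_\infty)$, where $Z$ is the center and $\mathcal{I}$ is the Iwahori subgroup of matrices in $\mathrm{GL}_2(\mathcal{O}_\infty)$ with lower left entry in $T^{-1}\mathcal{O}_\infty$; the edge $g\mathcal{I}Z(F_\infty)$ has the vertex of $g$ as origin and the vertex of $g\begin{pmatrix}0&1\\T^{-1}&0\end{pmatrix}$ as terminus. Let $\mathfrak{n}=\mathfrak{p}_1^{r_1}\cdots\mathfrak{p}_s^{r_s}\in A$, where $\mathfrak{p}_1,\dots,\mathfrak{p}_s$ are distinct monic irreducible polynomials and $r_i\ge 1$ (the case $s=0$, $\mathfrak{n}=1$ is allowed). Put $|a|=q^{\deg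 a}$ for $0\ne a\in A$, $$\Gamma_0(\mathfrak{n})=\left\{\begin{pmatrix}a&b\\c&d\end{pmatrix}\in\mathrm{GL}_2(A): \mathfrak{n}\mid c\right\},\qquad \Gamma_0^1(\mathfrak{n})=\Gamma_0(\mathfrak{n})\cap\mathrm{SL}_2(A).$$ Let $\epsilon(\mathfrak{n})=\#\mathbb{P}^1(A/\mathfrak{n})$, where $\mathbb{P}^1(R)$ is the set of pairs $(u,v)\in R^2$ with $Ru+Rv=R$ modulo $R^\times$, let $$\kappa(\mathfrak{n})=\prod_{i=1}^s\left(|\mathfrak{p}_i|^{\lfloor (r_i-1)/2\rfloor}+|\mathfrak{p}_i|^{\lfloor r_i/2\rfloor}\right),$$ and let $\mathrm{me}(\mathfrak{n})=1$ if all $\deg\mathfrak{p}_i$ are even and $\mathrm{me}(\mathfrak{n})=0$ otherwise. For a subgroup $\Gamma\subseteq\mathrm{GL}_2(A)$ let $g(\Gamma\backslash\mathcal{T})=\mathrm{rank}_{\mathbb{Z}}H_1(\Gamma\backslash\mathcal{T},\mathbb{Z})$ be the genus of the quotient graph. Then $\epsilon(\mathfrak{n})=\prod_{i=1}^s|\mathfrak{p}_i|^{r_i-1}(|\mathfrak{p}_i|+1)$,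 the groups $H_1(\Gamma_0^1(\mathfrak{n})\backslash\mathcal{T},\mathbb{Z})$ and $H_1(\Gamma_0(\mathfrak{n})\backslash\mathcal{T},\mathbb{Z})$ are finitely generated, $$g(\Gamma_0^1(\mathfrak{n})\backslash\mathcal{T})=1+\frac{2}{q^2-1}\epsilon(\mathfrak{n})-\frac{2}{q-1}\kappa(\mathfrak{n})+2^{s-1}\left(\frac{3-q}{q-1}+\frac{1-q}{q+1}\,\mathrm{me}(\mathfrak{n})\right),$$ and $$g(\Gamma_0^1(\mathfrak{n})\backslash\mathcal{T})=2\,g(\Gamma_0(\mathfrak{n})\backslash\mathcal{T})-1+2^{s-1}(1+\mathrm{me}(\mathfrak{n})).$$ -/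

import Mathlib

open Polynomial
open scoped LaurentSeries PowerSeries MatrixGroups

noncomputable section

/-! ### Graphs and their first homology -/

universe u

/-- A graph in the sense of Serre: a set of vertices, a set of oriented edges with origin and
terminus, and a fixed-point-free involution reversing the edges. Loops and multiple edges are
allowed. -/
structure SerreGraph where
  /-- vertices -/
  V : Type u
  /-- oriented edges -/
  E : Type u
  /-- origin -/
  o : E → V
  /-- terminus -/
  t : E → V
  /-- the same edge with the opposite orientation -/
  rev : E → E
  rev_rev : ∀ e, rev (rev e) = e
  rev_ne : ∀ e, rev e ≠ e
  o_rev : ∀ e, o (rev e) = t e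

namespace SerreGraph

/-- Integral `1`-chains: the free abelian group on oriented edges modulo `ē = -e`. -/
abbrev C₁ (X : SerreGraph) : Type _ :=
  (X.E →₀ ℤ) ⧸ Submodule.span ℤ
    (Set.range fun e : X.E => Finsupp.single e (1 : ℤ) + Finsupp.single (X.rev e) 1)

lemma t_rev (X : SerreGraph) (e : X.E) : X.t (X.rev e) = X.o e := by
  rw [← X.o_rev, X.rev_rev]

/-- The boundary map, `∂ e = t(e) - o(e)`. -/
def boundary (X : SerreGraph) : X.C₁ →ₗ[ℤ] (X.V →₀ ℤ) :=
  Submodule.liftQ _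
    (Finsupp.linearCombination ℤ fun e : X.E =>
      Finsupp.single (X.t e) (1 : ℤ) - Finsupp.single (X.o e) 1)
    (by
      rw [Submodule.span_le]
      rintro _ ⟨e, rfl⟩
      simp [X.o_rev, X.t_rev])

/-- `H₁(X, ℤ)`. As `X` has no cells of dimension two, this is the kernel of the boundary map. -/
abbrev H₁ (X : SerreGraph) : Type _ := LinearMap.ker X.boundary

/-- The genus of a graph: the rank of its first homology group. -/
def genus (X : SerreGraph) : ℕ := Module.finrank ℤ X.H₁

end SerreGraph

/-! ### Congruence subgroups -/

/-- The subgroup of those matrices in `GL₂(R)` whose lower left entry is divisible by `x`. -/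
def Gamma0GL {R : Type*} [CommRing R] (x : R) : Subgroup (GL (Fin 2) R) where
  carrier := {g | x ∣ g 1 0}
  one_mem' := by simp
  mul_mem' := by
    intro a b ha hb
    simp only [Set.mem_ofPred_eq] at ha hb ⊢
    simp only [Units.val_mul, Matrix.mul_apply, Fin.sum_univ_two]
    exact dvd_add (ha.mul_right _) (hb.mul_left _)
  inv_mem' := by
    intro a ha
    simp only [Set.mem_ofPred_eq] at ha ⊢
    rw [Matrix.coe_units_inv, Matrix.inv_def, Matrix.adjugate_fin_two]
    simp only [Matrix.smul_apply, Matrix.of_apply, Matrix.cons_val_one, Matrix.cons_val_zero,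
      smul_eq_mul]
    exact ((dvd_neg.mpr ha)).mul_left _

/-- The Hecke congruence group `Γ₀(𝔫) ⊆ GL₂(F[T])`. -/
abbrev Gamma0 {F : Type*} [Field F] (n : F[X]) : Subgroup (GL (Fin 2) F[X]) := Gamma0GL n

/-- `Γ₀¹(𝔫) = Γ₀(𝔫) ∩ SL₂(F[T])`. -/
def Gamma01 {F : Type*} [Field F] (n : F[X]) : Subgroup (GL (Fin 2) F[X]) :=
  Gamma0 n ⊓ (Matrix.GeneralLinearGroup.det (n := Fin 2) (R := F[X])).ker

/-! ### The Bruhat-Tits tree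

The field `F⸨X⸩` of Laurent series plays the role of `F_∞ = F((1/T))`: its variable is `1/T`, and
its ring of integers is `F⟦X⟧`. -/

variable (F : Type u) [Field F]

/-- `GL₂(F_∞)` -/
abbrev GLInf : Type _ := GL (Fin 2) F⸨X⸩

/-- The embedding of `F[T]` into `F_∞`; it sends `T` to the inverse of the variable of `F_∞`. -/
def polyToInf : F[X] →+* F⸨X⸩ :=
  Polynomial.eval₂RingHom HahnSeries.C (HahnSeries.single (-1 : ℤ) (1 : F))

/-- The embedding of `GL₂(F[T])` into `GL₂(F_∞)`. -/
def polyGL : GL (Fin 2) F[X] →* GLInf F := Matrix.GeneralLinearGroup.map (polyToInf F)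

/-- The embedding of `GL₂(O_∞)` into `GL₂(F_∞)`. -/
def intGL : GL (Fin 2) F⟦X⟧ →* GLInf F :=
  Matrix.GeneralLinearGroup.map (HahnSeries.ofPowerSeries ℤ F)

/-- `GL₂(O_∞) · Z(F_∞)` -/
def vertexGroup : Subgroup (GLInf F) := (intGL F).range ⊔ Subgroup.center (GLInf F)

/-- The Iwahori subgroup: the matrices in `GL₂(O_∞)` with lower left entry in `T⁻¹ O_∞`. -/
def iwahori : Subgroup (GLInf F) := (Gamma0GL (PowerSeries.X : F⟦X⟧)).map (intGL F)

/-- `I · Z(F_∞)` with `I` the Iwahori subgroup. -/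
def edgeGroup : Subgroup (GLInf F) := iwahori F ⊔ Subgroup.center (GLInf F)

/-- The matrix with rows `(0, 1)` and `(T⁻¹, 0)`. It normalizes the Iwahori subgroup and its
square is scalar. -/
def edgeFlip : GLInf F :=
  Matrix.GeneralLinearGroup.mkOfDetNeZero !![0, 1; HahnSeries.single (1 : ℤ) (1 : F), 0]
    (by simp [Matrix.det_fin_two])

lemma intGL_le_of_mem_iwahori : iwahori F ≤ (intGL F).range := by
  rintro _ ⟨k, -, rfl⟩
  exact ⟨k, rfl⟩

lemma edgeGroup_le_vertexGroup : edgeGroup F ≤ vertexGroup F :=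
  sup_le_sup_right (intGL_le_of_mem_iwahori F) _

lemma edgeFlip_conj_mem {h : GLInf F} (hh : h ∈ edgeGroup F) :
    (edgeFlip F)⁻¹ * h * edgeFlip F ∈ edgeGroup F := by
  obtain ⟨k, hk, z, hz, rfl⟩ := Subgroup.mem_sup_of_normal_right.mp hh
  obtain ⟨m, ⟨c, hc⟩, rfl⟩ := hk
  have hdet : (!![m 1 1, c; PowerSeries.X * m 0 1, m 0 0] : Matrix (Fin 2) (Fin 2) F⟦X⟧).det
      = (m : Matrix (Fin 2) (Fin 2) F⟦X⟧).det := by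
    rw [Matrix.det_fin_two, Matrix.det_fin_two, hc]
    simp
    ring
  have hu : IsUnit (!![m 1 1, c; PowerSeries.X * m 0 1, m 0 0] :
      Matrix (Fin 2) (Fin 2) F⟦X⟧).det := by
    rw [hdet]
    exact (Matrix.isUnit_iff_isUnit_det _).mp m.isUnit
  obtain ⟨m', hm'⟩ : ∃ m' : GL (Fin 2) F⟦X⟧, (m' : Matrix (Fin 2) (Fin 2) F⟦X⟧) =
      !![m 1 1, c; PowerSeries.X * m 0 1, m 0 0] :=
    ⟨Matrix.GeneralLinearGroup.mk'' _ hu, rfl⟩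
  have key : intGL F m * edgeFlip F = edgeFlip F * intGL F m' := by
    ext i j
    fin_cases i <;> fin_cases j <;>
      simp [intGL, edgeFlip, hm', Matrix.mul_apply, Fin.sum_univ_two, hc,
        Matrix.GeneralLinearGroup.mkOfDetNeZero, mul_comm]
  have hzc := (Subgroup.mem_center_iff.mp hz) (edgeFlip F)
  have : (edgeFlip F)⁻¹ * (intGL F m * z) * edgeFlip F = intGL F m' * z := by
    rw [mul_assoc, mul_assoc, ← hzc, ← mul_assoc (intGL F m), key]
    group
  rw [this]
  exact Subgroup.mem_sup_of_normal_right.mpr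
    ⟨_, ⟨m', by simp [Gamma0GL, hm'], rfl⟩, z, hz, rfl⟩

lemma edgeFlip_mul_self_mem : edgeFlip F * edgeFlip F ∈ Subgroup.center (GLInf F) := by
  rw [Matrix.GeneralLinearGroup.mem_center_iff_val_mem_range_scalar]
  refine ⟨HahnSeries.single (1 : ℤ) (1 : F), ?_⟩
  ext i j
  fin_cases i <;> fin_cases j <;>
    simp [edgeFlip, Matrix.mul_apply, Matrix.GeneralLinearGroup.mkOfDetNeZero]

/-- The order of vanishing of the determinant. -/
def detOrder (g : GLInf F) : ℤ := HahnSeries.order (g : Matrix (Fin 2) (Fin 2) F⸨X⸩).det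

lemma det_ne_zero' (g : GLInf F) : (g : Matrix (Fin 2) (Fin 2) F⸨X⸩).det ≠ 0 :=
  ((Matrix.isUnit_iff_isUnit_det _).mp g.isUnit).ne_zero

lemma detOrder_mul (g h : GLInf F) : detOrder F (g * h) = detOrder F g + detOrder F h := by
  rw [detOrder, Units.val_mul, Matrix.det_mul,
    HahnSeries.order_mul (det_ne_zero' F g) (det_ne_zero' F h)]
  rfl

lemma detOrder_edgeFlip : detOrder F (edgeFlip F) = 1 := by
  simp [detOrder, edgeFlip, Matrix.GeneralLinearGroup.mkOfDetNeZero, Matrix.det_fin_two,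
    HahnSeries.order_single]

lemma detOrder_polyGL (g : GL (Fin 2) F[X]) : detOrder F (polyGL F g) = 0 := by
  obtain ⟨c, -, hc⟩ := Polynomial.isUnit_iff.mp ((Matrix.isUnit_iff_isUnit_det _).mp g.isUnit)
  have : ((polyGL F g : GLInf F) : Matrix (Fin 2) (Fin 2) F⸨X⸩).det
      = polyToInf F (g : Matrix (Fin 2) (Fin 2) F[X]).det := by
    rw [RingHom.map_det]
    rfl
  rw [detOrder, this, ← hc]
  have hC : polyToInf F (C c) = HahnSeries.C c := by simp [polyToInf]
  rw [hC, HahnSeries.order_C]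

lemma detOrder_intGL (g : GL (Fin 2) F⟦X⟧) : detOrder F (intGL F g) = 0 := by
  have nonneg : ∀ g : GL (Fin 2) F⟦X⟧, 0 ≤ detOrder F (intGL F g) := by
    intro g
    have : ((intGL F g : GLInf F) : Matrix (Fin 2) (Fin 2) F⸨X⸩).det
        = HahnSeries.ofPowerSeries ℤ F (g : Matrix (Fin 2) (Fin 2) F⟦X⟧).det := by
      rw [RingHom.map_det]
      rfl
    have h0 := det_ne_zero' F (intGL F g)
    rw [detOrder]
    by_contra! hlt
    have hc := HahnSeries.coeff_order_eq_zero.not.mpr h0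
    apply hc
    generalize HahnSeries.order ((intGL F g : GLInf F) : Matrix (Fin 2) (Fin 2) F⸨X⸩).det = k
      at hlt
    rw [this, HahnSeries.ofPowerSeries_apply]
    apply HahnSeries.embDomain_of_notMem_range
    rintro ⟨n, hn⟩
    have : (n : ℤ) = k := hn
    omega
  have h1 := nonneg g
  have h2 := nonneg g⁻¹
  have h3 := detOrder_mul F (intGL F g) (intGL F g⁻¹)
  rw [← map_mul, mul_inv_cancel, map_one] at h3
  have h4 : detOrder F 1 = 0 := by simp [detOrder]
  omega

lemma even_detOrder_of_mem {h : GLInf F} (hh : h ∈ vertexGroup F) : Even (detOrder F h) := by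
  obtain ⟨k, ⟨m, rfl⟩, z, hz, rfl⟩ := Subgroup.mem_sup_of_normal_right.mp hh
  rw [detOrder_mul, detOrder_intGL, zero_add]
  obtain ⟨a, ha⟩ := Matrix.GeneralLinearGroup.mem_center_iff_val_mem_range_scalar.mp hz
  have h0 := det_ne_zero' F z
  have hd : (z : Matrix (Fin 2) (Fin 2) F⸨X⸩).det = a * a := by
    rw [← ha]
    simp [sq]
  have ha0 : a ≠ 0 := by
    rintro rfl
    exact h0 (by simp [hd])
  exact ⟨a.order, by rw [detOrder, hd, HahnSeries.order_mul ha0 ha0]⟩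

/-- The vertices of the Bruhat-Tits tree. -/
abbrev TreeVertex : Type _ := GLInf F ⧸ vertexGroup F

/-- The oriented edges of the Bruhat-Tits tree. -/
abbrev TreeEdge : Type _ := GLInf F ⧸ edgeGroup F

/-- The origin of the edge `g I Z` is the vertex `g GL₂(O_∞) Z`. -/
def treeOrigin : TreeEdge F → TreeVertex F :=
  Subgroup.quotientMapOfLE (edgeGroup_le_vertexGroup F)

/-- Reversal of edges, `g I Z ↦ g w I Z` with `w` the matrix with rows `(0, 1)`, `(T⁻¹, 0)`.
For instance the edge from the class of `diag(Tⁱ, 1)` to that of `diag(Tⁱ⁺¹, 1)` is that of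
`g = diag(Tⁱ, 1)`. -/
def treeRev : TreeEdge F → TreeEdge F :=
  Quotient.map' (fun g => g * edgeFlip F) (by
    intro a b hab
    rw [QuotientGroup.leftRel_apply] at hab ⊢
    have := edgeFlip_conj_mem F hab
    simpa [mul_assoc] using this)

lemma treeRev_treeRev (e : TreeEdge F) : treeRev F (treeRev F e) = e := by
  induction e using QuotientGroup.induction_on with
  | H g =>
    refine QuotientGroup.eq.mpr ?_
    have h : edgeFlip F * edgeFlip F ∈ edgeGroup F :=
      Subgroup.mem_sup_right (edgeFlip_mul_self_mem F)
    have := (edgeGroup F).inv_mem h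
    simpa [mul_assoc] using this

lemma treeOrigin_smul (x : GLInf F) (e : TreeEdge F) :
    treeOrigin F (x • e) = x • treeOrigin F e := by
  induction e using QuotientGroup.induction_on with
  | H g => rfl

lemma treeRev_smul (x : GLInf F) (e : TreeEdge F) : treeRev F (x • e) = x • treeRev F e := by
  induction e using QuotientGroup.induction_on with
  | H g =>
    refine congrArg (QuotientGroup.mk (s := edgeGroup F)) ?_
    simp [mul_assoc]

/-- Elements of `GL₂(F[T])` act on the tree without inversion. -/
lemma treeRev_ne_smul (x : GL (Fin 2) F[X]) (e : TreeEdge F) :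
    treeRev F e ≠ polyGL F x • e := by
  induction e using QuotientGroup.induction_on with
  | H g =>
    intro h
    have h' : (g * edgeFlip F)⁻¹ * (polyGL F x * g) ∈ edgeGroup F := QuotientGroup.eq.mp h
    have hev := even_detOrder_of_mem F (edgeGroup_le_vertexGroup F h')
    have e1 := detOrder_mul F (g * edgeFlip F) ((g * edgeFlip F)⁻¹ * (polyGL F x * g))
    rw [mul_inv_cancel_left, detOrder_mul, detOrder_mul, detOrder_polyGL, detOrder_edgeFlip] at e1
    obtain ⟨r, hr⟩ := hev
    omega

/-- The Bruhat-Tits tree `𝒯` of `PGL₂(F_∞)`. -/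
def bruhatTitsTree : SerreGraph where
  V := TreeVertex F
  E := TreeEdge F
  o := treeOrigin F
  t e := treeOrigin F (treeRev F e)
  rev := treeRev F
  rev_rev := treeRev_treeRev F
  rev_ne e := by simpa using treeRev_ne_smul F 1 e
  o_rev _ := rfl

variable {F}

/-- The quotient graph `Γ \ 𝒯` for a subgroup `Γ` of `GL₂(F[T])`, which acts on `𝒯` by left
multiplication: its vertices and oriented edges are the `Γ`-orbits of vertices and of oriented edges
of `𝒯`. -/
def quotientGraph (Γ : Subgroup (GL (Fin 2) F[X])) : SerreGraph where
  V := MulAction.orbitRel.Quotient (Γ.map (polyGL F)) (TreeVertex F)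
  E := MulAction.orbitRel.Quotient (Γ.map (polyGL F)) (TreeEdge F)
  o := Quotient.map' (bruhatTitsTree F).o (by
    rintro _ e ⟨x, rfl⟩
    exact ⟨x, (treeOrigin_smul F x e).symm⟩)
  t := Quotient.map' (bruhatTitsTree F).t (by
    rintro _ e ⟨x, rfl⟩
    refine ⟨x, ?_⟩
    have h := treeOrigin_smul F x (treeRev F e)
    rw [← treeRev_smul] at h
    exact h.symm)
  rev := Quotient.map' (bruhatTitsTree F).rev (by
    rintro _ e ⟨x, rfl⟩
    exact ⟨x, (treeRev_smul F x e).symm⟩)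
  rev_rev e := by
    induction e using Quotient.inductionOn' with
    | h e => exact congrArg Quotient.mk'' (treeRev_treeRev F e)
  rev_ne e := by
    induction e using Quotient.inductionOn' with
    | h e =>
      intro h
      obtain ⟨⟨y, hy⟩, hxy⟩ := Quotient.exact' h
      obtain ⟨x, _, rfl⟩ := hy
      exact treeRev_ne_smul F x e hxy.symm
  o_rev e := by
    induction e using Quotient.inductionOn' with
    | h e => rfl

/-! ### Arithmetic functions of the level -/

/-- Two unimodular pairs over `R` are equivalent when they differ by a unit of `R`. -/
def P1Setoid (R : Type*) [CommRing R] : Setoid {w : R × R // IsCoprime w.1 w.2} where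
  r w w' := ∃ c : Rˣ, w'.1 = (c : R) • w.1
  iseqv :=
    { refl := fun _ => ⟨1, by simp⟩
      symm := by
        rintro w w' ⟨c, hc⟩
        exact ⟨c⁻¹, by rw [hc, smul_smul]; simp⟩
      trans := by
        rintro w w' w'' ⟨c, hc⟩ ⟨c', hc'⟩
        exact ⟨c' * c, by rw [hc', hc, smul_smul]; simp⟩ }

/-- The projective line `ℙ¹(R)`: classes `(u : v)` with `R u + R v = R`. -/
def P1 (R : Type*) [CommRing R] : Type _ := Quotient (P1Setoid R)

/-- `ε(𝔫) = #ℙ¹(A/𝔫)` with `A = F[T]`. -/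
def levelEps (n : F[X]) : ℕ := Nat.card (P1 (F[X] ⧸ Ideal.span {n}))

/-- The absolute value `|a| = q ^ deg a` of a nonzero polynomial. -/
def polyAbs [Fintype F] (a : F[X]) : ℕ := Fintype.card F ^ a.natDegree

/-- `κ`, for the level `∏ pᵢ ^ rᵢ`. -/
def levelKappa [Fintype F] {s : ℕ} (p : Fin s → F[X]) (r : Fin s → ℕ) : ℕ :=
  ∏ i, (polyAbs (p i) ^ ((r i - 1) / 2) + polyAbs (p i) ^ (r i / 2))

open Classical in
/-- `1` if all `pᵢ` have even degree, and `0` otherwise. -/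
def levelMe {s : ℕ} (p : Fin s → F[X]) : ℕ := if ∀ i, Even (p i).natDegree then 1 else 0

end

-- Fix a subgroup `D` of `Fˣ`, and let Γ be the group of matrices in Γ₀(𝔫) with determinant in `D`
-- (`congruenceGroup`). The two groups of the theorem are the cases `⊥` and `⊤`, and both genera
-- come from one formula, `genus_congruenceGroup`.
--
-- The group G of all matrices over F[T] with determinant in `D` acts on the tree with a half line
-- as quotient, its vertices being the classes of diag(Tⁱ, 1) (`exists_reduction`,
-- `exists_edge_reduction`, `stabilizer_vertex`). Since Γ\G is ℙ¹(A/𝔫), the part of Γ\𝒯 above a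
-- vertex or edge of the half line is the set of orbits of its stabilizer on ℙ¹(A/𝔫)
-- (`orbitPoint_eq_iff`). The stabilizer of vertex 0 consists of constant matrices. That of edge i,
-- and of vertex i for i ≥ 1, consists of upper triangular matrices whose upper right entry has
-- degree at most i. These Borel groups increase with i, and from degree deg 𝔫 on their orbits no
-- longer change; the stable orbits are the cusps.
--
-- So above layer 0 edges only merge on the way up: from each vertex of layer i ≥ 1 exactly one edge
-- goes up. A cycle is then determined by its part in layer 0, and such a part extends to a cycle
-- exactly when it vanishes in the bottom vertices and in the cusps (`Layering.homologyEquiv`). As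
-- the graph is connected, genus = 1 + E - V - c, with E bottom edges, V bottom vertices and c cusps
-- (`Layering.genus_add_card`).
--
-- The three numbers come from Burnside's lemma. E counts the orbits of the constant group on
-- ℙ¹(A/𝔫) × ℙ¹(F), so |G₀|(E - V) is the sum of φ(g)(θ(g) - 1), with φ and θ the numbers of fixed
-- points on ℙ¹(A/𝔫) and ℙ¹(F) and G₀ the constant group. The factor θ - 1 is q, 0, 1, -1 on scalar,
-- parabolic, split and nonsplit elements, so parabolic elements drop out. On the others φ is ε(𝔫),
-- 2ˢ and 2ˢ me(𝔫) (`card_fixedBy_level_disc`), and the sizes of the classes follow from the double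
-- transitivity of G₀ on ℙ¹(F). For the cusps, a triangular matrix with distinct diagonal entries
-- has 2ˢ fixed points, while unipotent matrices have κ(𝔫) on average
-- (`sum_card_fixedBy_level_unip`).

universe u

/-! ### Homology of layered graphs -/

/-- The map of free abelian groups induced by a coarsening of equivalence relations. -/
noncomputable def coarsen {X : Type*} {r r' : Setoid X} (h : r ≤ r') :
    (Quotient r →₀ ℤ) →ₗ[ℤ] (Quotient r' →₀ ℤ) :=
  Finsupp.lmapDomain ℤ ℤ (Quotient.map' id h)

@[simp] lemma coarsen_single {X : Type*} {r r' : Setoid X} (h : r ≤ r') (x : X) (k : ℤ) :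
    coarsen h (Finsupp.single (Quotient.mk r x) k) = Finsupp.single (Quotient.mk r' x) k := by
  simp [coarsen, Finsupp.lmapDomain_apply, Finsupp.mapDomain_single]

/-- Two linear maps out of the free abelian group on a quotient agree if they agree on classes. -/
lemma quotFinsupp_hom_ext {X M : Type*} [AddCommGroup M] {r : Setoid X}
    {f g : (Quotient r →₀ ℤ) →ₗ[ℤ] M}
    (h : ∀ x, f (Finsupp.single (Quotient.mk r x) 1) = g (Finsupp.single (Quotient.mk r x) 1)) :
    f = g := by
  refine Finsupp.lhom_ext' fun y => LinearMap.ext_ring ?_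
  induction y using Quotient.inductionOn with
  | h x => exact h x

/-- A description of a graph as a union of layers `i = 0, 1, 2, …`: both the vertices and the
upward edges of each layer are classes of elements of `X`, an edge of layer `i` going from layer `i`
to layer `i + 1`. For `i ≥ 1` the edges of layer `i` are in bijection with its vertices, and the
equivalence relations are eventually constant. -/
structure Layering (Q : SerreGraph.{u}) (X : Type*) where
  /-- the vertices of layer `i` -/
  vx : ℕ → X → Q.V
  /-- the upward edges of layer `i` -/
  ed : ℕ → X → Q.E
  /-- equality of vertices in the bottom layer -/
  bot : Setoid X
  /-- equality of edges in layer `i`, and of vertices in layer `i ≥ 1` -/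
  rel : ℕ → Setoid X
  /-- the stable relation -/
  top : Setoid X
  exists_vx : ∀ v, ∃ i x, v = vx i x
  exists_ed : ∀ e, ∃ i x, e = ed i x ∨ e = Q.rev (ed i x)
  o_ed : ∀ i x, Q.o (ed i x) = vx i x
  t_ed : ∀ i x, Q.t (ed i x) = vx (i + 1) x
  level_eq : ∀ i j x y, vx i x = vx j y → i = j
  vx_zero : ∀ x y, vx 0 x = vx 0 y ↔ bot x y
  vx_succ : ∀ i x y, vx (i + 1) x = vx (i + 1) y ↔ rel (i + 1) x y
  ed_eq : ∀ i x y, ed i x = ed i y ↔ rel i x y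
  rel_zero_le : rel 0 ≤ bot
  rel_mono : ∀ i, rel i ≤ rel (i + 1)
  rel_le_top : ∀ i, rel i ≤ top
  /-- the layer from which on the relations are constant -/
  depth : ℕ
  rel_eq_top : ∀ i, depth ≤ i → rel i = top

namespace Layering

variable {Q : SerreGraph.{u}} {X : Type*} (L : Layering Q X)

lemma ed_level {i j : ℕ} {x y : X} (h : L.ed i x = L.ed j y) : i = j :=
  L.level_eq i j x y (by rw [← L.o_ed, h, L.o_ed])

/-- An upward edge raises the layer by one and a reversed one lowers it. -/
lemma ed_ne_rev (i j : ℕ) (x y : X) : L.ed i x ≠ Q.rev (L.ed j y) := by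
  intro h
  have h1 := L.level_eq i (j + 1) x y (by rw [← L.o_ed, h, Q.o_rev, L.t_ed])
  have h2 := L.level_eq (i + 1) j x y (by rw [← L.t_ed, h, Q.t_rev, L.o_ed])
  omega

/-- The class of an oriented edge in the group of chains. -/
noncomputable def _root_.SerreGraph.edgeChain (Q : SerreGraph.{u}) (e : Q.E) : Q.C₁ :=
  Submodule.Quotient.mk (Finsupp.single e 1)

lemma _root_.SerreGraph.edgeChain_rev (Q : SerreGraph.{u}) (e : Q.E) :
    Q.edgeChain (Q.rev e) = - Q.edgeChain e := by
  rw [eq_neg_iff_add_eq_zero, add_comm]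
  exact (Submodule.Quotient.mk_eq_zero _).mpr (Submodule.subset_span ⟨e, rfl⟩)

lemma _root_.SerreGraph.boundary_edgeChain (Q : SerreGraph.{u}) (e : Q.E) :
    Q.boundary (Q.edgeChain e) = Finsupp.single (Q.t e) 1 - Finsupp.single (Q.o e) 1 := by
  simp only [SerreGraph.boundary, SerreGraph.edgeChain]
  erw [Submodule.liftQ_apply]
  simp

lemma _root_.SerreGraph.chain_induction {Q : SerreGraph.{u}} {P : Q.C₁ → Prop} (c : Q.C₁)
    (zero : P 0) (add : ∀ a b, P a → P b → P (a + b)) (neg : ∀ a, P a → P (-a))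
    (edge : ∀ e, P (Q.edgeChain e)) : P c := by
  obtain ⟨c, rfl⟩ := Submodule.Quotient.mk_surjective _ c
  induction c using Finsupp.induction_linear with
  | zero => exact zero
  | add f g hf hg => exact add _ _ hf hg
  | single e k =>
    have hk : (Submodule.Quotient.mk (Finsupp.single e k) : Q.C₁) = k • Q.edgeChain e := by
      rw [SerreGraph.edgeChain, ← Submodule.Quotient.mk_smul]
      simp
    rw [hk]
    clear hk
    induction k using Int.induction_on with
    | zero => simpa using zero
    | succ i ih =>
      rw [add_smul, one_smul]
      exact add _ _ ih (edge e)
    | pred i ih =>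
      rw [sub_smul, one_smul, sub_eq_add_neg]
      exact add _ _ ih (neg _ (edge e))

lemma chain_induction {P : Q.C₁ → Prop} (c : Q.C₁)
    (zero : P 0) (add : ∀ a b, P a → P b → P (a + b)) (neg : ∀ a, P a → P (-a))
    (edge : ∀ i x, P (Q.edgeChain (L.ed i x))) : P c := by
  refine SerreGraph.chain_induction c zero add neg fun e => ?_
  obtain ⟨i, x, rfl | rfl⟩ := L.exists_ed e
  · exact edge i x
  · rw [Q.edgeChain_rev]
    exact neg _ (edge i x)

/-- The chain of edges of layer `i` given by a combination of classes. -/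
noncomputable def incl (i : ℕ) : (Quotient (L.rel i) →₀ ℤ) →ₗ[ℤ] Q.C₁ :=
  Finsupp.linearCombination ℤ (Quotient.lift (fun x => Q.edgeChain (L.ed i x))
    fun x y h => by
      rw [(L.ed_eq i x y).mpr h])

lemma incl_single (i : ℕ) (x : X) :
    L.incl i (Finsupp.single (Quotient.mk _ x) 1) = Q.edgeChain (L.ed i x) := by
  simp [incl]

open Classical in
/-- The component of an oriented edge in layer `i`. -/
noncomputable def edgeComponent (i : ℕ) (e : Q.E) : Quotient (L.rel i) →₀ ℤ :=
  if h : ∃ x, e = L.ed i x then Finsupp.single (Quotient.mk _ h.choose) 1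
  else if h : ∃ x, e = Q.rev (L.ed i x) then -Finsupp.single (Quotient.mk _ h.choose) 1
  else 0

lemma edgeComponent_ed (i : ℕ) (x : X) :
    L.edgeComponent i (L.ed i x) = Finsupp.single (Quotient.mk _ x) 1 := by
  have h : ∃ y, L.ed i x = L.ed i y := ⟨x, rfl⟩
  rw [edgeComponent, dif_pos h]
  congr 1
  exact Quotient.sound ((L.ed_eq _ _ _).mp h.choose_spec.symm)

lemma edgeComponent_rev_ed (i : ℕ) (x : X) :
    L.edgeComponent i (Q.rev (L.ed i x)) = -Finsupp.single (Quotient.mk _ x) 1 := by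
  have h0 : ¬∃ y, Q.rev (L.ed i x) = L.ed i y := fun ⟨y, hy⟩ => L.ed_ne_rev _ _ _ _ hy.symm
  have h : ∃ y, Q.rev (L.ed i x) = Q.rev (L.ed i y) := ⟨x, rfl⟩
  rw [edgeComponent, dif_neg h0, dif_pos h]
  congr 2
  have h' := congrArg Q.rev h.choose_spec
  rw [Q.rev_rev, Q.rev_rev] at h'
  exact Quotient.sound ((L.ed_eq _ _ _).mp h'.symm)

lemma edgeComponent_of_ne {i j : ℕ} (hij : i ≠ j) (x : X) :
    L.edgeComponent i (L.ed j x) = 0 ∧ L.edgeComponent i (Q.rev (L.ed j x)) = 0 := by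
  constructor <;> rw [edgeComponent, dif_neg, dif_neg]
  · rintro ⟨y, hy⟩
    exact L.ed_ne_rev _ _ _ _ hy
  · rintro ⟨y, hy⟩
    exact hij (L.ed_level hy).symm
  · rintro ⟨y, hy⟩
    refine hij (L.ed_level (x := y) (y := x) ?_)
    rw [← Q.rev_rev (L.ed j x), hy, Q.rev_rev]
  · rintro ⟨y, hy⟩
    exact L.ed_ne_rev _ _ _ _ hy.symm

lemma edgeComponent_rev (i : ℕ) (e : Q.E) :
    L.edgeComponent i (Q.rev e) = -L.edgeComponent i e := by
  obtain ⟨j, x, rfl | rfl⟩ := L.exists_ed e <;> by_cases hij : i = j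
  · subst hij
    rw [edgeComponent_ed, edgeComponent_rev_ed]
  · rw [(L.edgeComponent_of_ne hij x).1, (L.edgeComponent_of_ne hij x).2, neg_zero]
  · subst hij
    rw [Q.rev_rev, edgeComponent_ed, edgeComponent_rev_ed, neg_neg]
  · rw [Q.rev_rev, (L.edgeComponent_of_ne hij x).1, (L.edgeComponent_of_ne hij x).2, neg_zero]

/-- The component of a chain in layer `i`. -/
noncomputable def component (i : ℕ) : Q.C₁ →ₗ[ℤ] (Quotient (L.rel i) →₀ ℤ) :=
  Submodule.liftQ _ (Finsupp.linearCombination ℤ (L.edgeComponent i)) (by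
    rw [Submodule.span_le]
    rintro _ ⟨e, rfl⟩
    simp [L.edgeComponent_rev])

lemma component_ed (i : ℕ) (x : X) :
    L.component i (Q.edgeChain (L.ed i x)) = Finsupp.single (Quotient.mk _ x) 1 := by
  simp only [component, SerreGraph.edgeChain]
  erw [Submodule.liftQ_apply]
  simp [edgeComponent_ed]

lemma component_of_ne {i j : ℕ} (hij : i ≠ j) (x : X) :
    L.component i (Q.edgeChain (L.ed j x)) = 0 := by
  simp only [component, SerreGraph.edgeChain]
  erw [Submodule.liftQ_apply]
  simp [(L.edgeComponent_of_ne hij x).1]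

open Classical in
/-- The component of a vertex in layer `i`, up to a relation `r`. -/
noncomputable def vertexComponent (i : ℕ) (r : Setoid X) (v : Q.V) : Quotient r →₀ ℤ :=
  if h : ∃ x, v = L.vx i x then Finsupp.single (Quotient.mk _ h.choose) 1 else 0

/-- The component of a `0`-chain in layer `i`, up to a relation `r`. -/
noncomputable def vcomponent (i : ℕ) (r : Setoid X) : (Q.V →₀ ℤ) →ₗ[ℤ] (Quotient r →₀ ℤ) :=
  Finsupp.linearCombination ℤ (L.vertexComponent i r)

lemma vcomponent_vx {i : ℕ} {r : Setoid X} (hr : ∀ x y, L.vx i x = L.vx i y ↔ r x y) (x : X) :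
    L.vcomponent i r (Finsupp.single (L.vx i x) 1) = Finsupp.single (Quotient.mk _ x) 1 := by
  have h : ∃ y, L.vx i x = L.vx i y := ⟨x, rfl⟩
  simp only [vcomponent, Finsupp.linearCombination_single, one_smul]
  rw [vertexComponent, dif_pos h]
  congr 1
  exact Quotient.sound ((hr _ _).mp h.choose_spec.symm)

lemma vcomponent_of_ne {i j : ℕ} (hij : i ≠ j) (r : Setoid X) (x : X) :
    L.vcomponent i r (Finsupp.single (L.vx j x) 1) = 0 := by
  simp only [vcomponent, Finsupp.linearCombination_single, one_smul]
  rw [vertexComponent, dif_neg]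
  rintro ⟨y, hy⟩
  exact hij (L.level_eq _ _ _ _ hy).symm

/-- No upward edge ends in layer 0, so only the origins of bottom edges contribute. -/
lemma vcomponent_zero_boundary (c : Q.C₁) :
    L.vcomponent 0 L.bot (Q.boundary c) = -coarsen L.rel_zero_le (L.component 0 c) := by
  induction c using L.chain_induction with
  | zero => simp
  | add a b ha hb => rw [map_add, map_add, ha, hb, map_add, map_add, neg_add]
  | neg a ha => rw [map_neg, map_neg, ha, map_neg, map_neg]
  | edge i x =>
    rw [Q.boundary_edgeChain, map_sub, L.t_ed, L.o_ed, L.vcomponent_of_ne (by omega), zero_sub]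
    rcases Nat.eq_zero_or_pos i with rfl | hi
    · rw [L.vcomponent_vx L.vx_zero, component_ed, coarsen_single]
    · rw [L.vcomponent_of_ne (by omega), L.component_of_ne (by omega), map_zero]

/-- A vertex of layer i + 1 receives the edges of layer i that merge into it and emits a single edge
of layer i + 1, with the same label. The boundary there is inflow minus outflow. -/
lemma vcomponent_succ_boundary (i : ℕ) (c : Q.C₁) :
    L.vcomponent (i + 1) (L.rel (i + 1)) (Q.boundary c) =
      coarsen (L.rel_mono i) (L.component i c) - L.component (i + 1) c := by
  induction c using L.chain_induction with
  | zero => simp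
  | add a b ha hb => simp only [map_add, ha, hb, add_sub_add_comm]
  | neg a ha => rw [map_neg, map_neg, ha, map_neg, map_neg, map_neg]; abel
  | edge j x =>
    rw [Q.boundary_edgeChain, map_sub, L.t_ed, L.o_ed]
    congr 1
    · by_cases hij : i = j
      · subst hij
        rw [L.vcomponent_vx (L.vx_succ i), component_ed, coarsen_single]
      · rw [L.vcomponent_of_ne (by omega), L.component_of_ne hij, map_zero]
    · by_cases hij : i + 1 = j
      · subst hij
        rw [L.vcomponent_vx (L.vx_succ i), component_ed]
      · rw [L.vcomponent_of_ne hij, L.component_of_ne hij]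

/-- Chains have finite support, so each one lives in finitely many layers. This is what forces
cycles to vanish at the cusps. -/
lemma eventually_eq_sum_component (c : Q.C₁) :
    ∃ N, ∀ M, N ≤ M → L.component M c = 0 ∧
      c = ∑ i ∈ Finset.range M, L.incl i (L.component i c) := by
  induction c using L.chain_induction with
  | zero => exact ⟨0, fun M _ => by simp⟩
  | add a b ha hb =>
    obtain ⟨N, hN⟩ := ha
    obtain ⟨N', hN'⟩ := hb
    refine ⟨max N N', fun M hM => ?_⟩
    obtain ⟨h1, h2⟩ := hN M (le_of_max_le_left hM)
    obtain ⟨h3, h4⟩ := hN' M (le_of_max_le_right hM)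
    refine ⟨by rw [map_add, h1, h3, add_zero], ?_⟩
    simp only [map_add, Finset.sum_add_distrib]
    rw [← h2, ← h4]
  | neg a ha =>
    obtain ⟨N, hN⟩ := ha
    refine ⟨N, fun M hM => ?_⟩
    obtain ⟨h1, h2⟩ := hN M hM
    refine ⟨by rw [map_neg, h1, neg_zero], ?_⟩
    simp only [map_neg, Finset.sum_neg_distrib]
    rw [← h2]
  | edge j x =>
    refine ⟨j + 1, fun M hM => ⟨L.component_of_ne (by omega) x, ?_⟩⟩
    rw [Finset.sum_eq_single j, component_ed, incl_single]
    · intro i _ hij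
      rw [L.component_of_ne hij, map_zero]
    · intro h
      exact absurd (Finset.mem_range.mpr (by omega)) h

lemma component_succ_of_mem {c : Q.C₁} (hc : Q.boundary c = 0) (i : ℕ) :
    L.component (i + 1) c = coarsen (L.rel_mono i) (L.component i c) := by
  have := L.vcomponent_succ_boundary i c
  rw [hc, map_zero] at this
  exact (sub_eq_zero.mp this.symm).symm

/-- The flow of a cycle into each cusp is the same through every layer. -/
lemma coarsen_top_component {c : Q.C₁} (hc : Q.boundary c = 0) (i : ℕ) :
    coarsen (L.rel_le_top i) (L.component i c) =
      coarsen (L.rel_le_top 0) (L.component 0 c) := by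
  induction i with
  | zero => rfl
  | succ i ih =>
    rw [← ih, L.component_succ_of_mem hc]
    have : coarsen (L.rel_le_top (i + 1)) ∘ₗ coarsen (L.rel_mono i) =
        coarsen (L.rel_le_top i) := quotFinsupp_hom_ext fun x => by simp
    exact LinearMap.congr_fun this _

/-- Bottom edges are mapped to the bottom vertices and to the ends. -/
noncomputable def endpoints :
    (Quotient (L.rel 0) →₀ ℤ) →ₗ[ℤ] (Quotient L.bot →₀ ℤ) × (Quotient L.top →₀ ℤ) :=
  (coarsen L.rel_zero_le).prod (coarsen (L.rel_le_top 0))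

/-- The flow into a cusp is constant in the layer, and it is zero in a layer beyond the support of
the cycle. -/
lemma endpoints_component {c : Q.C₁} (hc : Q.boundary c = 0) :
    L.endpoints (L.component 0 c) = 0 := by
  refine Prod.ext ?_ ?_
  · have := L.vcomponent_zero_boundary c
    rw [hc, map_zero] at this
    exact neg_eq_zero.mp this.symm
  · obtain ⟨N, hN⟩ := L.eventually_eq_sum_component c
    have := L.coarsen_top_component hc N
    rw [(hN N le_rfl).1, map_zero] at this
    exact this.symm

lemma component_zero_injective {c : Q.C₁} (hc : Q.boundary c = 0) (h0 : L.component 0 c = 0) :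
    c = 0 := by
  have h : ∀ i, L.component i c = 0 := by
    intro i
    induction i with
    | zero => exact h0
    | succ i ih => rw [L.component_succ_of_mem hc, ih, map_zero]
  obtain ⟨N, hN⟩ := L.eventually_eq_sum_component c
  rw [(hN N le_rfl).2]
  simp [h]

/-- The chain of edges of layer `i` above a combination of bottom edges. -/
noncomputable def lift (i : ℕ) : (Quotient (L.rel 0) →₀ ℤ) →ₗ[ℤ] Q.C₁ :=
  L.incl i ∘ₗ coarsen (monotone_nat_of_le_succ L.rel_mono (Nat.zero_le i))

/-- The vertices of layer `i` above a combination of bottom edges. -/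
noncomputable def vlift (i : ℕ) : (Quotient (L.rel 0) →₀ ℤ) →ₗ[ℤ] (Q.V →₀ ℤ) :=
  Finsupp.linearCombination ℤ (Quotient.lift (fun x => Finsupp.single (L.vx i x) (1 : ℤ))
    fun x y h => by
      rw [← L.o_ed, ← L.o_ed, (L.ed_eq i x y).mpr
        (monotone_nat_of_le_succ L.rel_mono (Nat.zero_le i) h)])

lemma boundary_lift (i : ℕ) (k : Quotient (L.rel 0) →₀ ℤ) :
    Q.boundary (L.lift i k) = L.vlift (i + 1) k - L.vlift i k := by
  have : Q.boundary ∘ₗ L.lift i = L.vlift (i + 1) - L.vlift i := by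
    refine quotFinsupp_hom_ext fun x => ?_
    simp [lift, incl_single, vlift, Q.boundary_edgeChain, L.t_ed, L.o_ed]
  exact LinearMap.congr_fun this k

lemma vlift_zero {k : Quotient (L.rel 0) →₀ ℤ} (hk : coarsen L.rel_zero_le k = 0) :
    L.vlift 0 k = 0 := by
  have : L.vlift 0 = Finsupp.linearCombination ℤ
      (Quotient.lift (fun x => Finsupp.single (L.vx 0 x) (1 : ℤ)) fun x y h => by
        rw [(L.vx_zero x y).mpr h]) ∘ₗ coarsen L.rel_zero_le :=
    quotFinsupp_hom_ext fun x => by simp [vlift]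
  rw [this, LinearMap.comp_apply, hk, map_zero]

/-- The layer is `depth + 1` and not `depth`, because vertices are governed by `rel` only in layers
at least 1, and `depth` may be 0. -/
lemma vlift_top {k : Quotient (L.rel 0) →₀ ℤ} (hk : coarsen (L.rel_le_top 0) k = 0) :
    L.vlift (L.depth + 1) k = 0 := by
  have : L.vlift (L.depth + 1) = Finsupp.linearCombination ℤ
      (Quotient.lift (fun x => Finsupp.single (L.vx (L.depth + 1) x) (1 : ℤ)) fun x y h => by
        rw [(L.vx_succ _ x y).mpr]
        rw [L.rel_eq_top _ (Nat.le_succ _)]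
        exact h) ∘ₗ coarsen (L.rel_le_top 0) :=
    quotFinsupp_hom_ext fun x => by simp [vlift]
  rw [this, LinearMap.comp_apply, hk, map_zero]

/-- The cycle with given component in the bottom layer. -/
noncomputable def toCycle (k : Quotient (L.rel 0) →₀ ℤ) : Q.C₁ :=
  ∑ i ∈ Finset.range (L.depth + 1), L.lift i k

/-- The boundaries of the layers telescope, and the two remaining terms are controlled by the two
components of `endpoints`. -/
lemma boundary_toCycle {k : Quotient (L.rel 0) →₀ ℤ} (hk : L.endpoints k = 0) :
    Q.boundary (L.toCycle k) = 0 := by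
  simp only [toCycle, map_sum, boundary_lift]
  rw [Finset.sum_range_sub (fun i => L.vlift i k), L.vlift_zero (congrArg Prod.fst hk),
    L.vlift_top (congrArg Prod.snd hk), sub_zero]

lemma component_toCycle (k : Quotient (L.rel 0) →₀ ℤ) : L.component 0 (L.toCycle k) = k := by
  simp only [toCycle, map_sum]
  have h0 : ∀ i, 0 ≠ i → L.component 0 (L.lift i k) = 0 := by
    intro i hi
    have : L.component 0 ∘ₗ L.lift i = 0 := quotFinsupp_hom_ext fun x => by
      simp [lift, incl_single, L.component_of_ne hi]
    exact LinearMap.congr_fun this k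
  rw [Finset.sum_eq_single 0 (fun i _ hi => h0 i hi.symm) (by simp)]
  have : L.component 0 ∘ₗ L.lift 0 = LinearMap.id := quotFinsupp_hom_ext fun x => by
    simp [lift, incl_single, L.component_ed]
  exact LinearMap.congr_fun this k

/-- The first homology group is the kernel of the map from bottom edges to their two ends. -/
noncomputable def homologyEquiv : Q.H₁ ≃ₗ[ℤ] LinearMap.ker L.endpoints :=
  LinearEquiv.ofBijective
    ((L.component 0 ∘ₗ (LinearMap.ker Q.boundary).subtype).codRestrict _
      fun c => L.endpoints_component c.2)
    ⟨by
      rw [← LinearMap.ker_eq_bot, LinearMap.ker_eq_bot']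
      intro c hc
      exact Subtype.ext (L.component_zero_injective c.2 (congrArg Subtype.val hc)),
    fun k => ⟨⟨L.toCycle k.1, L.boundary_toCycle k.2⟩, Subtype.ext (L.component_toCycle k.1)⟩⟩

theorem finite_homology {Q : SerreGraph.{u}} {X : Type*} (L : Layering Q X) [Finite X] :
    Module.Finite ℤ Q.H₁ :=
  Module.Finite.equiv L.homologyEquiv.symm

/-- In the cokernel of `endpoints` a bottom vertex is minus the cusp above it. By connectedness all
bottom vertices then have the same class τ, so a pair goes to its difference of degrees times τ. -/
lemma range_endpoints [Nonempty X]
    (conn : ∀ r : Setoid X, L.bot ≤ r → L.top ≤ r → ∀ x y, r x y) :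
    LinearMap.range L.endpoints = LinearMap.ker
      ((Finsupp.linearCombination ℤ (fun _ : Quotient L.bot => (1 : ℤ))).coprod
        (-Finsupp.linearCombination ℤ (fun _ : Quotient L.top => (1 : ℤ)))) := by
  apply le_antisymm
  · rw [LinearMap.range_le_ker_iff]
    refine quotFinsupp_hom_ext fun x => ?_
    simp [endpoints]
  · obtain ⟨x₀⟩ := ‹Nonempty X›
    set N := LinearMap.range L.endpoints
    have e : ∀ x, N.mkQ (Finsupp.single (Quotient.mk L.bot x) 1, 0) =
        -N.mkQ (0, Finsupp.single (Quotient.mk L.top x) 1) := by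
      intro x
      rw [eq_neg_iff_add_eq_zero, ← map_add, Submodule.mkQ_apply, Submodule.Quotient.mk_eq_zero]
      exact ⟨Finsupp.single (Quotient.mk _ x) 1, by simp [endpoints]⟩
    -- Having the same class in the cokernel is an equivalence relation. It contains `bot` by
    -- definition, and `top` by `e`.
    have key := conn (Setoid.ker fun x => N.mkQ (Finsupp.single (Quotient.mk L.bot x) 1, 0))
      (fun x y h => by
        change N.mkQ _ = N.mkQ _
        rw [show (Quotient.mk L.bot x) = Quotient.mk L.bot y from Quotient.sound h])
      (fun x y h => by
        change N.mkQ _ = N.mkQ _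
        rw [e, e, show (Quotient.mk L.top x) = Quotient.mk L.top y from Quotient.sound h])
    set τ := N.mkQ (Finsupp.single (Quotient.mk L.bot x₀) 1, 0)
    have hτ : ∀ x, N.mkQ (Finsupp.single (Quotient.mk L.bot x) 1, 0) = τ := fun x => key x x₀
    have hl : N.mkQ ∘ₗ LinearMap.inl ℤ _ _ =
        (LinearMap.toSpanSingleton ℤ _ τ) ∘ₗ
          Finsupp.linearCombination ℤ (fun _ : Quotient L.bot => (1 : ℤ)) :=
      quotFinsupp_hom_ext fun x => by simpa using hτ x
    have hr : N.mkQ ∘ₗ LinearMap.inr ℤ _ _ =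
        -((LinearMap.toSpanSingleton ℤ _ τ) ∘ₗ
          Finsupp.linearCombination ℤ (fun _ : Quotient L.top => (1 : ℤ))) :=
      quotFinsupp_hom_ext fun x => by
        have := (e x).symm.trans (hτ x)
        simp only [LinearMap.comp_apply, LinearMap.inr_apply, LinearMap.neg_apply,
          Finsupp.linearCombination_single, LinearMap.toSpanSingleton_apply, smul_eq_mul, mul_one,
          one_smul]
        rw [← this, neg_neg]
    rintro ⟨v, w⟩ hvw
    rw [LinearMap.mem_ker, LinearMap.coprod_apply, LinearMap.neg_apply] at hvw
    rw [← Submodule.Quotient.mk_eq_zero, ← Submodule.mkQ_apply,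
      show (v, w) = LinearMap.inl ℤ _ _ v + LinearMap.inr ℤ _ _ w by simp, map_add]
    have h1 := LinearMap.congr_fun hl v
    have h2 := LinearMap.congr_fun hr w
    rw [LinearMap.comp_apply, LinearMap.comp_apply] at h1
    rw [LinearMap.comp_apply, LinearMap.neg_apply, LinearMap.comp_apply] at h2
    rw [h1, h2, ← map_neg, ← map_add, hvw, map_zero]

/-- The genus of a connected layered graph. -/
theorem genus_add_card [Finite X] [Nonempty X]
    (conn : ∀ r : Setoid X, L.bot ≤ r → L.top ≤ r → ∀ x y, r x y) :
    Q.genus + Nat.card (Quotient L.bot) + Nat.card (Quotient L.top) =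
      Nat.card (Quotient (L.rel 0)) + 1 := by
  classical
  have := Fintype.ofFinite (Quotient L.bot)
  have := Fintype.ofFinite (Quotient L.top)
  have := Fintype.ofFinite (Quotient (L.rel 0))
  set θ := (Finsupp.linearCombination ℤ (fun _ : Quotient L.bot => (1 : ℤ))).coprod
        (-Finsupp.linearCombination ℤ (fun _ : Quotient L.top => (1 : ℤ))) with hθ
  have rn : ∀ {M N : Type _} [AddCommGroup M] [AddCommGroup N] [Module.Finite ℤ M]
      (f : M →ₗ[ℤ] N), Module.finrank ℤ (LinearMap.range f) + Module.finrank ℤ (LinearMap.ker f)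
        = Module.finrank ℤ M := by
    intro M N _ _ _ f
    rw [← f.quotKerEquivRange.finrank_eq, Submodule.finrank_quotient_add_finrank]
  have rn' : ∀ {M : Type _} [AddCommGroup M] [Module.Finite ℤ M]
      (f : M →ₗ[ℤ] ℤ), Module.finrank ℤ (LinearMap.range f) + Module.finrank ℤ (LinearMap.ker f)
        = Module.finrank ℤ M := by
    intro M _ _ f
    rw [← f.quotKerEquivRange.finrank_eq, Submodule.finrank_quotient_add_finrank]
  have h1 := rn L.endpoints
  have h2 := rn' θ
  have h3 : LinearMap.range θ = ⊤ := by
    rw [LinearMap.range_eq_top]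
    intro k
    obtain ⟨x₀⟩ := ‹Nonempty X›
    exact ⟨(Finsupp.single (Quotient.mk _ x₀) k, 0), by simp [hθ]⟩
  rw [L.range_endpoints conn, ← hθ] at h1
  rw [h3, finrank_top, Module.finrank_self, Module.finrank_prod,
    Module.finrank_finsupp_self, Module.finrank_finsupp_self] at h2
  rw [Module.finrank_finsupp_self] at h1
  rw [SerreGraph.genus, L.homologyEquiv.finrank_eq]
  simp only [Nat.card_eq_fintype_card]
  omega

end Layering

/-! ### The action of matrices on the projective line -/

namespace P1

variable {S R : Type*} [CommRing S] [CommRing R] [Algebra S R]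

/-- The point `(u : v)`. -/
def mk (u v : R) (h : IsCoprime u v) : P1 R := Quotient.mk (P1Setoid R) ⟨(u, v), h⟩

lemma mk_eq_mk {u v u' v' : R} {h : IsCoprime u v} {h' : IsCoprime u' v'} :
    mk u v h = mk u' v' h' ↔ ∃ c : Rˣ, u' = c * u ∧ v' = c * v := by
  refine Quotient.eq.trans ?_
  constructor
  · rintro ⟨c, hc⟩
    exact ⟨c, congrArg Prod.fst hc, congrArg Prod.snd hc⟩
  · rintro ⟨c, hc, hc'⟩
    exact ⟨c, Prod.ext hc hc'⟩

lemma exists_mk (x : P1 R) : ∃ u v h, x = mk u v h := by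
  induction x using Quotient.inductionOn with
  | h w => exact ⟨w.1.1, w.1.2, w.2, rfl⟩

/-- The point `(1 : 0)`. -/
def infty : P1 R := mk 1 0 isCoprime_one_left

lemma isCoprime_act (g : GL (Fin 2) S) {u v : R} (h : IsCoprime u v) :
    IsCoprime (algebraMap S R (g 0 0) * u + algebraMap S R (g 0 1) * v)
      (algebraMap S R (g 1 0) * u + algebraMap S R (g 1 1) * v) := by
  obtain ⟨x, y, hxy⟩ := h
  have e : (g⁻¹ : GL (Fin 2) S).1 * g.1 = 1 := by
    rw [← Units.val_mul, inv_mul_cancel, Units.val_one]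
  have e00 := congrArg (algebraMap S R) (congrFun (congrFun e 0) 0)
  have e01 := congrArg (algebraMap S R) (congrFun (congrFun e 0) 1)
  have e10 := congrArg (algebraMap S R) (congrFun (congrFun e 1) 0)
  have e11 := congrArg (algebraMap S R) (congrFun (congrFun e 1) 1)
  simp only [Matrix.mul_apply, Fin.sum_univ_two, map_add, map_mul, Matrix.one_apply_eq,
    ne_eq, zero_ne_one, one_ne_zero, not_false_eq_true, Matrix.one_apply_ne, map_zero, map_one]
    at e00 e01 e10 e11
  set i00 := algebraMap S R ((g⁻¹ : GL (Fin 2) S).1 0 0)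
  set i01 := algebraMap S R ((g⁻¹ : GL (Fin 2) S).1 0 1)
  set i10 := algebraMap S R ((g⁻¹ : GL (Fin 2) S).1 1 0)
  set i11 := algebraMap S R ((g⁻¹ : GL (Fin 2) S).1 1 1)
  refine ⟨x * i00 + y * i10, x * i01 + y * i11, ?_⟩
  linear_combination hxy + x * u * e00 + x * v * e01 + y * u * e10 + y * v * e11

instance : MulAction (GL (Fin 2) S) (P1 R) where
  smul g := Quotient.lift (fun w => mk _ _ (isCoprime_act g w.2)) (by
    rintro ⟨⟨u, v⟩, h⟩ ⟨⟨u', v'⟩, h'⟩ ⟨c, hc⟩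
    have h1 : u' = c * u := congrArg Prod.fst hc
    have h2 : v' = c * v := congrArg Prod.snd hc
    refine mk_eq_mk.mpr ⟨c, ?_, ?_⟩ <;> simp only [h1, h2] <;> ring)
  one_smul x := by
    obtain ⟨u, v, h, rfl⟩ := exists_mk x
    refine mk_eq_mk.mpr ⟨1, ?_, ?_⟩ <;> simp
  mul_smul g g' x := by
    obtain ⟨u, v, h, rfl⟩ := exists_mk x
    refine mk_eq_mk.mpr ⟨1, ?_, ?_⟩ <;>
      simp only [Units.val_mul, Matrix.mul_apply, Fin.sum_univ_two, map_add, map_mul,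
        Units.val_one] <;> ring

lemma smul_mk (g : GL (Fin 2) S) {u v : R} (h : IsCoprime u v) :
    g • mk u v h = mk _ _ (isCoprime_act g h) := rfl

lemma smul_congr {S' : Type*} [CommRing S'] [Algebra S' R] (g : GL (Fin 2) S)
    (g' : GL (Fin 2) S') (h : ∀ i j, algebraMap S R (g i j) = algebraMap S' R (g' i j))
    (x : P1 R) : g • x = g' • x := by
  obtain ⟨u, v, huv, rfl⟩ := exists_mk x
  rw [smul_mk, smul_mk]
  refine mk_eq_mk.mpr ⟨1, ?_, ?_⟩ <;> simp [h]

/-- Applied to R = A/𝔫, this makes Γ₀(𝔫) the stabilizer of the point (1 : 0). -/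
lemma smul_infty_eq_iff (g : GL (Fin 2) S) :
    g • (infty : P1 R) = infty ↔ algebraMap S R (g 1 0) = 0 := by
  rw [infty, smul_mk, mk_eq_mk]
  constructor
  · rintro ⟨c, -, h⟩
    simp only [mul_one, mul_zero, add_zero] at h
    exact (Units.mul_right_eq_zero c).mp h.symm
  · intro h
    have hu := isCoprime_act (R := R) g (isCoprime_one_left (x := 0))
    simp only [mul_one, mul_zero, add_zero, h, isCoprime_zero_right] at hu
    obtain ⟨c, hc⟩ := hu
    exact ⟨c⁻¹, by simp [← hc], by simp [h]⟩

instance [Finite R] : Finite (P1 R) := inferInstanceAs (Finite (Quotient _))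

instance : Nonempty (P1 R) := ⟨infty⟩

end P1

/-! ### Elementary matrices in GL₂. -/

namespace GLTwo

variable {S : Type*} [CommRing S]

/-- The matrix with rows `(a, b)`, `(0, d)`. -/
noncomputable def upper (a : Sˣ) (b : S) (d : Sˣ) : GL (Fin 2) S :=
  Matrix.GeneralLinearGroup.mk'' !![(a : S), b; 0, d] (by
    rw [Matrix.det_fin_two]
    simp)

/-- The matrix with rows `(1, b)`, `(0, 1)`. -/
noncomputable def unip (b : S) : GL (Fin 2) S := upper 1 b 1

/-- The matrix with rows `(0, 1)`, `(-1, 0)`. -/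
noncomputable def weyl : GL (Fin 2) S :=
  Matrix.GeneralLinearGroup.mk'' !![0, 1; -1, 0] (by
    rw [Matrix.det_fin_two]
    simp)

lemma upper_val (a : Sˣ) (b : S) (d : Sˣ) :
    (upper a b d : Matrix (Fin 2) (Fin 2) S) = !![(a : S), b; 0, d] := rfl

lemma unip_val (b : S) : (unip b : Matrix (Fin 2) (Fin 2) S) = !![1, b; 0, 1] := rfl

lemma weyl_val : (weyl : GL (Fin 2) S).1 = !![0, 1; -1, 0] := rfl

lemma det_upper (a : Sˣ) (b : S) (d : Sˣ) :
    Matrix.GeneralLinearGroup.det (upper a b d) = a * d := by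
  ext
  simp [upper_val, Matrix.det_fin_two]

lemma det_unip (b : S) : Matrix.GeneralLinearGroup.det (unip b) = 1 := by
  simp [unip, det_upper]

lemma det_weyl : Matrix.GeneralLinearGroup.det (weyl : GL (Fin 2) S) = 1 := by
  ext
  simp [weyl_val, Matrix.det_fin_two]

lemma eq_upper {g : GL (Fin 2) S} (h : g 1 0 = 0) :
    ∃ a d, g = upper a (g 0 1) d := by
  have hdet : IsUnit (g.1 0 0 * g.1 1 1) := by
    have := (Matrix.isUnit_iff_isUnit_det _).mp g.isUnit
    rwa [Matrix.det_fin_two, h, mul_zero, sub_zero] at this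
  obtain ⟨⟨a, ha⟩, ⟨d, hd⟩⟩ := IsUnit.mul_iff.mp hdet
  refine ⟨a, d, ?_⟩
  ext i j
  fin_cases i <;> fin_cases j <;> simp [upper_val, ha, hd, h]

end GLTwo

open GLTwo

/-- Once u + tv is a unit c, the translated point is (1 : w) with w = v/c, and this is reached from
(1 : 0). Applying `weyl` three times sends the vector (1, 0) to (0, 1) without a sign, so the scalar
relating the two sides is c itself. -/
lemma P1.mk_eq_smul_infty {S R : Type*} [CommRing S] [CommRing R] [Algebra S R] {u v : R}
    (h : IsCoprime u v) {t w : S} {c : Rˣ} (hc : c = u + algebraMap S R t * v)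
    (hw : algebraMap S R w = ↑c⁻¹ * v) :
    mk u v h = unip (-t) • (weyl : GL (Fin 2) S) • unip (-w) •
      (weyl : GL (Fin 2) S) • (weyl : GL (Fin 2) S) • (weyl : GL (Fin 2) S) • (infty : P1 R) := by
  have hv : v = c * algebraMap S R w := by rw [hw, Units.mul_inv_cancel_left]
  symm
  rw [infty]
  simp only [smul_mk]
  refine mk_eq_mk.mpr ⟨c, ?_, ?_⟩
  · simp [unip_val, weyl_val]
    linear_combination -hc - algebraMap S R t * hv
  · simpa [unip_val, weyl_val] using hv

/-! ### Cosets of congruence groups and points of ℙ¹(A/𝔫). -/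

section Level

variable {F : Type u} [Field F]

/-- In `F[T] / 𝔫`, every unimodular pair can be made to start with a unit. -/
lemma exists_isUnit_add_mul {n : F[X]} (hn : n ≠ 0) {u v : F[X] ⧸ Ideal.span {n}}
    (h : IsCoprime u v) : ∃ t : F[X], IsUnit (u + Ideal.Quotient.mk _ t * v) := by
  classical
  obtain ⟨u, rfl⟩ := Ideal.Quotient.mk_surjective u
  obtain ⟨v, rfl⟩ := Ideal.Quotient.mk_surjective v
  obtain ⟨x, y, hxy⟩ := h
  obtain ⟨x, rfl⟩ := Ideal.Quotient.mk_surjective x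
  obtain ⟨y, rfl⟩ := Ideal.Quotient.mk_surjective y
  rw [← map_mul, ← map_mul, ← map_add, ← map_one (Ideal.Quotient.mk _), Ideal.Quotient.eq,
    Ideal.mem_span_singleton] at hxy
  -- Let t be the product of the primes of `n` not dividing `u`. A prime of `n` dividing `u` divides
  -- neither t nor `v`, and any other prime of `n` divides t but not `u`; in both cases it does not
  -- divide u + tv.
  set s := (UniqueFactorizationMonoid.normalizedFactors n).toFinset.filter (fun p => ¬ p ∣ u)
  refine ⟨∏ p ∈ s, p, ?_⟩
  rw [← map_mul, ← map_add]
  have hc : IsCoprime (u + (∏ p ∈ s, p) * v) n := by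
    refine isCoprime_of_prime_dvd (fun hh => hn hh.2) fun z hz hz1 hz2 => ?_
    obtain ⟨p, hp, hzp⟩ := UniqueFactorizationMonoid.exists_mem_normalizedFactors_of_dvd hn
      hz.irreducible hz2
    have hpz : p ∣ z := hzp.symm.dvd
    have hpp := UniqueFactorizationMonoid.prime_of_normalized_factor p hp
    by_cases hpu : p ∣ u
    · have h1 : p ∣ (∏ p ∈ s, p) * v := (dvd_add_right hpu).mp (hpz.trans hz1)
      rcases hpp.dvd_or_dvd h1 with h2 | h2
      · obtain ⟨p', hp', hd⟩ := (Prime.dvd_finsetProd_iff hpp _).mp h2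
        simp only [s, Finset.mem_filter, Multiset.mem_toFinset] at hp'
        have hirr := (UniqueFactorizationMonoid.prime_of_normalized_factor p' hp'.1).irreducible
        exact hp'.2 (((hpp.irreducible.associated_of_dvd hirr hd).symm.dvd).trans hpu)
      · have h3 : p ∣ x * u + y * v := dvd_add (hpu.mul_left _) (h2.mul_left _)
        have h4 : p ∣ x * u + y * v - 1 := (hpz.trans hz2).trans hxy
        exact hpp.not_dvd_one ((dvd_sub_right h3).mp h4)
    · have hps : p ∈ s := Finset.mem_filter.mpr ⟨Multiset.mem_toFinset.mpr hp, hpu⟩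
      have h1 : p ∣ (∏ p ∈ s, p) * v := (Finset.dvd_prod_of_mem _ hps).mul_right _
      exact hpu ((dvd_add_left h1).mp (hpz.trans hz1))
  obtain ⟨a, b, hab⟩ := hc
  refine IsUnit.of_mul_eq_one (Ideal.Quotient.mk _ a) ?_
  rw [← map_mul, ← map_one (Ideal.Quotient.mk _), Ideal.Quotient.eq, Ideal.mem_span_singleton]
  exact ⟨-b, by linear_combination hab⟩

/-- The upper unipotent matrices over `F[T]` and the Weyl element act transitively. -/
lemma P1.induction_unip {n : F[X]} (hn : n ≠ 0) {P : P1 (F[X] ⧸ Ideal.span {n}) → Prop}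
    (h0 : P infty) (hu : ∀ (b : F[X]) x, P x → P (unip b • x))
    (hw : ∀ x, P x → P ((weyl : GL (Fin 2) F[X]) • x)) (x : P1 (F[X] ⧸ Ideal.span {n})) :
    P x := by
  obtain ⟨u, v, h, rfl⟩ := exists_mk x
  obtain ⟨t, c, hc⟩ := exists_isUnit_add_mul hn h
  obtain ⟨w, hw'⟩ := Ideal.Quotient.mk_surjective ((↑c⁻¹ : F[X] ⧸ Ideal.span {n}) * v)
  rw [mk_eq_smul_infty h hc hw']
  exact hu _ _ (hw _ (hu _ _ (hw _ (hw _ (hw _ h0)))))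

variable (D : Subgroup Fˣ)

/-- The matrices over `F[T]` with determinant in `D`. -/
noncomputable def detGroup : Subgroup (GL (Fin 2) F[X]) :=
  (D.map (Units.map (C : F →+* F[X]).toMonoidHom)).comap Matrix.GeneralLinearGroup.det

/-- The matrices over `F` with determinant in `D`. -/
noncomputable def constGroup : Subgroup (GL (Fin 2) F) := D.comap Matrix.GeneralLinearGroup.det

lemma mem_detGroup_of_det_eq_one {g : GL (Fin 2) F[X]}
    (h : Matrix.GeneralLinearGroup.det g = 1) : g ∈ detGroup D := by
  simp only [detGroup, Subgroup.mem_comap, h]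
  exact one_mem _

lemma det_map_C (g : GL (Fin 2) F) :
    Matrix.GeneralLinearGroup.det (Matrix.GeneralLinearGroup.map (C : F →+* F[X]) g) =
      Units.map (C : F →+* F[X]).toMonoidHom (Matrix.GeneralLinearGroup.det g) := by
  refine Units.ext ?_
  exact (RingHom.map_det (C : F →+* F[X]) g.1).symm

lemma units_map_C_injective :
    Function.Injective (Units.map (C : F →+* F[X]).toMonoidHom) :=
  Units.map_injective C_injective

lemma map_C_mem_detGroup {g : GL (Fin 2) F} :
    Matrix.GeneralLinearGroup.map (C : F →+* F[X]) g ∈ detGroup D ↔ g ∈ constGroup D := by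
  simp only [detGroup, constGroup, Subgroup.mem_comap, det_map_C]
  exact Subgroup.mem_map_iff_mem units_map_C_injective

lemma exists_units_map_C (a : F[X]ˣ) : ∃ c, a = Units.map (C : F →+* F[X]).toMonoidHom c := by
  obtain ⟨c, hc, h⟩ := Polynomial.isUnit_iff.mp a.isUnit
  exact ⟨hc.unit, Units.ext h.symm⟩

/-- The upper triangular matrix over `F[T]` with diagonal entries `a` and `d` in `F`. -/
noncomputable def upperC (a : Fˣ) (b : F[X]) (d : Fˣ) : GL (Fin 2) F[X] :=
  upper (Units.map (C : F →+* F[X]).toMonoidHom a) b (Units.map (C : F →+* F[X]).toMonoidHom d)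

lemma upperC_val (a : Fˣ) (b : F[X]) (d : Fˣ) :
    (upperC a b d : Matrix (Fin 2) (Fin 2) F[X]) = !![C (a : F), b; 0, C (d : F)] := rfl

lemma upperC_mul (a : Fˣ) (b : F[X]) (d a' : Fˣ) (b' : F[X]) (d' : Fˣ) :
    upperC a b d * upperC a' b' d' =
      upperC (a * a') (C (a : F) * b' + b * C (d' : F)) (d * d') := by
  ext i j : 2
  fin_cases i <;> fin_cases j <;> simp [upperC_val, Matrix.mul_apply, Fin.sum_univ_two]

lemma upperC_inv (a : Fˣ) (b : F[X]) (d : Fˣ) :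
    (upperC a b d)⁻¹ = upperC a⁻¹ (-(C ((a⁻¹ * d⁻¹ : Fˣ) : F) * b)) d⁻¹ := by
  rw [inv_eq_iff_mul_eq_one, upperC_mul]
  ext i j : 2
  have h1 : C (a : F) * C (↑a⁻¹ : F) = 1 := by rw [← C_mul, Units.mul_inv, C_1]
  have h2 : C (d : F) * C (↑d⁻¹ : F) = 1 := by rw [← C_mul, Units.mul_inv, C_1]
  have h3 : C (a : F) * -(C ((a⁻¹ * d⁻¹ : Fˣ) : F) * b) + b * C (↑d⁻¹ : F) = 0 := by
    rw [Units.val_mul, C_mul]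
    linear_combination -C (↑d⁻¹ : F) * b * h1
  fin_cases i <;> fin_cases j
  · simp [upperC_val]
  · simpa [upperC_val] using h3
  · simp [upperC_val]
  · simp [upperC_val]

lemma upperC_mem_detGroup {a d : Fˣ} {b : F[X]} : upperC a b d ∈ detGroup D ↔ a * d ∈ D := by
  simp only [detGroup, Subgroup.mem_comap, upperC, det_upper, ← map_mul]
  exact Subgroup.mem_map_iff_mem units_map_C_injective

/-- The upper triangular matrices over `F[T]` with determinant in `D` and upper right entry of
degree less than `k`. -/
noncomputable def borelGroup (k : ℕ) : Subgroup (GL (Fin 2) F[X]) where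
  carrier := {g | ∃ a b d, g = upperC a b d ∧ b.degree < k ∧ a * d ∈ D}
  one_mem' := ⟨1, 0, 1, by
    ext i j : 2
    fin_cases i <;> fin_cases j <;> simp [upperC_val], by simp, by simp⟩
  mul_mem' := by
    rintro _ _ ⟨a, b, d, rfl, hb, had⟩ ⟨a', b', d', rfl, hb', had'⟩
    refine ⟨_, _, _, upperC_mul .., ?_, ?_⟩
    · refine (degree_add_le _ _).trans_lt (max_lt ?_ ?_)
      · exact (degree_C_mul a.ne_zero).trans_lt hb'
      · rw [mul_comm]
        exact (degree_C_mul d'.ne_zero).trans_lt hb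
    · rw [mul_mul_mul_comm]
      exact mul_mem had had'
  inv_mem' := by
    rintro _ ⟨a, b, d, rfl, hb, had⟩
    refine ⟨_, _, _, upperC_inv .., ?_, ?_⟩
    · rw [degree_neg, degree_C_mul (Units.ne_zero _)]
      exact hb
    · rw [← mul_inv]
      exact inv_mem had

lemma mem_borel {k : ℕ} {g : GL (Fin 2) F[X]} :
    g ∈ borelGroup D k ↔ g ∈ detGroup D ∧ g 1 0 = 0 ∧ (g 0 1).degree < k := by
  constructor
  · rintro ⟨a, b, d, rfl, hb, had⟩
    exact ⟨(upperC_mem_detGroup D).mpr had, by simp [upperC_val], by simpa [upperC_val]⟩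
  · rintro ⟨h1, h2, h3⟩
    obtain ⟨a, d, h⟩ := eq_upper h2
    obtain ⟨a, rfl⟩ := exists_units_map_C a
    obtain ⟨d, rfl⟩ := exists_units_map_C d
    refine ⟨a, g 0 1, d, h, h3, ?_⟩
    rw [h] at h1
    exact (upperC_mem_detGroup D).mp h1

lemma borel_mono {k l : ℕ} (h : k ≤ l) : borelGroup D k ≤ borelGroup D l := by
  rintro _ ⟨a, b, d, rfl, hb, had⟩
  exact ⟨a, b, d, rfl, hb.trans_le (by exact_mod_cast h), had⟩

variable {D} {n : F[X]}

lemma orbitRel_borel_mono {k l : ℕ} (h : k ≤ l) :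
    MulAction.orbitRel (borelGroup D k) (P1 (F[X] ⧸ Ideal.span {n})) ≤
      MulAction.orbitRel (borelGroup D l) (P1 (F[X] ⧸ Ideal.span {n})) := by
  rintro x y ⟨g, rfl⟩
  exact ⟨⟨g, borel_mono D h g.2⟩, rfl⟩

/-- The relation given by the matrices of the Borel group is stable from degree `deg 𝔫` on. -/
lemma orbitRel_borel_le (hn : n ≠ 0) (k : ℕ) :
    MulAction.orbitRel (borelGroup D k) (P1 (F[X] ⧸ Ideal.span {n})) ≤
      MulAction.orbitRel (borelGroup D n.natDegree) (P1 (F[X] ⧸ Ideal.span {n})) := by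
  rintro x y ⟨⟨_, a, b, d, rfl, hb, had⟩, rfl⟩
  refine ⟨⟨upperC a (b % n) d, a, _, d, rfl, ?_, had⟩, ?_⟩
  · rw [← degree_eq_natDegree hn]
    exact EuclideanDomain.mod_lt b hn
  · change upperC a (b % n) d • y = upperC a b d • y
    refine P1.smul_congr _ _ (fun i j => ?_) y
    fin_cases i <;> fin_cases j <;> simp [upperC_val, Ideal.Quotient.algebraMap_eq]
    rw [Ideal.Quotient.eq, Ideal.mem_span_singleton]
    exact ⟨-(b / n), by linear_combination EuclideanDomain.div_add_mod b n⟩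

lemma orbitRel_borel_eq (hn : n ≠ 0) {k : ℕ} (hk : n.natDegree ≤ k) :
    MulAction.orbitRel (borelGroup D k) (P1 (F[X] ⧸ Ideal.span {n})) =
      MulAction.orbitRel (borelGroup D n.natDegree) (P1 (F[X] ⧸ Ideal.span {n})) :=
  le_antisymm (orbitRel_borel_le hn k) (orbitRel_borel_mono hk)

lemma map_C_smul (g : GL (Fin 2) F) (x : P1 (F[X] ⧸ Ideal.span {n})) :
    Matrix.GeneralLinearGroup.map (C : F →+* F[X]) g • x = g • x :=
  P1.smul_congr _ _ (fun _ _ => rfl) x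

/-- The matrices with constant entries and those of the Borel group generate a connected
relation. -/
lemma P1.connected (hn : n ≠ 0) (r : Setoid (P1 (F[X] ⧸ Ideal.span {n})))
    (h1 : MulAction.orbitRel (constGroup D) _ ≤ r)
    (h2 : MulAction.orbitRel (borelGroup D n.natDegree) _ ≤ r) (x y) : r x y := by
  suffices h : ∀ x, r x infty from r.trans (h x) (r.symm (h y))
  refine P1.induction_unip hn (r.refl _) (fun b x hx => r.trans ?_ hx) (fun x hx => r.trans ?_ hx)
  -- The entry `b` may have any degree; stability of the Borel orbits brings it below deg 𝔫.
  · refine h2 (orbitRel_borel_le hn (b.natDegree + 1) ⟨⟨unip b, ?_⟩, rfl⟩)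
    rw [mem_borel]
    refine ⟨mem_detGroup_of_det_eq_one D (det_unip b), by simp [unip_val], ?_⟩
    simpa [unip_val] using degree_le_natDegree.trans_lt (by exact_mod_cast Nat.lt_succ_self _)
  · refine h1 ⟨⟨weyl, ?_⟩, ?_⟩
    · rw [constGroup, Subgroup.mem_comap, det_weyl]
      exact one_mem _
    · change (weyl : GL (Fin 2) F) • x = (weyl : GL (Fin 2) F[X]) • x
      refine P1.smul_congr _ _ (fun i j => ?_) x
      fin_cases i <;> fin_cases j <;> simp [weyl_val]

/-- The point of `ℙ¹(A / 𝔫)` attached to a coset of the congruence group. -/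
noncomputable def cosetPoint (n : F[X]) (s : GL (Fin 2) F[X]) : P1 (F[X] ⧸ Ideal.span {n}) :=
  s⁻¹ • P1.infty

lemma cosetPoint_mul (s g : GL (Fin 2) F[X]) :
    cosetPoint n (s * g) = g⁻¹ • cosetPoint n s := by
  rw [cosetPoint, cosetPoint, mul_inv_rev, mul_smul]

/-- Γ₀(𝔫) is the stabilizer of (1 : 0), so s⁻¹(1 : 0) determines the coset Γ₀(𝔫)s. -/
lemma cosetPoint_eq_iff {s s' : GL (Fin 2) F[X]} :
    cosetPoint n s = cosetPoint n s' ↔ s * s'⁻¹ ∈ Gamma0 n := by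
  have : s * s'⁻¹ ∈ Gamma0 n ↔ (s * s'⁻¹) • (P1.infty : P1 (F[X] ⧸ Ideal.span {n})) =
      P1.infty := by
    rw [P1.smul_infty_eq_iff, Ideal.Quotient.algebraMap_eq, Ideal.Quotient.eq_zero_iff_dvd]
    rfl
  rw [this, cosetPoint, cosetPoint, inv_smul_eq_iff, mul_smul, eq_comm]

/-- The generators used for transitivity have determinant 1, so the representative can be taken in
`detGroup D` for every `D`. -/
lemma exists_cosetPoint (hn : n ≠ 0) (x : P1 (F[X] ⧸ Ideal.span {n})) :
    ∃ s, s ∈ detGroup D ∧ cosetPoint n s = x := by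
  induction x using P1.induction_unip hn with
  | h0 => exact ⟨1, one_mem _, by simp [cosetPoint]⟩
  | hu b x hx =>
    obtain ⟨s, hs, rfl⟩ := hx
    refine ⟨s * (unip b)⁻¹, mul_mem hs (inv_mem (mem_detGroup_of_det_eq_one D (det_unip b))), ?_⟩
    rw [cosetPoint_mul, inv_inv]
  | hw x hx =>
    obtain ⟨s, hs, rfl⟩ := hx
    refine ⟨s * weyl⁻¹, mul_mem hs (inv_mem (mem_detGroup_of_det_eq_one D det_weyl)), ?_⟩
    rw [cosetPoint_mul, inv_inv]

end Level

/-! ### Laurent series in `1/T` -/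

section Laurent

variable {F : Type u} [Field F]

lemma coeff_polyToInf (f : F[X]) (m : ℤ) :
    (polyToInf F f).coeff m = if m ≤ 0 then f.coeff (-m).toNat else 0 := by
  induction f using Polynomial.induction_on' with
  | add p q hp hq =>
    rw [map_add, HahnSeries.coeff_add, hp, hq]
    split_ifs <;> simp
  | monomial k a =>
    have h : polyToInf F (monomial k a) = HahnSeries.single (-(k : ℤ)) a := by
      simp only [polyToInf, coe_eval₂RingHom, eval₂_monomial, HahnSeries.single_pow, one_pow]
      rw [HahnSeries.C_mul_eq_smul]
      ext j
      by_cases hj : j = -(k : ℤ)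
      · subst hj; simp
      · simp [HahnSeries.coeff_single_of_ne, hj]
    rw [h, coeff_monomial]
    by_cases hm : m = -(k : ℤ)
    · subst hm
      simp
    · rw [HahnSeries.coeff_single_of_ne hm]
      split_ifs with h1 h2
      · omega
      · rfl
      · rfl

lemma polyToInf_injective : Function.Injective (polyToInf F) := by
  rw [injective_iff_map_eq_zero]
  intro f hf
  ext k
  have := coeff_polyToInf f (-(k : ℤ))
  rw [hf] at this
  simpa using this.symm

lemma order_polyToInf {f : F[X]} (hf : f ≠ 0) :
    (polyToInf F f).order = -(f.natDegree : ℤ) := by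
  have h0 : polyToInf F f ≠ 0 := fun h => hf (polyToInf_injective (h.trans (map_zero _).symm))
  apply le_antisymm
  · apply HahnSeries.order_le_of_coeff_ne_zero
    rw [coeff_polyToInf]
    simpa using hf
  · by_contra! hlt
    apply HahnSeries.coeff_order_eq_zero.not.mpr h0
    rw [coeff_polyToInf]
    split_ifs
    · exact coeff_eq_zero_of_natDegree_lt (by omega)
    · rfl

/-- Every Laurent series in `1/T` is a polynomial in `T` plus a series without constant term. -/
lemma exists_polynomial_part (f : F⸨X⸩) :
    ∃ P : F[X], f - polyToInf F P = 0 ∨ 1 ≤ (f - polyToInf F P).order := by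
  set N := (-f.order).toNat
  refine ⟨∑ k ∈ Finset.range (N + 1), monomial k (f.coeff (-(k : ℤ))), ?_⟩
  set P := ∑ k ∈ Finset.range (N + 1), monomial k (f.coeff (-(k : ℤ)))
  rw [or_iff_not_imp_left]
  intro h0
  by_contra! hlt
  apply HahnSeries.coeff_order_eq_zero.not.mpr h0
  generalize (f - polyToInf F P).order = m at hlt
  rw [HahnSeries.coeff_sub, coeff_polyToInf, if_pos (by omega)]
  have hP : P.coeff (-m).toNat = if (-m).toNat < N + 1 then f.coeff m else 0 := by
    simp only [P, finsetSum_coeff, coeff_monomial]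
    split_ifs with h
    · rw [Finset.sum_eq_single (-m).toNat]
      · rw [if_pos rfl]
        congr 1
        omega
      · intro b _ hb
        rw [if_neg hb]
      · intro hh
        exact absurd (Finset.mem_range.mpr h) hh
    · refine Finset.sum_eq_zero fun b hb => if_neg ?_
      have := Finset.mem_range.mp hb
      omega
  rw [hP]
  split_ifs with h
  · exact sub_self _
  · rw [sub_zero]
    exact HahnSeries.coeff_eq_zero_of_lt_order (by omega)

lemma exists_ofPowerSeries {x : F⸨X⸩} (hx : x = 0 ∨ 0 ≤ x.order) :
    ∃ y, HahnSeries.ofPowerSeries ℤ F y = x := by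
  rcases hx with rfl | hx
  · exact ⟨0, map_zero _⟩
  · obtain ⟨k, hk⟩ := Int.eq_ofNat_of_zero_le hx
    refine ⟨PowerSeries.X ^ k * x.powerSeriesPart, ?_⟩
    rw [map_mul, HahnSeries.ofPowerSeries_X_pow, ← hk]
    exact LaurentSeries.single_order_mul_powerSeriesPart x

lemma order_ofPowerSeries_nonneg (y : F⟦X⟧) : 0 ≤ (HahnSeries.ofPowerSeries ℤ F y).order := by
  by_cases h0 : HahnSeries.ofPowerSeries ℤ F y = 0
  · simp [h0]
  by_contra! hlt
  apply HahnSeries.coeff_order_eq_zero.not.mpr h0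
  generalize (HahnSeries.ofPowerSeries ℤ F y).order = k at hlt
  rw [HahnSeries.ofPowerSeries_apply]
  apply HahnSeries.embDomain_of_notMem_range
  rintro ⟨n, hn⟩
  have : (n : ℤ) = k := hn
  omega

lemma order_div {x y : F⸨X⸩} (hx : x ≠ 0) (hy : y ≠ 0) : (x / y).order = x.order - y.order := by
  have := HahnSeries.order_mul (div_ne_zero hx hy) hy
  rw [div_mul_cancel₀ _ hy] at this
  omega

lemma exists_ofPowerSeries_div {x y : F⸨X⸩} (hy : y ≠ 0) (h : x = 0 ∨ y.order ≤ x.order) :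
    ∃ z, HahnSeries.ofPowerSeries ℤ F z = x / y := by
  apply exists_ofPowerSeries
  by_cases hx : x = 0
  · simp [hx]
  · right
    rw [order_div hx hy]
    have := h.resolve_left hx
    omega

lemma exists_unit_ofPowerSeries {x : F⸨X⸩} (hx : x ≠ 0) (h : x.order = 0) :
    ∃ z : F⟦X⟧ˣ, HahnSeries.ofPowerSeries ℤ F z = x := by
  obtain ⟨z, hz⟩ := exists_ofPowerSeries (Or.inr h.ge)
  obtain ⟨w, hw⟩ := exists_ofPowerSeries_div hx (x := 1) (Or.inr (by simp [h]))
  refine ⟨⟨z, w, ?_, ?_⟩, hz⟩ <;> apply HahnSeries.ofPowerSeries_injective (Γ := ℤ) <;>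
    rw [map_mul, hz, hw, map_one] <;> field_simp

end Laurent

/-! ### Reduction theory on the tree -/

section Tree

variable {F : Type u} [Field F]

/-- The scalar matrix of a nonzero Laurent series. -/
noncomputable def scalarInf (x : F⸨X⸩) (hx : x ≠ 0) : GLInf F :=
  Matrix.GeneralLinearGroup.mkOfDetNeZero !![x, 0; 0, x] (by simp [Matrix.det_fin_two, hx])

/-- The matrix with rows `(x, f)`, `(0, 1)`. -/
noncomputable def affInf (x f : F⸨X⸩) (hx : x ≠ 0) : GLInf F :=
  Matrix.GeneralLinearGroup.mkOfDetNeZero !![x, f; 0, 1] (by simp [Matrix.det_fin_two, hx])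

variable (F) in
/-- The matrix `diag(Tⁱ, 1)`. -/
noncomputable def diagInf (i : ℕ) : GLInf F :=
  affInf (HahnSeries.single (-(i : ℤ)) 1) 0 (by simp)

lemma scalarInf_val (x : F⸨X⸩) (hx : x ≠ 0) :
    (scalarInf x hx : Matrix (Fin 2) (Fin 2) F⸨X⸩) = !![x, 0; 0, x] := rfl

lemma affInf_val (x f : F⸨X⸩) (hx : x ≠ 0) :
    (affInf x f hx : Matrix (Fin 2) (Fin 2) F⸨X⸩) = !![x, f; 0, 1] := rfl

lemma diagInf_val (i : ℕ) : (diagInf F i : Matrix (Fin 2) (Fin 2) F⸨X⸩) =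
    !![HahnSeries.single (-(i : ℤ)) 1, 0; 0, 1] := rfl

lemma polyGL_val (s : GL (Fin 2) F[X]) (i j : Fin 2) :
    (polyGL F s : Matrix (Fin 2) (Fin 2) F⸨X⸩) i j = polyToInf F (s i j) := rfl

lemma intGL_val (k : GL (Fin 2) F⟦X⟧) (i j : Fin 2) :
    (intGL F k : Matrix (Fin 2) (Fin 2) F⸨X⸩) i j = HahnSeries.ofPowerSeries ℤ F (k i j) := rfl

lemma edgeFlip_val : (edgeFlip F : Matrix (Fin 2) (Fin 2) F⸨X⸩) =
    !![0, 1; HahnSeries.single (1 : ℤ) (1 : F), 0] := rfl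

lemma scalarInf_mem_center (x : F⸨X⸩) (hx : x ≠ 0) :
    scalarInf x hx ∈ Subgroup.center (GLInf F) := by
  rw [Matrix.GeneralLinearGroup.mem_center_iff_val_mem_range_scalar]
  refine ⟨x, ?_⟩
  ext i j
  fin_cases i <;> fin_cases j <;> simp [scalarInf_val]

lemma vertex_eq_of_mul {g g' : GLInf F} (k : GL (Fin 2) F⟦X⟧) (x : F⸨X⸩) (hx : x ≠ 0)
    (h : g * intGL F k = g' * scalarInf x hx) :
    (QuotientGroup.mk g : TreeVertex F) = QuotientGroup.mk g' := by
  refine QuotientGroup.eq.mpr ?_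
  have : g⁻¹ * g' = intGL F k * (scalarInf x hx)⁻¹ := by
    rw [eq_mul_inv_iff_mul_eq, mul_assoc, ← h, inv_mul_cancel_left]
  rw [this]
  exact mul_mem (Subgroup.mem_sup_left ⟨k, rfl⟩)
    (Subgroup.mem_sup_right (inv_mem (scalarInf_mem_center x hx)))

lemma edge_eq_of_mul {g g' : GLInf F} (k : GL (Fin 2) F⟦X⟧) (hk : PowerSeries.X ∣ k 1 0)
    (x : F⸨X⸩) (hx : x ≠ 0) (h : g * intGL F k = g' * scalarInf x hx) :
    (QuotientGroup.mk g : TreeEdge F) = QuotientGroup.mk g' := by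
  refine QuotientGroup.eq.mpr ?_
  have : g⁻¹ * g' = intGL F k * (scalarInf x hx)⁻¹ := by
    rw [eq_mul_inv_iff_mul_eq, mul_assoc, ← h, inv_mul_cancel_left]
  rw [this]
  exact mul_mem (Subgroup.mem_sup_left ⟨k, hk, rfl⟩)
    (Subgroup.mem_sup_right (inv_mem (scalarInf_mem_center x hx)))

lemma exists_scalarInf {z : GLInf F} (hz : z ∈ Subgroup.center (GLInf F)) :
    ∃ x hx, z = scalarInf x hx := by
  obtain ⟨x, hx⟩ := Matrix.GeneralLinearGroup.mem_center_iff_val_mem_range_scalar.mp hz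
  have h0 := det_ne_zero' F z
  have hx0 : x ≠ 0 := by
    rintro rfl
    exact h0 (by simp [← hx])
  refine ⟨x, hx0, Units.ext ?_⟩
  rw [← hx, scalarInf_val]
  ext i j
  fin_cases i <;> fin_cases j <;> simp

lemma exists_of_vertex_eq {g g' : GLInf F}
    (h : (QuotientGroup.mk g : TreeVertex F) = QuotientGroup.mk g') :
    ∃ k x hx, g' = g * intGL F k * scalarInf x hx := by
  obtain ⟨_, ⟨k, rfl⟩, z, hz, hkz⟩ := Subgroup.mem_sup_of_normal_right.mp (QuotientGroup.eq.mp h)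
  obtain ⟨x, hx, rfl⟩ := exists_scalarInf hz
  exact ⟨k, x, hx, by rw [mul_assoc, hkz, mul_inv_cancel_left]⟩

lemma exists_of_edge_eq {g g' : GLInf F}
    (h : (QuotientGroup.mk g : TreeEdge F) = QuotientGroup.mk g') :
    ∃ k x hx, PowerSeries.X ∣ k 1 0 ∧ g' = g * intGL F k * scalarInf x hx := by
  obtain ⟨_, ⟨k, hk, rfl⟩, z, hz, hkz⟩ :=
    Subgroup.mem_sup_of_normal_right.mp (QuotientGroup.eq.mp h)
  obtain ⟨x, hx, rfl⟩ := exists_scalarInf hz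
  exact ⟨k, x, hx, hk, by rw [mul_assoc, hkz, mul_inv_cancel_left]⟩

/-- The matrix with rows `(1, 0)`, `(c, 1)`. -/
noncomputable def lowerUnip {S : Type*} [CommRing S] (c : S) : GL (Fin 2) S :=
  Matrix.GeneralLinearGroup.mk'' !![1, 0; c, 1] (by simp [Matrix.det_fin_two])

lemma lowerUnip_val {S : Type*} [CommRing S] (c : S) :
    (lowerUnip c : Matrix (Fin 2) (Fin 2) S) = !![1, 0; c, 1] := rfl

/-- The quotient of the lower entries is integral, so an integral column operation clears the lower
left entry; then divide by the lower right one. -/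
lemma vertex_eq_affInf_of_order {g : GLInf F} (hd : g 1 1 ≠ 0)
    (h : g 1 0 = 0 ∨ (g 1 1).order ≤ (g 1 0).order) :
    ∃ x f hx, (QuotientGroup.mk g : TreeVertex F) = QuotientGroup.mk (affInf x f hx) := by
  obtain ⟨z, hz⟩ := exists_ofPowerSeries_div hd h
  have hdet := det_ne_zero' F g
  rw [Matrix.det_fin_two] at hdet
  have hx : (g 0 0 * g 1 1 - g 0 1 * g 1 0) / (g 1 1) ^ 2 ≠ 0 :=
    div_ne_zero hdet (pow_ne_zero 2 hd)
  refine ⟨_, g 0 1 / g 1 1, hx, vertex_eq_of_mul (lowerUnip (-z)) (g 1 1) hd ?_⟩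
  ext i j : 2
  rw [Units.val_mul, Units.val_mul, Matrix.mul_apply, Matrix.mul_apply, Fin.sum_univ_two,
    Fin.sum_univ_two]
  simp only [intGL_val, affInf_val, scalarInf_val, lowerUnip_val]
  fin_cases i <;> fin_cases j <;> simp [hz] <;> field_simp <;> ring

lemma vertex_eq_affInf (g : GLInf F) :
    ∃ x f hx, (QuotientGroup.mk g : TreeVertex F) = QuotientGroup.mk (affInf x f hx) := by
  by_cases h : g 1 1 ≠ 0 ∧ (g 1 0 = 0 ∨ (g 1 1).order ≤ (g 1 0).order)
  · exact vertex_eq_affInf_of_order h.1 h.2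
  · have hdet := det_ne_zero' F g
    rw [Matrix.det_fin_two] at hdet
    have hswap : (QuotientGroup.mk g : TreeVertex F) = QuotientGroup.mk (g * intGL F weyl) :=
      vertex_eq_of_mul weyl 1 one_ne_zero (by
        rw [show scalarInf (1 : F⸨X⸩) one_ne_zero = 1 from Units.ext (by
          rw [scalarInf_val, Units.val_one, Matrix.one_fin_two]), mul_one])
    have e10 : (g * intGL F weyl) 1 0 = -g 1 1 := by
      rw [Units.val_mul, Matrix.mul_apply, Fin.sum_univ_two]
      simp [intGL_val, weyl_val]
    have e11 : (g * intGL F weyl) 1 1 = g 1 0 := by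
      rw [Units.val_mul, Matrix.mul_apply, Fin.sum_univ_two]
      simp [intGL_val, weyl_val]
    rw [hswap]
    apply vertex_eq_affInf_of_order
    · rw [e11]
      intro h0
      refine h ⟨fun h1 => hdet (by rw [h0, h1]; ring), Or.inl h0⟩
    · rw [e10, e11, neg_eq_zero, HahnSeries.order_neg]
      by_contra! hh
      exact h ⟨hh.1, Or.inr hh.2.le⟩

lemma vertex_diag (x : F⸨X⸩) (hx : x ≠ 0) (i : ℕ) (h : x.order = -(i : ℤ)) :
    (QuotientGroup.mk (affInf x 0 hx) : TreeVertex F) = QuotientGroup.mk (diagInf F i) := by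
  have hs : HahnSeries.single (-(i : ℤ)) (1 : F) ≠ 0 := by simp
  obtain ⟨z, hz⟩ := exists_unit_ofPowerSeries (div_ne_zero hs hx)
    (by rw [order_div hs hx, HahnSeries.order_single one_ne_zero, h, sub_self])
  refine vertex_eq_of_mul (upper z 0 1) 1 one_ne_zero ?_
  ext i j : 2
  rw [Units.val_mul, Units.val_mul, Matrix.mul_apply, Matrix.mul_apply, Fin.sum_univ_two,
    Fin.sum_univ_two]
  simp only [intGL_val, affInf_val, scalarInf_val, diagInf_val, upper_val]
  fin_cases i <;> fin_cases j <;> simp [hz]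
  field_simp

lemma vertex_diag_neg (x : F⸨X⸩) (hx : x ≠ 0) (i : ℕ) (h : x.order = i) :
    (QuotientGroup.mk (affInf x 0 hx) : TreeVertex F) =
      polyGL F weyl • (QuotientGroup.mk (diagInf F i) : TreeVertex F) := by
  have hy : x⁻¹ ≠ 0 := inv_ne_zero hx
  have ho : (x⁻¹).order = -(i : ℤ) := by
    rw [inv_eq_one_div, order_div one_ne_zero hx, h]
    simp
  rw [← vertex_diag x⁻¹ hy i ho]
  refine vertex_eq_of_mul (g' := polyGL F weyl * affInf x⁻¹ 0 hy) weyl x hx ?_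
  ext i j : 2
  rw [Units.val_mul, Units.val_mul, Units.val_mul, Matrix.mul_apply, Matrix.mul_apply,
    Fin.sum_univ_two, Fin.sum_univ_two, Matrix.mul_apply, Matrix.mul_apply, Fin.sum_univ_two,
    Fin.sum_univ_two]
  simp only [intGL_val, polyGL_val, affInf_val, scalarInf_val, weyl_val]
  fin_cases i <;> fin_cases j <;> simp [hx]

lemma polyGL_unip_mul_affInf (P : F[X]) (x f : F⸨X⸩) (hx : x ≠ 0) :
    affInf x f hx = polyGL F (unip P) * affInf x (f - polyToInf F P) hx := by
  ext i j : 2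
  rw [Units.val_mul, Matrix.mul_apply, Fin.sum_univ_two]
  simp only [polyGL_val, affInf_val, unip_val]
  fin_cases i <;> fin_cases j <;> simp

/-- This is the inversion step of the continued fraction algorithm: it replaces f by -1/f and lowers
the order of x by twice that of f. -/
lemma affInf_flip (x f : F⸨X⸩) (hx : x ≠ 0) (hf : f ≠ 0) (hlt : f.order < x.order) :
    (QuotientGroup.mk (affInf x f hx) : TreeVertex F) = polyGL F weyl •
      (QuotientGroup.mk (affInf (x / f ^ 2) (-(1 / f)) (div_ne_zero hx (pow_ne_zero 2 hf))) :
        TreeVertex F) := by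
  obtain ⟨z, hz⟩ := exists_ofPowerSeries_div hf (Or.inr hlt.le)
  refine vertex_eq_of_mul (g' := polyGL F weyl * affInf _ _ _)
    (lowerUnip (-z)) f hf ?_
  ext i j : 2
  rw [Units.val_mul, Units.val_mul, Units.val_mul, Matrix.mul_apply, Matrix.mul_apply,
    Fin.sum_univ_two, Fin.sum_univ_two, Matrix.mul_apply, Matrix.mul_apply, Fin.sum_univ_two,
    Fin.sum_univ_two]
  simp only [intGL_val, polyGL_val, affInf_val, scalarInf_val, weyl_val, lowerUnip_val]
  fin_cases i <;> fin_cases j <;> simp [hz] <;> field_simp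
  ring

/-- Every affine matrix is equivalent to some `diag(Tⁱ, 1)` under `SL₂(F[T])`. -/
lemma exists_reduction_affInf (N : ℕ) : ∀ (x f : F⸨X⸩) (hx : x ≠ 0), x.order ≤ N →
    ∃ (s : GL (Fin 2) F[X]) (i : ℕ), Matrix.GeneralLinearGroup.det s = 1 ∧
      (QuotientGroup.mk (affInf x f hx) : TreeVertex F) =
        polyGL F s • (QuotientGroup.mk (diagInf F i) : TreeVertex F) := by
  induction N using Nat.strong_induction_on with
  | _ N ih =>
  intro x f hx hN
  obtain ⟨P, hP⟩ := exists_polynomial_part f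
  rw [polyGL_unip_mul_affInf P]
  set f' := f - polyToInf F P
  suffices h : ∃ (s : GL (Fin 2) F[X]) (i : ℕ), Matrix.GeneralLinearGroup.det s = 1 ∧
      (QuotientGroup.mk (affInf x f' hx) : TreeVertex F) =
        polyGL F s • (QuotientGroup.mk (diagInf F i) : TreeVertex F) by
    obtain ⟨s, i, hs, h⟩ := h
    refine ⟨unip P * s, i, by rw [map_mul, det_unip, hs, one_mul], ?_⟩
    rw [map_mul, mul_smul, ← h]
    rfl
  -- If x divides f', a column operation removes f' and a diagonal matrix remains. Otherwise f' has
  -- order at least 1 after the removal of its polynomial part, and inversion strictly lowers the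
  -- order of x.
  by_cases hc : f' = 0 ∨ x.order ≤ f'.order
  · obtain ⟨z, hz⟩ := exists_ofPowerSeries_div hx hc
    have h0 : (QuotientGroup.mk (affInf x f' hx) : TreeVertex F) =
        QuotientGroup.mk (affInf x 0 hx) := by
      refine vertex_eq_of_mul (unip (-z)) 1 one_ne_zero ?_
      ext i j : 2
      rw [Units.val_mul, Units.val_mul, Matrix.mul_apply, Matrix.mul_apply, Fin.sum_univ_two,
        Fin.sum_univ_two]
      simp only [intGL_val, affInf_val, scalarInf_val, unip_val]
      fin_cases i <;> fin_cases j <;> simp [hz]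
      field_simp
      ring
    rw [h0]
    rcases le_or_gt x.order 0 with ho | ho
    · obtain ⟨i, hi⟩ := Int.eq_ofNat_of_zero_le (neg_nonneg.mpr ho)
      refine ⟨1, i, map_one _, ?_⟩
      rw [map_one, one_smul]
      exact vertex_diag x hx i (by omega)
    · obtain ⟨i, hi⟩ := Int.eq_ofNat_of_zero_le ho.le
      exact ⟨weyl, i, det_weyl, vertex_diag_neg x hx i hi⟩
  · push Not at hc
    have h1 := hP.resolve_left hc.1
    rw [affInf_flip x f' hx hc.1 hc.2]
    have ho : (x / f' ^ 2).order = x.order - 2 * f'.order := by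
      rw [order_div hx (pow_ne_zero 2 hc.1), HahnSeries.order_pow]
      simp
    obtain ⟨s, i, hs, h⟩ := ih (N - 1) (by omega) (x / f' ^ 2) (-(1 / f'))
      (div_ne_zero hx (pow_ne_zero 2 hc.1)) (by rw [ho]; omega)
    refine ⟨weyl * s, i, by rw [map_mul, det_weyl, hs, one_mul], ?_⟩
    rw [h, map_mul, mul_smul]

/-- Every vertex of the tree is equivalent to some `diag(Tⁱ, 1)` under `SL₂(F[T])`. -/
lemma exists_reduction (v : TreeVertex F) :
    ∃ (s : GL (Fin 2) F[X]) (i : ℕ), Matrix.GeneralLinearGroup.det s = 1 ∧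
      v = polyGL F s • (QuotientGroup.mk (diagInf F i) : TreeVertex F) := by
  induction v using QuotientGroup.induction_on with
  | H g =>
    obtain ⟨x, f, hx, h⟩ := vertex_eq_affInf g
    rw [h]
    exact exists_reduction_affInf x.order.toNat x f hx (Int.self_le_toNat _)

end Tree

/-! ### Stabilizers of the standard vertices and edges. -/

section Stabilizers

variable {F : Type u} [Field F]

/-- The order of an embedded polynomial is minus its degree, and the integral factor `y` has
nonnegative order. -/
lemma polyToInf_eq_mul {f : F[X]} {y : F⟦X⟧} {x : F⸨X⸩} (hx : x ≠ 0) {m : ℤ}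
    (h : polyToInf F f * HahnSeries.single m 1 = HahnSeries.ofPowerSeries ℤ F y * x) (hf : f ≠ 0) :
    (f.natDegree : ℤ) ≤ m - x.order := by
  have h0 : polyToInf F f ≠ 0 := fun h => hf (polyToInf_injective (h.trans (map_zero _).symm))
  have hs : HahnSeries.single m (1 : F) ≠ 0 := by simp
  have hy : HahnSeries.ofPowerSeries ℤ F y ≠ 0 := by
    intro hy
    rw [hy, zero_mul] at h
    exact mul_ne_zero h0 hs h
  have h1 := congrArg HahnSeries.order h
  rw [HahnSeries.order_mul h0 hs, HahnSeries.order_mul hy hx, order_polyToInf hf,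
    HahnSeries.order_single one_ne_zero] at h1
  have := order_ofPowerSeries_nonneg y
  omega

lemma degree_le_zero_of_dvd {f : F[X]} {y : F⟦X⟧} (hy : PowerSeries.X ∣ y) {x : F⸨X⸩} (hx : x ≠ 0)
    {m : ℤ} (h : polyToInf F f * HahnSeries.single m 1 = HahnSeries.ofPowerSeries ℤ F y * x)
    (hf : f ≠ 0) : (f.natDegree : ℤ) ≤ m - x.order - 1 := by
  obtain ⟨y, rfl⟩ := hy
  have hx1 : HahnSeries.ofPowerSeries ℤ F PowerSeries.X ≠ 0 := by
    rw [HahnSeries.ofPowerSeries_X]; simp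
  have := polyToInf_eq_mul (y := y) (x := HahnSeries.ofPowerSeries ℤ F PowerSeries.X * x)
    (mul_ne_zero hx1 hx) (m := m) (f := f) (by rw [h, map_mul]; ring) hf
  rw [HahnSeries.order_mul hx1 hx, HahnSeries.ofPowerSeries_X,
    HahnSeries.order_single one_ne_zero] at this
  omega

lemma detOrder_diagInf (i : ℕ) : detOrder F (diagInf F i) = -(i : ℤ) := by
  rw [detOrder, diagInf_val, Matrix.det_fin_two]
  simp [HahnSeries.order_single]

lemma detOrder_scalarInf (x : F⸨X⸩) (hx : x ≠ 0) :
    detOrder F (scalarInf x hx) = 2 * x.order := by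
  rw [detOrder, scalarInf_val, Matrix.det_fin_two]
  simp [HahnSeries.order_mul hx hx, two_mul]

/-- The entries of an equation `h · diag(Tⁱ, 1) = diag(Tʲ, 1) · k · x`. -/
lemma entries_of_eq {h : GL (Fin 2) F[X]} {i j : ℕ} {k : GL (Fin 2) F⟦X⟧} {x : F⸨X⸩} {hx : x ≠ 0}
    (e : polyGL F h * diagInf F i = diagInf F j * intGL F k * scalarInf x hx) :
    polyToInf F (h 0 0) * HahnSeries.single ((j : ℤ) - i) 1 =
        HahnSeries.ofPowerSeries ℤ F (k 0 0) * x ∧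
      polyToInf F (h 0 1) * HahnSeries.single (j : ℤ) 1 =
        HahnSeries.ofPowerSeries ℤ F (k 0 1) * x ∧
      polyToInf F (h 1 0) * HahnSeries.single (-(i : ℤ)) 1 =
        HahnSeries.ofPowerSeries ℤ F (k 1 0) * x ∧
      polyToInf F (h 1 1) * HahnSeries.single (0 : ℤ) 1 =
        HahnSeries.ofPowerSeries ℤ F (k 1 1) * x := by
  have e' := congrArg Units.val e
  have c : HahnSeries.single (j : ℤ) (1 : F) * HahnSeries.single (-(j : ℤ)) 1 = 1 := by
    simp [HahnSeries.single_mul_single]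
  have hij : HahnSeries.single ((j : ℤ) - i) (1 : F) =
      HahnSeries.single (j : ℤ) 1 * HahnSeries.single (-(i : ℤ)) 1 := by
    simp [HahnSeries.single_mul_single, sub_eq_add_neg]
  have e00 := congrFun (congrFun e' 0) 0
  have e01 := congrFun (congrFun e' 0) 1
  have e10 := congrFun (congrFun e' 1) 0
  have e11 := congrFun (congrFun e' 1) 1
  simp only [Units.val_mul, Matrix.mul_apply, Fin.sum_univ_two, polyGL_val, intGL_val, diagInf_val,
    scalarInf_val, Matrix.of_apply, Matrix.cons_val_zero, Matrix.cons_val_one, mul_zero, zero_mul,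
    add_zero, zero_add, mul_one, one_mul] at e00 e01 e10 e11
  refine ⟨?_, ?_, e10, ?_⟩
  · rw [hij]
    linear_combination (HahnSeries.single (j : ℤ) (1 : F)) * e00 +
      HahnSeries.ofPowerSeries ℤ F (k 0 0) * x * c
  · linear_combination (HahnSeries.single (j : ℤ) (1 : F)) * e01 +
      HahnSeries.ofPowerSeries ℤ F (k 0 1) * x * c
  · rw [HahnSeries.single_zero_one, mul_one]
    exact e11

/-- Write h·diag(Tⁱ, 1) = diag(Tʲ, 1)·k·x with k integral. Determinants give j - i = 2 ord x, and
each entry of `h` has its degree bounded in terms of i, j and ord x. Invertibility of `h` then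
forces ord x = 0. -/
lemma stabilizer_vertex {h : GL (Fin 2) F[X]} {i j : ℕ}
    (e : polyGL F h • (QuotientGroup.mk (diagInf F i) : TreeVertex F) =
      QuotientGroup.mk (diagInf F j)) :
    i = j ∧ (h 0 0).natDegree = 0 ∧ (h 0 1).natDegree ≤ i ∧ (h 1 1).natDegree = 0 ∧
      (h 1 0).natDegree = 0 ∧ (0 < i → h 1 0 = 0) := by
  obtain ⟨k, x, hx, e'⟩ := exists_of_vertex_eq e.symm
  replace e' : polyGL F h * diagInf F i = diagInf F j * intGL F k * scalarInf x hx := e'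
  have hd := congrArg (detOrder F) e'
  rw [detOrder_mul, detOrder_mul, detOrder_mul, detOrder_polyGL, detOrder_intGL,
    detOrder_scalarInf, detOrder_diagInf, detOrder_diagInf] at hd
  obtain ⟨e00, e01, e10, e11⟩ := entries_of_eq e'
  have b00 := polyToInf_eq_mul hx e00
  have b01 := polyToInf_eq_mul hx e01
  have b10 := polyToInf_eq_mul hx e10
  have b11 := polyToInf_eq_mul hx e11
  have hdet : h.1 0 0 * h.1 1 1 - h.1 0 1 * h.1 1 0 ≠ 0 := by
    have := ((Matrix.isUnit_iff_isUnit_det _).mp h.isUnit).ne_zero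
    rwa [Matrix.det_fin_two] at this
  have nd : ∀ (f : F[X]) (m : ℕ), (f ≠ 0 → f.natDegree ≤ m) → f.natDegree ≤ m := by
    intro f m hf
    by_cases h0 : f = 0
    · simp [h0]
    · exact hf h0
  have h0 : x.order = 0 := by
    -- If the lower left entry vanishes, both diagonal entries are nonzero and bound ord x from both
    -- sides. If not, ord x ≤ -i, and with j = i + 2 ord x ≥ 0 this leaves i = j = 0.
    by_cases h10 : h.1 1 0 = 0
    · rw [h10, mul_zero, sub_zero] at hdet
      have := b00 (left_ne_zero_of_mul hdet)
      have := b11 (right_ne_zero_of_mul hdet)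
      omega
    · have := b10 h10
      omega
  have hij : i = j := by omega
  subst hij
  refine ⟨rfl, Nat.le_zero.mp (nd _ _ fun h => ?_), nd _ _ fun h => ?_,
    Nat.le_zero.mp (nd _ _ fun h => ?_), Nat.le_zero.mp (nd _ _ fun h => ?_), fun hi => ?_⟩
  · have := b00 h
    omega
  · have := b01 h
    omega
  · have := b11 h
    omega
  · have := b10 h
    omega
  · by_contra h
    have := b10 h
    omega

/-- The Iwahori condition improves the bound for the lower left entry by one, which excludes a
nonzero entry even when i = 0. -/
lemma stabilizer_edge {h : GL (Fin 2) F[X]} {i j : ℕ}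
    (e : polyGL F h • (QuotientGroup.mk (diagInf F i) : TreeEdge F) =
      QuotientGroup.mk (diagInf F j)) :
    i = j ∧ h 1 0 = 0 ∧ (h 0 1).natDegree ≤ i := by
  have ev : polyGL F h • (QuotientGroup.mk (diagInf F i) : TreeVertex F) =
      QuotientGroup.mk (diagInf F j) := congrArg (treeOrigin F) e
  have hv := stabilizer_vertex ev
  obtain ⟨k, x, hx, hk, e'⟩ := exists_of_edge_eq e.symm
  replace e' : polyGL F h * diagInf F i = diagInf F j * intGL F k * scalarInf x hx := e'
  have hd := congrArg (detOrder F) e'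
  rw [detOrder_mul, detOrder_mul, detOrder_mul, detOrder_polyGL, detOrder_intGL,
    detOrder_scalarInf, detOrder_diagInf, detOrder_diagInf] at hd
  obtain ⟨rfl, -, h01, -⟩ := hv
  refine ⟨rfl, ?_, h01⟩
  by_contra h10
  have := degree_le_zero_of_dvd hk hx (entries_of_eq e').2.2.1 h10
  omega

lemma upperC_smul_edge (a : Fˣ) (b : F[X]) (d : Fˣ) (i : ℕ) (hb : b.natDegree ≤ i) :
    polyGL F (upperC a b d) • (QuotientGroup.mk (diagInf F i) : TreeEdge F) =
      QuotientGroup.mk (diagInf F i) := by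
  symm
  have hs : HahnSeries.single (-(i : ℤ)) (1 : F) ≠ 0 := by simp
  obtain ⟨z, hz⟩ := exists_ofPowerSeries_div (x := polyToInf F b) hs (by
    by_cases h0 : b = 0
    · simp [h0]
    · right
      rw [order_polyToInf h0, HahnSeries.order_single one_ne_zero]
      omega)
  refine edge_eq_of_mul (g' := polyGL F (upperC a b d) * diagInf F i)
    (upper (Units.map (PowerSeries.C (R := F)).toMonoidHom a) z
      (Units.map (PowerSeries.C (R := F)).toMonoidHom d))
    (by simp [upper_val]) 1 one_ne_zero ?_
  have hC : ∀ c : F, polyToInf F (C c) = HahnSeries.C c := fun c => by simp [polyToInf]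
  ext i j : 2
  rw [Units.val_mul, Units.val_mul, Units.val_mul, Matrix.mul_apply, Matrix.mul_apply,
    Fin.sum_univ_two, Fin.sum_univ_two, Matrix.mul_apply, Matrix.mul_apply, Fin.sum_univ_two,
    Fin.sum_univ_two]
  simp only [intGL_val, polyGL_val, diagInf_val, scalarInf_val, upperC_val, upper_val]
  fin_cases i <;> fin_cases j <;> simp [hz, hC, mul_comm]
  rw [mul_div_cancel₀ _ hs]

lemma diagInf_zero : diagInf F 0 = 1 := by
  refine Units.ext ?_
  rw [diagInf_val, Units.val_one, Matrix.one_fin_two]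
  rfl

lemma map_C_smul_vertex (g : GL (Fin 2) F) :
    polyGL F (Matrix.GeneralLinearGroup.map (C : F →+* F[X]) g) •
      (QuotientGroup.mk (diagInf F 0) : TreeVertex F) = QuotientGroup.mk (diagInf F 0) := by
  symm
  refine vertex_eq_of_mul
    (g' := polyGL F (Matrix.GeneralLinearGroup.map (C : F →+* F[X]) g) * diagInf F 0)
    (Matrix.GeneralLinearGroup.map (PowerSeries.C (R := F)) g) 1 one_ne_zero ?_
  have hC : ∀ c : F, polyToInf F (C c) = HahnSeries.C c := fun c => by simp [polyToInf]
  rw [diagInf_zero, one_mul, mul_one]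
  ext i j : 2
  rw [Units.val_mul, Matrix.mul_apply, Fin.sum_univ_two]
  simp only [intGL_val, polyGL_val, scalarInf_val]
  fin_cases j <;> simp [hC]

lemma exists_map_C {h : GL (Fin 2) F[X]} (hh : ∀ i j, (h i j).natDegree = 0) :
    ∃ g, h = Matrix.GeneralLinearGroup.map (C : F →+* F[X]) g := by
  have hc : ∀ i j, h i j = C ((h i j).coeff 0) := fun i j => eq_C_of_natDegree_eq_zero (hh i j)
  have hm : h.1 = (C : F →+* F[X]).mapMatrix (Matrix.of fun i j => (h i j).coeff 0) := by
    ext1 i j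
    exact hc i j
  have hdet : (Matrix.of fun i j => (h i j).coeff 0).det ≠ 0 := by
    intro h0
    have := ((Matrix.isUnit_iff_isUnit_det _).mp h.isUnit).ne_zero
    rw [hm, ← RingHom.map_det, h0, map_zero] at this
    exact this rfl
  exact ⟨Matrix.GeneralLinearGroup.mkOfDetNeZero _ hdet, Units.ext hm⟩

lemma terminus_diagInf (i : ℕ) :
    treeOrigin F (treeRev F (QuotientGroup.mk (diagInf F i))) =
      QuotientGroup.mk (diagInf F (i + 1)) := by
  refine vertex_eq_of_mul (g := diagInf F i * edgeFlip F) (upper 1 0 (-1) * weyl)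
    (HahnSeries.single (1 : ℤ) 1) (by simp) ?_
  ext i j : 2
  rw [Units.val_mul, Units.val_mul, Units.val_mul, Matrix.mul_apply, Matrix.mul_apply,
    Fin.sum_univ_two, Fin.sum_univ_two, Matrix.mul_apply, Matrix.mul_apply, Fin.sum_univ_two,
    Fin.sum_univ_two]
  simp only [intGL_val, edgeFlip_val, diagInf_val, scalarInf_val, Units.val_mul,
    Matrix.mul_apply, Fin.sum_univ_two, upper_val, weyl_val]
  fin_cases i <;> fin_cases j <;> simp [HahnSeries.single_mul_single]

/-- Every edge of the tree is, up to orientation, equivalent to the edge of some `diag(Tⁱ, 1)`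
under `SL₂(F[T])`. -/
lemma exists_edge_reduction (e : TreeEdge F) :
    ∃ (s : GL (Fin 2) F[X]) (i : ℕ), Matrix.GeneralLinearGroup.det s = 1 ∧
      (e = polyGL F s • (QuotientGroup.mk (diagInf F i) : TreeEdge F) ∨
        e = treeRev F (polyGL F s • (QuotientGroup.mk (diagInf F i) : TreeEdge F))) := by
  induction e using QuotientGroup.induction_on with
  | H g =>
  obtain ⟨s, i, hs, h⟩ := exists_reduction (QuotientGroup.mk g : TreeVertex F)
  obtain ⟨k, x, hx, hg⟩ := exists_of_vertex_eq (g := polyGL F s * diagInf F i) (g' := g) h.symm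
  have hone : ∀ y : GLInf F, y * scalarInf (1 : F⸨X⸩) one_ne_zero = y := fun y => by
    rw [show scalarInf (1 : F⸨X⸩) one_ne_zero = 1 from Units.ext (by
      rw [scalarInf_val, Units.val_one, Matrix.one_fin_two]), mul_one]
  have hg' : (QuotientGroup.mk g : TreeEdge F) =
      QuotientGroup.mk (polyGL F s * diagInf F i * intGL F k) :=
    (edge_eq_of_mul (1 : GL (Fin 2) F⟦X⟧) (by simp) x hx (by rw [map_one, mul_one, hg]))
  -- The edges with origin diag(Tⁱ, 1) correspond to points of ℙ¹(F), read off from the first column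
  -- of `k` at 1/T = 0. The point (1 : 0) is the standard upward edge.
  by_cases hk : PowerSeries.X ∣ k 1 0
  · refine ⟨s, i, hs, Or.inl ?_⟩
    rw [hg']
    exact (edge_eq_of_mul (g := polyGL F s * diagInf F i) k hk 1 one_ne_zero (by rw [hone])).symm
  · rw [PowerSeries.X_dvd_iff] at hk
    -- At any other point (t : 1) one has k ∈ unip(t)·weyl·I, with I the Iwahori group. Moving
    -- unip(t) across diag(Tⁱ, 1) turns it into the polynomial matrix unip(tTⁱ).
    set t : F := PowerSeries.constantCoeff (k 0 0) / PowerSeries.constantCoeff (k 1 0) with ht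
    have hk' : PowerSeries.X ∣ (k⁻¹ * unip (PowerSeries.C t) * weyl : GL (Fin 2) F⟦X⟧) 1 0 := by
      rw [PowerSeries.X_dvd_iff, Units.val_mul, Units.val_mul, Matrix.coe_units_inv,
        Matrix.inv_def, Matrix.adjugate_fin_two]
      simp only [Matrix.mul_apply, Fin.sum_univ_two, unip_val, weyl_val, Matrix.smul_apply,
        Matrix.of_apply, Matrix.cons_val_zero, Matrix.cons_val_one, smul_eq_mul]
      simp only [map_add, map_mul, map_neg, map_one, map_zero, PowerSeries.constantCoeff_C]
      rw [ht]
      field_simp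
      ring
    have e1 : (QuotientGroup.mk (polyGL F s * diagInf F i * intGL F k) : TreeEdge F) =
        QuotientGroup.mk (polyGL F s * diagInf F i * intGL F (unip (PowerSeries.C t)) *
          intGL F weyl) :=
      edge_eq_of_mul _ hk' 1 one_ne_zero (by rw [hone]; simp only [map_mul, map_inv]; group)
    have e2 : diagInf F i * intGL F (unip (PowerSeries.C t)) =
        polyGL F (unip (monomial i t)) * diagInf F i := by
      have hm : polyToInf F (monomial i t) =
          HahnSeries.single (-(i : ℤ)) 1 * HahnSeries.C t := by
        simp [polyToInf, HahnSeries.single_pow, mul_comm]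
      ext i j : 2
      rw [Units.val_mul, Units.val_mul, Matrix.mul_apply, Matrix.mul_apply, Fin.sum_univ_two,
        Fin.sum_univ_two]
      simp only [intGL_val, polyGL_val, diagInf_val, unip_val]
      fin_cases i <;> fin_cases j <;> simp [hm]
    rw [mul_assoc _ _ (intGL F (unip _)), e2, ← mul_assoc, ← map_mul] at e1
    rw [hg', e1]
    -- What remains is the edge of diag(Tⁱ, 1)·weyl. For i = 0 the Weyl element is itself polynomial
    -- and is absorbed in the group; for i > 0 this edge points down and is the reverse of the
    -- standard edge of layer i - 1.
    cases i with
    | zero =>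
      refine ⟨s * unip (monomial 0 t) * weyl, 0, by simp [hs, det_unip, det_weyl], Or.inl ?_⟩
      rw [diagInf_zero, mul_one, map_mul _ _ weyl]
      have : intGL F weyl = polyGL F weyl := by
        ext i j : 2
        rw [intGL_val, polyGL_val, weyl_val, weyl_val]
        fin_cases i <;> fin_cases j <;> simp
      rw [this]
      change _ = QuotientGroup.mk (_ * 1)
      rw [mul_one]
    | succ i =>
      refine ⟨s * unip (monomial (i + 1) t), i, by simp [hs, det_unip], Or.inr ?_⟩
      refine edge_eq_of_mul (g' := polyGL F (s * unip (monomial (i + 1) t)) * diagInf F i *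
        edgeFlip F) (upper (-1) 0 1) (by simp [upper_val])
        (HahnSeries.single (-1 : ℤ) 1) (by simp) ?_
      rw [mul_assoc, mul_assoc, mul_assoc, mul_assoc]
      congr 1
      ext i j : 2
      rw [Units.val_mul, Units.val_mul, Units.val_mul, Units.val_mul, Matrix.mul_apply,
        Matrix.mul_apply, Fin.sum_univ_two, Fin.sum_univ_two, Matrix.mul_apply, Matrix.mul_apply,
        Matrix.mul_apply, Matrix.mul_apply]
      simp only [Fin.sum_univ_two, intGL_val, edgeFlip_val, diagInf_val, scalarInf_val, upper_val,
        weyl_val]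
      fin_cases i <;> fin_cases j <;> simp [HahnSeries.single_mul_single, add_comm]

end Stabilizers

/-! ### The quotient of the tree by a congruence group -/

section Quotient

variable {F : Type u} [Field F]

/-- The matrices in `Γ₀(𝔫)` with determinant in `D`. -/
noncomputable def congruenceGroup (D : Subgroup Fˣ) (n : F[X]) : Subgroup (GL (Fin 2) F[X]) :=
  Gamma0 n ⊓ detGroup D

/-- A matrix with given point in `ℙ¹(A / 𝔫)`. -/
noncomputable def pointLift (D : Subgroup Fˣ) {n : F[X]} (hn : n ≠ 0)
    (x : P1 (F[X] ⧸ Ideal.span {n})) : GL (Fin 2) F[X] :=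
  (exists_cosetPoint (D := D) hn x).choose

variable {D : Subgroup Fˣ} {n : F[X]} (hn : n ≠ 0)

lemma pointLift_mem (x : P1 (F[X] ⧸ Ideal.span {n})) : pointLift D hn x ∈ detGroup D :=
  (exists_cosetPoint (D := D) hn x).choose_spec.1

lemma cosetPoint_pointLift (x : P1 (F[X] ⧸ Ideal.span {n})) :
    cosetPoint n (pointLift D hn x) = x :=
  (exists_cosetPoint (D := D) hn x).choose_spec.2

variable (D) {α : Type*} [MulAction (GLInf F) α]

/-- The orbit under the congruence group of the translate of `p` given by a point of
`ℙ¹(A / 𝔫)`. -/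
noncomputable def orbitPoint (p : α) (x : P1 (F[X] ⧸ Ideal.span {n})) :
    MulAction.orbitRel.Quotient ((congruenceGroup D n).map (polyGL F)) α :=
  Quotient.mk'' (polyGL F (pointLift D hn x) • p)

variable {D}

/-- The matrices γ and h are related by γ = s h s'⁻¹: γ carries s'p' to sp exactly when h carries p'
to p, and γ lies in Γ₀(𝔫) exactly when h carries the point of s' to that of s. -/
lemma orbit_mk_eq_iff {s s' : GL (Fin 2) F[X]} (hs : s ∈ detGroup D) (hs' : s' ∈ detGroup D)
    (p p' : α) :
    (Quotient.mk'' (polyGL F s • p) :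
      MulAction.orbitRel.Quotient ((congruenceGroup D n).map (polyGL F)) α) =
        Quotient.mk'' (polyGL F s' • p') ↔
      ∃ h ∈ detGroup D, polyGL F h • p' = p ∧ h • cosetPoint n s' = cosetPoint n s := by
  rw [Quotient.eq'']
  constructor
  · rintro ⟨⟨_, γ, hγ, rfl⟩, h⟩
    refine ⟨s⁻¹ * γ * s', mul_mem (mul_mem (inv_mem hs) hγ.2) hs', ?_, ?_⟩
    · rw [map_mul, map_mul, map_inv, mul_smul, mul_smul, inv_smul_eq_iff]
      exact h
    · rw [← inv_inv (s⁻¹ * γ * s'), ← cosetPoint_mul, cosetPoint_eq_iff]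
      have e : s' * (s⁻¹ * γ * s')⁻¹ * s⁻¹ = γ⁻¹ := by group
      rw [e]
      exact (Gamma0 n).inv_mem hγ.1
  · rintro ⟨h, hh, rfl, hx⟩
    refine ⟨⟨_, s * h * s'⁻¹, ⟨?_, (detGroup D).mul_mem ((detGroup D).mul_mem hs hh)
      ((detGroup D).inv_mem hs')⟩, rfl⟩, ?_⟩
    · rw [← inv_inv h, ← cosetPoint_mul, cosetPoint_eq_iff] at hx
      have e : s * h * s'⁻¹ = (s' * h⁻¹ * s⁻¹)⁻¹ := by group
      rw [e]
      exact (Gamma0 n).inv_mem hx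
    · change polyGL F (s * h * s'⁻¹) • polyGL F s' • p' = polyGL F s • polyGL F h • p'
      rw [← mul_smul, ← mul_smul, ← map_mul, ← map_mul, inv_mul_cancel_right]

lemma orbitPoint_eq_iff (p p' : α) (x y : P1 (F[X] ⧸ Ideal.span {n})) :
    orbitPoint D hn p x = orbitPoint D hn p' y ↔
      ∃ h ∈ detGroup D, polyGL F h • p' = p ∧ h • y = x := by
  refine (orbit_mk_eq_iff (pointLift_mem hn x) (pointLift_mem hn y) p p').trans ?_
  rw [cosetPoint_pointLift, cosetPoint_pointLift]

lemma orbitPoint_cosetPoint {s : GL (Fin 2) F[X]} (hs : s ∈ detGroup D) (p : α) :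
    orbitPoint D hn p (cosetPoint n s) = Quotient.mk'' (polyGL F s • p) := by
  refine (orbit_mk_eq_iff (pointLift_mem hn _) hs p p).mpr ⟨1, one_mem _, by simp, ?_⟩
  rw [cosetPoint_pointLift, one_smul]

lemma mem_borelGroup_of_natDegree {h : GL (Fin 2) F[X]} (hd : h ∈ detGroup D) (h10 : h 1 0 = 0)
    {i : ℕ} (h01 : (h 0 1).natDegree ≤ i) : h ∈ borelGroup D (i + 1) := by
  refine (mem_borel D).mpr ⟨hd, h10, degree_le_natDegree.trans_lt ?_⟩
  exact_mod_cast Nat.lt_succ_of_le h01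

lemma borelGroup_smul_edge {i : ℕ} {h : GL (Fin 2) F[X]} (hh : h ∈ borelGroup D (i + 1)) :
    polyGL F h • (QuotientGroup.mk (diagInf F i) : TreeEdge F) =
      QuotientGroup.mk (diagInf F i) := by
  obtain ⟨a, b, d, rfl, hb, -⟩ := hh
  refine upperC_smul_edge a b d i (natDegree_le_of_degree_le ?_)
  exact Order.lt_succ_iff.mp (by exact_mod_cast hb)

lemma borelGroup_smul_vertex {i : ℕ} {h : GL (Fin 2) F[X]} (hh : h ∈ borelGroup D (i + 1)) :
    polyGL F h • (QuotientGroup.mk (diagInf F i) : TreeVertex F) =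
      QuotientGroup.mk (diagInf F i) :=
  congrArg (treeOrigin F) (borelGroup_smul_edge hh)

variable (D) in
/-- The layers of the quotient of the tree by a congruence group. -/
noncomputable def quotientLayering :
    Layering (quotientGraph (congruenceGroup D n)) (P1 (F[X] ⧸ Ideal.span {n})) where
  vx i x := orbitPoint D hn (QuotientGroup.mk (diagInf F i) : TreeVertex F) x
  ed i x := orbitPoint D hn (QuotientGroup.mk (diagInf F i) : TreeEdge F) x
  bot := MulAction.orbitRel (constGroup D) _
  rel i := MulAction.orbitRel (borelGroup D (i + 1)) _
  top := MulAction.orbitRel (borelGroup D n.natDegree) _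
  exists_vx v := by
    induction v using Quotient.inductionOn' with
    | h v =>
      obtain ⟨s, i, hs, rfl⟩ := exists_reduction v
      exact ⟨i, cosetPoint n s,
        (orbitPoint_cosetPoint hn (mem_detGroup_of_det_eq_one D hs) _).symm⟩
  exists_ed e := by
    induction e using Quotient.inductionOn' with
    | h e =>
      obtain ⟨s, i, hs, h⟩ := exists_edge_reduction e
      have hp := orbitPoint_cosetPoint hn (mem_detGroup_of_det_eq_one D hs)
        (QuotientGroup.mk (diagInf F i) : TreeEdge F)
      refine ⟨i, cosetPoint n s, ?_⟩
      rcases h with rfl | rfl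
      · exact Or.inl hp.symm
      · right
        rw [hp]
        rfl
  o_ed i x := rfl
  t_ed i x := by
    have h : treeOrigin F (treeRev F (polyGL F (pointLift D hn x) •
        (QuotientGroup.mk (diagInf F i) : TreeEdge F))) =
        polyGL F (pointLift D hn x) • QuotientGroup.mk (diagInf F (i + 1)) := by
      rw [treeRev_smul, treeOrigin_smul, terminus_diagInf]
    exact congrArg Quotient.mk'' h
  level_eq i j x y h := by
    obtain ⟨h, -, h1, -⟩ := (orbitPoint_eq_iff hn _ _ x y).mp h
    exact (stabilizer_vertex h1).1.symm
  vx_zero x y := by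
    refine (orbitPoint_eq_iff hn _ _ x y).trans ?_
    constructor
    · rintro ⟨h, hd, h1, h2⟩
      obtain ⟨-, h00, h01, h11, h10, -⟩ := stabilizer_vertex h1
      obtain ⟨g, rfl⟩ := exists_map_C (h := h) (by
        intro i j
        fin_cases i <;> fin_cases j
        exacts [h00, Nat.le_zero.mp h01, h10, h11])
      exact ⟨⟨g, (map_C_mem_detGroup D).mp hd⟩, (map_C_smul g y).symm.trans h2⟩
    · rintro ⟨⟨g, hg⟩, h⟩
      exact ⟨_, (map_C_mem_detGroup D).mpr hg, map_C_smul_vertex g, (map_C_smul g y).trans h⟩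
  vx_succ i x y := by
    refine (orbitPoint_eq_iff hn _ _ x y).trans ?_
    constructor
    · rintro ⟨h, hd, h1, h2⟩
      obtain ⟨-, -, h01, -, -, h10⟩ := stabilizer_vertex h1
      exact ⟨⟨h, mem_borelGroup_of_natDegree hd (h10 (Nat.succ_pos i)) h01⟩, h2⟩
    · rintro ⟨⟨h, hh⟩, h2⟩
      exact ⟨h, ((mem_borel D).mp hh).1, borelGroup_smul_vertex hh, h2⟩
  ed_eq i x y := by
    refine (orbitPoint_eq_iff hn _ _ x y).trans ?_
    constructor
    · rintro ⟨h, hd, h1, h2⟩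
      obtain ⟨-, h10, h01⟩ := stabilizer_edge h1
      exact ⟨⟨h, mem_borelGroup_of_natDegree hd h10 h01⟩, h2⟩
    · rintro ⟨⟨h, hh⟩, h2⟩
      exact ⟨h, ((mem_borel D).mp hh).1, borelGroup_smul_edge hh, h2⟩
  rel_zero_le := by
    rintro x y ⟨⟨h, hh⟩, h2⟩
    obtain ⟨a, b, d, rfl, hb, had⟩ := hh
    obtain ⟨g, hg⟩ := exists_map_C (h := upperC a b d) (by
      intro i j
      fin_cases i <;> fin_cases j <;> simp [upperC_val]
      exact Nat.le_zero.mp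
        (natDegree_le_of_degree_le (Order.lt_succ_iff.mp (by exact_mod_cast hb))))
    have hm := (upperC_mem_detGroup D (b := b)).mpr had
    rw [hg] at hm
    refine ⟨⟨g, (map_C_mem_detGroup D).mp hm⟩, (map_C_smul g y).symm.trans ?_⟩
    rw [← hg]
    exact h2
  rel_mono i := orbitRel_borel_mono (Nat.le_succ _)
  rel_le_top i := orbitRel_borel_le hn _
  depth := n.natDegree
  rel_eq_top i hi := orbitRel_borel_eq hn (by omega)

end Quotient

/-! ### The genus in terms of numbers of orbits. -/

section Genus

variable {F : Type u} [Field F] [Finite F]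

lemma finite_quotient_span {n : F[X]} (hn : n ≠ 0) : Finite (F[X] ⧸ Ideal.span {n}) := by
  have : Module.Finite F (F[X] ⧸ Ideal.span {n}) := (AdjoinRoot.powerBasis hn).finite
  exact Module.finite_of_finite F

theorem finite_homology_quotientGraph (D : Subgroup Fˣ) {n : F[X]} (hn : n ≠ 0) :
    Module.Finite ℤ (quotientGraph (congruenceGroup D n)).H₁ := by
  have := finite_quotient_span hn
  exact (quotientLayering D hn).finite_homology

/-- The genus of the quotient graph in terms of numbers of orbits on `ℙ¹(A / 𝔫)`. -/
theorem genus_quotientGraph (D : Subgroup Fˣ) {n : F[X]} (hn : n ≠ 0) :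
    (quotientGraph (congruenceGroup D n)).genus +
        Nat.card (MulAction.orbitRel.Quotient (constGroup D) (P1 (F[X] ⧸ Ideal.span {n}))) +
        Nat.card (MulAction.orbitRel.Quotient (borelGroup D n.natDegree)
          (P1 (F[X] ⧸ Ideal.span {n}))) =
      Nat.card (MulAction.orbitRel.Quotient (borelGroup D 1) (P1 (F[X] ⧸ Ideal.span {n}))) + 1 := by
  have := finite_quotient_span hn
  exact (quotientLayering D hn).genus_add_card (P1.connected hn)

end Genus

/-! ### Fixed points on the projective line -/

namespace P1

/-! ### Fixed points over a product of rings. -/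

section Product

variable {S R : Type*} [CommRing S] [CommRing R] [Algebra S R]

/-- The map of projective lines induced by a homomorphism. -/
def map {R' : Type*} [CommRing R'] [Algebra S R'] (f : R →ₐ[S] R') : P1 R → P1 R' :=
  Quotient.lift (fun w => mk (f w.1.1) (f w.1.2) (w.2.map f.toRingHom)) (by
    rintro ⟨⟨u, v⟩, h⟩ ⟨⟨u', v'⟩, h'⟩ ⟨c, hc⟩
    have h1 : u' = c * u := congrArg Prod.fst hc
    have h2 : v' = c * v := congrArg Prod.snd hc
    refine mk_eq_mk.mpr ⟨Units.map (f : R →* R') c, ?_, ?_⟩ <;> simp [h1, h2])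

lemma map_mk {R' : Type*} [CommRing R'] [Algebra S R'] (f : R →ₐ[S] R') {u v : R}
    (h : IsCoprime u v) : map f (mk u v h) = mk (f u) (f v) (h.map f.toRingHom) := rfl

lemma map_smul {R' : Type*} [CommRing R'] [Algebra S R'] (f : R →ₐ[S] R') (g : GL (Fin 2) S)
    (x : P1 R) : map f (g • x) = g • map f x := by
  obtain ⟨u, v, h, rfl⟩ := exists_mk x
  rw [smul_mk, map_mk, map_mk, smul_mk]
  refine mk_eq_mk.mpr ⟨1, ?_, ?_⟩ <;> simp

variable {ι : Type*} {Rι : ι → Type*} [∀ i, CommRing (Rι i)] [∀ i, Algebra S (Rι i)]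

/-- The projective line over a product of rings is the product of the projective lines. -/
lemma bijective_map_pi (f : ∀ i, R →ₐ[S] Rι i)
    (hf : Function.Bijective fun (x : R) (i : ι) => f i x) :
    Function.Bijective fun (x : P1 R) (i : ι) => map (f i) x := by
  constructor
  · intro x y hxy
    obtain ⟨u, v, h, rfl⟩ := exists_mk x
    obtain ⟨u', v', h', rfl⟩ := exists_mk y
    have : ∀ i, ∃ c : (Rι i)ˣ, f i u' = c * f i u ∧ f i v' = c * f i v := fun i =>
      mk_eq_mk.mp (congrFun hxy i)
    choose c hc hc' using this
    obtain ⟨a, ha⟩ := hf.2 fun i => (c i : Rι i)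
    obtain ⟨b, hb⟩ := hf.2 fun i => (↑(c i)⁻¹ : Rι i)
    have hab : a * b = 1 := hf.1 (funext fun i => by
      have h1 := congrFun ha i
      have h2 := congrFun hb i
      simp only at h1 h2
      simp [h1, h2])
    refine mk_eq_mk.mpr ⟨⟨a, b, hab, by rw [mul_comm, hab]⟩, hf.1 (funext fun i => ?_),
      hf.1 (funext fun i => ?_)⟩
    · have h1 := congrFun ha i
      simp only at h1
      simp [h1, hc]
    · have h1 := congrFun ha i
      simp only at h1
      simp [h1, hc']
  · intro y
    have : ∀ i, ∃ u v x z, ∃ h : x * u + z * v = 1, y i = mk u v ⟨x, z, h⟩ := fun i => by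
      obtain ⟨u, v, ⟨x, z, h⟩, e⟩ := exists_mk (y i)
      exact ⟨u, v, x, z, h, e⟩
    choose u v x z h e using this
    obtain ⟨u', hu⟩ := hf.2 u
    obtain ⟨v', hv⟩ := hf.2 v
    obtain ⟨x', hx⟩ := hf.2 x
    obtain ⟨z', hz⟩ := hf.2 z
    have h' : x' * u' + z' * v' = 1 := hf.1 (funext fun i => by
      have h1 := congrFun hu i
      have h2 := congrFun hv i
      have h3 := congrFun hx i
      have h4 := congrFun hz i
      simp only at h1 h2 h3 h4
      simp [h1, h2, h3, h4, h])
    have hc : IsCoprime u' v' := ⟨x', z', h'⟩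
    refine ⟨mk u' v' hc, funext fun i => (map_mk (f i) hc).trans ?_⟩
    rw [e]
    refine mk_eq_mk.mpr ⟨1, ?_, ?_⟩
    · simpa using (congrFun hu i).symm
    · simpa using (congrFun hv i).symm

lemma card_fixedBy_pi [Fintype ι] (f : ∀ i, R →ₐ[S] Rι i)
    (hf : Function.Bijective fun (x : R) (i : ι) => f i x) (g : GL (Fin 2) S) :
    Nat.card (MulAction.fixedBy (P1 R) g) = ∏ i, Nat.card (MulAction.fixedBy (P1 (Rι i)) g) := by
  rw [← Nat.card_pi]
  have hb := bijective_map_pi f hf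
  refine Nat.card_congr (Equiv.ofBijective
    (fun x i => ⟨map (f i) x.1, by
      rw [MulAction.mem_fixedBy, ← map_smul, MulAction.mem_fixedBy.mp x.2]⟩) ⟨?_, ?_⟩)
  · intro x y hxy
    refine Subtype.ext (hb.1 (funext fun i => ?_))
    exact congrArg Subtype.val (congrFun hxy i)
  · intro y
    obtain ⟨x, hx⟩ := hb.2 fun i => (y i).1
    refine ⟨⟨x, hb.1 (funext fun i => ?_)⟩, funext fun i => Subtype.ext (congrFun hx i)⟩
    have h1 := congrFun hx i
    simp only at h1
    simp only
    rw [map_smul, h1]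
    exact (y i).2

end Product

/-! ### Fixed points over a local ring. -/

section Local

variable {S R : Type*} [CommRing S] [CommRing R] [Algebra S R]

lemma smul_mk_one_right (g : GL (Fin 2) S) (u : R) :
    g • mk u 1 isCoprime_one_right = mk u 1 isCoprime_one_right ↔
      algebraMap S R (g 0 0) * u + algebraMap S R (g 0 1) =
        (algebraMap S R (g 1 0) * u + algebraMap S R (g 1 1)) * u := by
  rw [smul_mk, mk_eq_mk]
  constructor
  · rintro ⟨c, h1, h2⟩
    simp only [mul_one] at h1 h2
    have h3 : (c : R) * (algebraMap S R (g 0 0) * u + algebraMap S R (g 0 1)) =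
        c * ((algebraMap S R (g 1 0) * u + algebraMap S R (g 1 1)) * u) := by
      rw [← h1, ← mul_assoc, ← h2, one_mul]
    exact c.isUnit.mul_right_injective h3
  · intro h
    have hc := isCoprime_act (R := R) g (isCoprime_one_right (x := u))
    rw [mul_one, mul_one, h] at hc
    have hu : IsUnit (algebraMap S R (g 1 0) * u + algebraMap S R (g 1 1)) := by
      obtain ⟨a, b, hab⟩ := hc
      exact IsUnit.of_mul_eq_one (a * u + b) (by linear_combination hab)
    obtain ⟨c, hc⟩ := hu
    refine ⟨c⁻¹, ?_, ?_⟩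
    · rw [mul_one, h, ← hc, Units.inv_mul_cancel_left]
    · rw [mul_one, ← hc, Units.inv_mul]

lemma smul_mk_one_left (g : GL (Fin 2) S) (v : R) :
    g • mk 1 v isCoprime_one_left = mk 1 v isCoprime_one_left ↔
      algebraMap S R (g 1 0) + algebraMap S R (g 1 1) * v =
        (algebraMap S R (g 0 0) + algebraMap S R (g 0 1) * v) * v := by
  rw [smul_mk, mk_eq_mk]
  constructor
  · rintro ⟨c, h1, h2⟩
    simp only [mul_one] at h1 h2
    have h3 : (c : R) * (algebraMap S R (g 1 0) + algebraMap S R (g 1 1) * v) =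
        c * ((algebraMap S R (g 0 0) + algebraMap S R (g 0 1) * v) * v) := by
      rw [← h2, ← mul_assoc, ← h1, one_mul]
    exact c.isUnit.mul_right_injective h3
  · intro h
    have hc := isCoprime_act (R := R) g (isCoprime_one_left (x := v))
    rw [mul_one, mul_one, h] at hc
    have hu : IsUnit (algebraMap S R (g 0 0) + algebraMap S R (g 0 1) * v) := by
      obtain ⟨a, b, hab⟩ := hc
      exact IsUnit.of_mul_eq_one (a + b * v) (by linear_combination hab)
    obtain ⟨c, hc⟩ := hu
    refine ⟨c⁻¹, ?_, ?_⟩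
    · rw [mul_one, ← hc, Units.inv_mul]
    · rw [mul_one, h, ← hc, Units.inv_mul_cancel_left]

variable [IsLocalRing R]

/-- Over a local ring with maximal ideal `𝔪`, the points of the projective line are the `(u : 1)`
and the `(1 : v)` with `v ∈ 𝔪`. -/
noncomputable def equivLocal : P1 R ≃ R ⊕ IsLocalRing.maximalIdeal R :=
  (Equiv.ofBijective
    (Sum.elim (fun u => mk u 1 isCoprime_one_right)
      (fun v : IsLocalRing.maximalIdeal R => mk 1 v.1 isCoprime_one_left))
    ⟨by
      have hne : ∀ (u : R) (v : IsLocalRing.maximalIdeal R),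
          mk u 1 isCoprime_one_right ≠ mk 1 v.1 isCoprime_one_left := by
        intro u v h
        obtain ⟨c, h1, h2⟩ := mk_eq_mk.mp h
        have := v.2
        rw [h2, mul_one] at this
        exact (IsLocalRing.mem_maximalIdeal _).mp this c.isUnit
      rintro (u | v) (u' | v') h
      · obtain ⟨c, h1, h2⟩ := mk_eq_mk.mp h
        rw [mul_one] at h2
        rw [← h2, one_mul] at h1
        rw [h1]
      · exact absurd h (hne _ _)
      · exact absurd h.symm (hne _ _)
      · obtain ⟨c, h1, h2⟩ := mk_eq_mk.mp h
        rw [mul_one] at h1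
        rw [← h1, one_mul] at h2
        rw [Subtype.ext h2], by
      intro x
      obtain ⟨u, v, h, rfl⟩ := exists_mk x
      by_cases hv : IsUnit v
      · obtain ⟨c, rfl⟩ := hv
        exact ⟨Sum.inl (↑c⁻¹ * u), mk_eq_mk.mpr ⟨c, by simp, by simp⟩⟩
      · have hu : IsUnit u := by
          obtain ⟨a, b, hab⟩ := h
          rcases IsLocalRing.isUnit_or_isUnit_of_add_one hab with h1 | h1
          · exact isUnit_of_mul_isUnit_right h1
          · exact absurd (isUnit_of_mul_isUnit_right h1) hv
        obtain ⟨c, rfl⟩ := hu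
        exact ⟨Sum.inr ⟨↑c⁻¹ * v, Ideal.mul_mem_left _ _ hv⟩,
          mk_eq_mk.mpr ⟨c, by simp, by simp⟩⟩⟩).symm

lemma card_local [Finite R] :
    Nat.card (P1 R) = Nat.card R + Nat.card (IsLocalRing.maximalIdeal R) := by
  rw [Nat.card_congr equivLocal, Nat.card_sum]

lemma card_fixedBy_local [Finite R] (g : GL (Fin 2) S) :
    Nat.card (MulAction.fixedBy (P1 R) g) =
      Nat.card {u : R // algebraMap S R (g 0 0) * u + algebraMap S R (g 0 1) =
        (algebraMap S R (g 1 0) * u + algebraMap S R (g 1 1)) * u} +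
      Nat.card {v : IsLocalRing.maximalIdeal R //
        algebraMap S R (g 1 0) + algebraMap S R (g 1 1) * v.1 =
          (algebraMap S R (g 0 0) + algebraMap S R (g 0 1) * v.1) * v.1} := by
  have e : MulAction.fixedBy (P1 R) g ≃
      {y : R ⊕ IsLocalRing.maximalIdeal R // g • equivLocal.symm y = equivLocal.symm y} :=
    equivLocal.subtypeEquiv fun x => by simp [MulAction.mem_fixedBy]
  rw [Nat.card_congr (e.trans (Equiv.subtypeSum)), Nat.card_sum]
  congr 1
  · exact Nat.card_congr (Equiv.subtypeEquivRight fun u => smul_mk_one_right g u)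
  · exact Nat.card_congr (Equiv.subtypeEquivRight fun v => smul_mk_one_left g v.1)

/-- One fixed point is (1 : 0). Points (u : 1) satisfy (d - a)u = b, which has one solution; points
(1 : v) with v in the maximal ideal satisfy (d - a - bv)v = 0, where the first factor is a unit. -/
lemma card_fixedBy_upper [Finite R] (g : GL (Fin 2) S) (h0 : algebraMap S R (g 1 0) = 0)
    (h1 : IsUnit (algebraMap S R (g 1 1) - algebraMap S R (g 0 0))) :
    Nat.card (MulAction.fixedBy (P1 R) g) = 2 := by
  rw [card_fixedBy_local, h0]
  set a := algebraMap S R (g 0 0)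
  set b := algebraMap S R (g 0 1)
  set d := algebraMap S R (g 1 1)
  obtain ⟨c, hc⟩ := h1
  have hu1 : Nat.card {u : R // a * u + b = (0 * u + d) * u} = 1 := by
    rw [Nat.card_eq_one_iff_exists]
    have hb : (c : R) * (↑c⁻¹ * b) = b := Units.mul_inv_cancel_left _ _
    refine ⟨⟨↑c⁻¹ * b, ?_⟩, fun y => Subtype.ext ?_⟩
    · rw [hc] at hb
      linear_combination -hb
    · apply c.isUnit.mul_right_injective
      change (c : R) * y.1 = c * (↑c⁻¹ * b)
      rw [hb, hc]
      linear_combination -y.2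
  have hv1 :
      Nat.card {v : IsLocalRing.maximalIdeal R // 0 + d * v.1 = (a + b * v.1) * v.1} = 1 := by
    rw [Nat.card_eq_one_iff_exists]
    refine ⟨⟨0, by simp⟩, fun y => Subtype.ext (Subtype.ext ?_)⟩
    have hunit : IsUnit ((c : R) - b * y.1.1) := by
      by_contra hn
      have h2 : b * y.1.1 ∈ IsLocalRing.maximalIdeal R := Ideal.mul_mem_left _ _ y.1.2
      have h3 := Ideal.add_mem _ ((IsLocalRing.mem_maximalIdeal _).mpr hn) h2
      rw [sub_add_cancel] at h3
      exact (IsLocalRing.mem_maximalIdeal _).mp h3 c.isUnit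
    refine (hunit.mul_right_eq_zero).mp ?_
    rw [hc]
    linear_combination y.2
  rw [hu1, hv1]

/-- The number of square roots of a unit. -/
lemma card_sq_eq [Finite R] (h2 : IsUnit (2 : R)) {x : R} (hx : IsUnit x) [Decidable (IsSquare x)] :
    Nat.card {y : R // y ^ 2 = x} = if IsSquare x then 2 else 0 := by
  split_ifs with h
  · obtain ⟨y, rfl⟩ := h
    have hy : IsUnit y := isUnit_of_mul_isUnit_left hx
    have hne : y ≠ -y := by
      intro h
      have : IsUnit (2 * y) := h2.mul hy
      rw [show 2 * y = 0 by linear_combination h] at this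
      exact not_isUnit_zero this
    rw [Nat.card_eq_two_iff]
    refine ⟨⟨y, by ring⟩, ⟨-y, by ring⟩, fun h => hne (congrArg Subtype.val h), ?_⟩
    refine Set.eq_univ_of_forall fun z => ?_
    have hz : (z.1 - y) * (z.1 + y) = 0 := by linear_combination z.2
    -- The factors z - y and z + y cannot both lie in the maximal ideal, since their difference 2y
    -- is a unit. So one is a unit and the other vanishes.
    have hs : IsUnit ((z.1 + y) + (y - z.1)) := by
      rw [show (z.1 + y) + (y - z.1) = 2 * y by ring]
      exact h2.mul hy
    rcases IsLocalRing.isUnit_or_isUnit_of_isUnit_add hs with h1 | h1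
    · left
      exact Subtype.ext (sub_eq_zero.mp ((h1.mul_left_eq_zero).mp hz))
    · right
      refine Subtype.ext (eq_neg_of_add_eq_zero_left ((h1.mul_right_eq_zero).mp ?_))
      linear_combination -hz
  · rw [Nat.card_eq_zero]
    left
    exact ⟨fun y => h ⟨y.1, y.2.symm.trans (sq _)⟩⟩

end Local

end P1

/-- The discriminant of the characteristic polynomial of a matrix. -/
def GLTwo.disc {S : Type*} [CommRing S] (g : GL (Fin 2) S) : S :=
  (g 1 1 - g 0 0) ^ 2 + 4 * (g 0 1 * g 1 0)

/-! ### Fixed points of constant matrices. -/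

section Field

variable {F : Type*} [Field F] {R : Type*} [CommRing R] [Algebra F R] [IsLocalRing R] [Finite R]

/-- No point (1 : v) with v in the maximal ideal is fixed, since the lower left entry c is a unit.
For (u : 1) the condition is a quadratic equation, and completing the square with y = 2cu + (d - a)
gives y² = disc. -/
lemma P1.card_fixedBy_lower (h2 : (2 : F) ≠ 0) (g : GL (Fin 2) F) (hc : g 1 0 ≠ 0) :
    Nat.card (MulAction.fixedBy (P1 R) g) =
      Nat.card {y : R // y ^ 2 = algebraMap F R (disc g)} := by
  have hcu : IsUnit (algebraMap F R (g 1 0)) := (IsUnit.mk0 _ hc).map (algebraMap F R)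
  have h2cu : IsUnit (algebraMap F R (2 * g 1 0)) :=
    (IsUnit.mk0 _ (mul_ne_zero h2 hc)).map (algebraMap F R)
  rw [card_fixedBy_local]
  have hz : Nat.card {v : IsLocalRing.maximalIdeal R //
        algebraMap F R (g 1 0) + algebraMap F R (g 1 1) * v.1 =
          (algebraMap F R (g 0 0) + algebraMap F R (g 0 1) * v.1) * v.1} = 0 := by
    rw [Nat.card_eq_zero]
    left
    refine ⟨fun v => ?_⟩
    have h1 : algebraMap F R (g 1 0) = (algebraMap F R (g 0 0) - algebraMap F R (g 1 1) +
        algebraMap F R (g 0 1) * v.1.1) * v.1.1 := by linear_combination v.2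
    have h3 := Ideal.mul_mem_left _ (algebraMap F R (g 0 0) - algebraMap F R (g 1 1) +
        algebraMap F R (g 0 1) * v.1.1) v.1.2
    rw [← h1] at h3
    exact (IsLocalRing.mem_maximalIdeal _).mp h3 hcu
  rw [hz, add_zero]
  obtain ⟨c, hc'⟩ := h2cu
  refine Nat.card_congr (((Units.mulLeft c).trans
    (Equiv.addRight (algebraMap F R (g 1 1 - g 0 0)))).subtypeEquiv fun u => ?_)
  have hcinj := (hcu.mul_right_injective).eq_iff (a := algebraMap F R (g 0 0) * u +
    algebraMap F R (g 0 1)) (b := (algebraMap F R (g 1 0) * u + algebraMap F R (g 1 1)) * u)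
  have h4 : IsUnit (algebraMap F R (4 : F)) :=
    (IsUnit.mk0 _ (by rw [show (4 : F) = 2 * 2 by norm_num]; exact mul_ne_zero h2 h2)).map _
  have h4inj := (h4.mul_right_injective).eq_iff (a := algebraMap F R (g 1 0) *
    (algebraMap F R (g 0 0) * u + algebraMap F R (g 0 1))) (b := algebraMap F R (g 1 0) *
    ((algebraMap F R (g 1 0) * u + algebraMap F R (g 1 1)) * u))
  rw [← hcinj, ← h4inj]
  simp only [Equiv.trans_apply, Units.mulLeft_apply, Equiv.coe_addRight, hc', disc, map_add,
    map_mul, map_sub, map_pow]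
  have e4 : algebraMap F R 4 = 4 := map_ofNat _ 4
  have e2 : algebraMap F R 2 = 2 := map_ofNat _ 2
  rw [e4, e2]
  constructor <;> intro h <;> linear_combination -h

/-- The number of fixed points of a matrix with distinct eigenvalues. -/
lemma P1.card_fixedBy_of_disc_ne_zero (h2 : (2 : F) ≠ 0) (g : GL (Fin 2) F) (hg : disc g ≠ 0)
    [Decidable (IsSquare (algebraMap F R (disc g)))] :
    Nat.card (MulAction.fixedBy (P1 R) g) =
      if IsSquare (algebraMap F R (disc g)) then 2 else 0 := by
  by_cases hc : g 1 0 = 0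
  · have hd : disc g = (g 1 1 - g 0 0) * (g 1 1 - g 0 0) := by
      rw [disc, hc]
      ring
    rw [if_pos (by rw [hd, map_mul]; exact ⟨_, rfl⟩)]
    refine card_fixedBy_upper g (by rw [hc, map_zero]) ?_
    rw [← map_sub]
    rw [hd] at hg
    exact (IsUnit.mk0 _ (left_ne_zero_of_mul hg)).map _
  · rw [card_fixedBy_lower h2 g hc]
    refine card_sq_eq ?_ ((IsUnit.mk0 _ hg).map _)
    have := (IsUnit.mk0 _ h2).map (algebraMap F R)
    rwa [map_ofNat] at this

end Field

/-! ### The rings `F[T] / 𝔭 ^ r` -/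

section PrimePower

variable {F : Type u} [Field F]

lemma card_quotient_span {f : F[X]} (hf : f ≠ 0) :
    Nat.card (F[X] ⧸ Ideal.span {f}) = Nat.card F ^ f.natDegree := by
  have : Module.Finite F (F[X] ⧸ Ideal.span {f}) := (AdjoinRoot.powerBasis hf).finite
  rw [Module.natCard_eq_pow_finrank (K := F), finrank_quotient_span_eq_natDegree]

variable {p : F[X]}

lemma isUnit_mk_primePow (hp : Irreducible p) {r : ℕ} (hr : r ≠ 0) (f : F[X]) :
    IsUnit (Ideal.Quotient.mk (Ideal.span {p ^ r}) f) ↔ ¬ p ∣ f := by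
  have hd : IsUnit (Ideal.Quotient.mk (Ideal.span {p ^ r}) f) ↔ IsCoprime f (p ^ r) := by
    constructor
    · intro h
      obtain ⟨y, hy⟩ := h.exists_right_inv
      obtain ⟨g, rfl⟩ := Ideal.Quotient.mk_surjective y
      rw [← map_mul, ← map_one (Ideal.Quotient.mk _), Ideal.Quotient.eq,
        Ideal.mem_span_singleton] at hy
      obtain ⟨c, hc⟩ := hy
      exact ⟨g, -c, by linear_combination hc⟩
    · rintro ⟨a, b, hab⟩
      refine IsUnit.of_mul_eq_one (Ideal.Quotient.mk _ a) ?_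
      rw [← map_mul, ← map_one (Ideal.Quotient.mk _), Ideal.Quotient.eq, Ideal.mem_span_singleton]
      exact ⟨-b, by linear_combination hab⟩
  rw [hd, IsCoprime.pow_right_iff (Nat.pos_of_ne_zero hr), isCoprime_comm,
    hp.coprime_iff_not_dvd]

lemma isLocalRing_primePow (hp : Irreducible p) {r : ℕ} (hr : r ≠ 0) :
    IsLocalRing (F[X] ⧸ Ideal.span {p ^ r}) := by
  have : Nontrivial (F[X] ⧸ Ideal.span {p ^ r}) := by
    rw [Ideal.Quotient.nontrivial_iff, Ne, Ideal.span_singleton_eq_top, isUnit_pow_iff hr]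
    exact hp.not_isUnit
  refine IsLocalRing.of_nonunits_add fun a b ha hb => ?_
  obtain ⟨f, rfl⟩ := Ideal.Quotient.mk_surjective a
  obtain ⟨g, rfl⟩ := Ideal.Quotient.mk_surjective b
  rw [mem_nonunits_iff, isUnit_mk_primePow hp hr, not_not] at ha hb
  rw [mem_nonunits_iff, ← map_add, isUnit_mk_primePow hp hr, not_not]
  exact dvd_add ha hb

lemma mk_pow_dvd_mk {r k : ℕ} (hk : k ≤ r) (f : F[X]) :
    Ideal.Quotient.mk (Ideal.span {p ^ r}) p ^ k ∣ Ideal.Quotient.mk (Ideal.span {p ^ r}) f ↔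
      p ^ k ∣ f := by
  constructor
  · rintro ⟨c, hc⟩
    obtain ⟨g, rfl⟩ := Ideal.Quotient.mk_surjective c
    rw [← map_pow, ← map_mul, Ideal.Quotient.eq, Ideal.mem_span_singleton] at hc
    have := (pow_dvd_pow p hk).trans hc
    exact (dvd_sub_left (dvd_mul_right _ _)).mp this
  · rintro ⟨g, rfl⟩
    rw [map_mul, map_pow]
    exact dvd_mul_right _ _

lemma mem_maximalIdeal_primePow (hp : Irreducible p) {r : ℕ} (hr : r ≠ 0)
    [IsLocalRing (F[X] ⧸ Ideal.span {p ^ r})]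
    (v : F[X] ⧸ Ideal.span {p ^ r}) :
    v ∈ IsLocalRing.maximalIdeal (F[X] ⧸ Ideal.span {p ^ r}) ↔ Ideal.Quotient.mk _ p ^ 1 ∣ v := by
  obtain ⟨f, rfl⟩ := Ideal.Quotient.mk_surjective v
  rw [mk_pow_dvd_mk (Nat.one_le_iff_ne_zero.mpr hr), IsLocalRing.mem_maximalIdeal,
    mem_nonunits_iff, isUnit_mk_primePow hp hr, not_not, pow_one]

variable [Finite F]

/-- The multiples of pᵏ form the kernel of the projection to F[T]/pᵏ. -/
lemma card_pow_dvd (hp : Irreducible p) {r k : ℕ} (hk : k ≤ r) :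
    Nat.card {v : F[X] ⧸ Ideal.span {p ^ r} // Ideal.Quotient.mk _ p ^ k ∣ v} =
      (Nat.card F ^ p.natDegree) ^ (r - k) := by
  have hle : Ideal.span {p ^ r} ≤ Ideal.span {p ^ k} :=
    Ideal.span_singleton_le_span_singleton.mpr (pow_dvd_pow p hk)
  set φ := Ideal.Quotient.factor hle
  have hφ : Function.Surjective φ := Ideal.Quotient.factor_surjective hle
  have hker : ∀ v, v ∈ RingHom.ker φ ↔ Ideal.Quotient.mk _ p ^ k ∣ v := by
    intro v
    obtain ⟨f, rfl⟩ := Ideal.Quotient.mk_surjective v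
    rw [mk_pow_dvd_mk hk, RingHom.mem_ker, Ideal.Quotient.factor_mk,
      Ideal.Quotient.eq_zero_iff_dvd]
  have h1 := Submodule.card_eq_card_quotient_mul_card (RingHom.ker φ)
  have h2 := Nat.card_congr (RingHom.quotientKerEquivOfSurjective hφ).toEquiv
  have hpk : ∀ j, p ^ j ≠ 0 := fun j => pow_ne_zero j hp.ne_zero
  have h3 : Nat.card {v : F[X] ⧸ Ideal.span {p ^ r} // Ideal.Quotient.mk _ p ^ k ∣ v} =
      Nat.card (RingHom.ker φ) := Nat.card_congr (Equiv.subtypeEquivRight fun v => (hker v).symm)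
  rw [h3]
  have hq : 0 < Nat.card F := Nat.card_pos
  refine Nat.eq_of_mul_eq_mul_right (pow_pos (pow_pos hq p.natDegree) k) ?_
  rw [← pow_add, Nat.sub_add_cancel hk, ← pow_mul, ← pow_mul]
  rw [card_quotient_span (hpk r), natDegree_pow] at h1
  rw [card_quotient_span (hpk k), natDegree_pow] at h2
  rw [mul_comm p.natDegree, mul_comm p.natDegree, h1, ← h2, mul_comm]

/-- The number of points of the projective line over `F[T] / 𝔭 ^ r`. -/
lemma card_P1_primePow (hp : Irreducible p) {r : ℕ} (hr : r ≠ 0) :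
    Nat.card (P1 (F[X] ⧸ Ideal.span {p ^ r})) =
      (Nat.card F ^ p.natDegree) ^ (r - 1) * (Nat.card F ^ p.natDegree + 1) := by
  have := isLocalRing_primePow hp hr
  have := finite_quotient_span (pow_ne_zero r hp.ne_zero)
  rw [P1.card_local, card_quotient_span (pow_ne_zero r hp.ne_zero), natDegree_pow,
    Nat.card_congr (Equiv.subtypeEquivRight (mem_maximalIdeal_primePow hp hr)),
    card_pow_dvd hp (Nat.one_le_iff_ne_zero.mpr hr), mul_comm r, pow_mul, mul_add, mul_one,
    ← pow_succ, Nat.sub_add_cancel (Nat.one_le_iff_ne_zero.mpr hr)]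

/-- The annihilator of the square of an element of valuation `k`. -/
lemma card_annihilator_sq (hp : Irreducible p) {r k : ℕ} (hr : r ≠ 0) (hk : k ≤ r)
    {v : F[X] ⧸ Ideal.span {p ^ r}}
    (h1 : Ideal.Quotient.mk _ p ^ k ∣ v) (h2 : k < r → ¬ Ideal.Quotient.mk _ p ^ (k + 1) ∣ v) :
    Nat.card {b : F[X] ⧸ Ideal.span {p ^ r} // b * v ^ 2 = 0} =
      (Nat.card F ^ p.natDegree) ^ min (2 * k) r := by
  obtain ⟨f, rfl⟩ := Ideal.Quotient.mk_surjective v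
  rw [mk_pow_dvd_mk hk] at h1
  obtain ⟨g, rfl⟩ := h1
  have hg : k < r → ¬ p ∣ g := by
    intro hkr hpg
    refine h2 hkr ?_
    rw [mk_pow_dvd_mk hkr, pow_succ]
    exact mul_dvd_mul_left _ hpg
  have key : ∀ b : F[X] ⧸ Ideal.span {p ^ r}, b * Ideal.Quotient.mk _ (p ^ k * g) ^ 2 = 0 ↔
      Ideal.Quotient.mk _ p ^ (r - min (2 * k) r) ∣ b := by
    intro b
    obtain ⟨b, rfl⟩ := Ideal.Quotient.mk_surjective b
    rw [mk_pow_dvd_mk (Nat.sub_le _ _), ← map_pow, ← map_mul, Ideal.Quotient.eq_zero_iff_dvd]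
    rcases le_total r (2 * k) with h | h
    · rw [min_eq_right h, Nat.sub_self, pow_zero]
      refine iff_of_true ?_ (one_dvd _)
      rw [mul_pow, ← pow_mul, mul_comm k]
      exact ((pow_dvd_pow p h).mul_right _).mul_left _
    · have hkr : k < r := by omega
      rw [min_eq_left h]
      have e : b * (p ^ k * g) ^ 2 = p ^ (2 * k) * (b * g ^ 2) := by ring
      have e' : p ^ r = p ^ (2 * k) * p ^ (r - 2 * k) := by
        rw [← pow_add, Nat.add_sub_cancel' h]
      rw [e, e', mul_dvd_mul_iff_left (pow_ne_zero _ hp.ne_zero)]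
      refine ⟨fun hd => ?_, fun hd => hd.mul_right _⟩
      have hc : IsCoprime (p ^ (r - 2 * k)) (g ^ 2) :=
        ((hp.coprime_iff_not_dvd).mpr (hg hkr)).pow
      exact hc.dvd_of_dvd_mul_right hd
  rw [Nat.card_congr (Equiv.subtypeEquivRight key), card_pow_dvd hp (Nat.sub_le _ _)]
  congr 1
  omega

open Classical in
/-- The sum of the sizes of the annihilators of the squares of the elements of valuation at least
`k`. -/
noncomputable def annihilatorSum (p : F[X]) (r k : ℕ) [Fintype (F[X] ⧸ Ideal.span {p ^ r})] : ℕ :=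
  ∑ v : F[X] ⧸ Ideal.span {p ^ r} with Ideal.Quotient.mk _ p ^ k ∣ v,
    Nat.card {b : F[X] ⧸ Ideal.span {p ^ r} // b * v ^ 2 = 0}

lemma annihilatorSum_self (hp : Irreducible p) {r : ℕ} (hr : r ≠ 0)
    [Fintype (F[X] ⧸ Ideal.span {p ^ r})] :
    annihilatorSum p r r = (Nat.card F ^ p.natDegree) ^ r := by
  classical
  have h0 : Ideal.Quotient.mk (Ideal.span {p ^ r}) p ^ r = 0 := by
    rw [← map_pow, Ideal.Quotient.eq_zero_iff_dvd]
  rw [annihilatorSum]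
  have : ({v : F[X] ⧸ Ideal.span {p ^ r} | Ideal.Quotient.mk _ p ^ r ∣ v} : Finset _) = {0} := by
    ext v
    simp [h0]
  rw [this, Finset.sum_singleton, card_annihilator_sq hp hr le_rfl (dvd_zero _)
    (fun h => absurd h (lt_irrefl _)), min_eq_right (by omega)]

/-- With P = |p| there are P^(r-k) - P^(r-k-1) elements of valuation exactly k, and each contributes
P^min(2k, r). The terms are arranged to avoid subtraction of natural numbers. -/
lemma annihilatorSum_succ (hp : Irreducible p) {r k : ℕ} (hk : k < r)
    [Fintype (F[X] ⧸ Ideal.span {p ^ r})] :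
    annihilatorSum p r k + (Nat.card F ^ p.natDegree) ^ (r - (k + 1) + min (2 * k) r) =
      annihilatorSum p r (k + 1) + (Nat.card F ^ p.natDegree) ^ (r - k + min (2 * k) r) := by
  classical
  set π := Ideal.Quotient.mk (Ideal.span {p ^ r}) p
  set P := Nat.card F ^ p.natDegree
  have hcard : ∀ j, j ≤ r → (({v | π ^ j ∣ v} : Finset (F[X] ⧸ Ideal.span {p ^ r}))).card =
      P ^ (r - j) := by
    intro j hj
    rw [← card_pow_dvd hp hj, Nat.card_eq_fintype_card, Fintype.card_subtype]
  have hsub : ({v | π ^ (k + 1) ∣ v} : Finset (F[X] ⧸ Ideal.span {p ^ r})) ⊆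
      ({v | π ^ k ∣ v} : Finset _) := by
    intro v hv
    simp only [Finset.mem_filter, Finset.mem_univ, true_and] at hv ⊢
    exact (pow_dvd_pow π (Nat.le_succ k)).trans hv
  have h1 : annihilatorSum p r k = ∑ v ∈ ({v | π ^ k ∣ v} : Finset _) \
      ({v | π ^ (k + 1) ∣ v} : Finset _),
        Nat.card {b : F[X] ⧸ Ideal.span {p ^ r} // b * v ^ 2 = 0} + annihilatorSum p r (k + 1) :=
    (Finset.sum_sdiff hsub).symm
  have h2 : ∑ v ∈ ({v | π ^ k ∣ v} : Finset _) \ ({v | π ^ (k + 1) ∣ v} : Finset _),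
      Nat.card {b : F[X] ⧸ Ideal.span {p ^ r} // b * v ^ 2 = 0} =
      (P ^ (r - k) - P ^ (r - (k + 1))) * P ^ min (2 * k) r := by
    rw [Finset.sum_congr rfl fun v hv => ?_, Finset.sum_const, Finset.card_sdiff_of_subset hsub,
      hcard k hk.le, hcard (k + 1) hk, smul_eq_mul]
    simp only [Finset.mem_sdiff, Finset.mem_filter, Finset.mem_univ, true_and] at hv
    exact card_annihilator_sq hp (by omega) hk.le hv.1 fun _ => hv.2
  have hle : P ^ (r - (k + 1)) ≤ P ^ (r - k) :=
    Nat.pow_le_pow_right (pow_pos Nat.card_pos _) (by omega)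
  rw [h1, h2, pow_add, pow_add, Nat.sub_mul]
  have := Nat.mul_le_mul_right (P ^ min (2 * k) r) hle
  omega

/-- Here all the squares vanish, so each of the P^(r-k) elements is annihilated by the whole ring.
-/
lemma annihilatorSum_large (hp : Irreducible p) {r k : ℕ} (hr : r ≠ 0) (hk : k ≤ r) (h : r ≤ 2 * k)
    [Fintype (F[X] ⧸ Ideal.span {p ^ r})] :
    annihilatorSum p r k = (Nat.card F ^ p.natDegree) ^ (2 * r - k) := by
  induction hk using Nat.decreasingInduction with
  | self => rw [annihilatorSum_self hp hr, two_mul, Nat.add_sub_cancel]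
  | of_succ k hk ih =>
    have h1 := annihilatorSum_succ hp hk
    rw [ih (by omega), min_eq_right h, show r - (k + 1) + r = 2 * r - (k + 1) by omega,
      show r - k + r = 2 * r - k by omega] at h1
    omega

/-- While 2k ≤ r the consecutive differences are P^(r+k) - P^(r+k-1), so they telescope. -/
lemma annihilatorSum_small (hp : Irreducible p) {r k h : ℕ} (hk1 : 1 ≤ k) (hh : 2 * h ≤ r + 1)
    (hk : k ≤ h)
    [Fintype (F[X] ⧸ Ideal.span {p ^ r})] :
    annihilatorSum p r k + (Nat.card F ^ p.natDegree) ^ (r + k - 1) =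
      annihilatorSum p r h + (Nat.card F ^ p.natDegree) ^ (r + h - 1) := by
  induction hk using Nat.decreasingInduction with
  | self => rfl
  | of_succ k hk ih =>
    have h1 := annihilatorSum_succ hp (k := k) (r := r) (by omega)
    have h2 := ih (by omega)
    rw [min_eq_left (by omega), show r - (k + 1) + 2 * k = r + k - 1 by omega,
      show r - k + 2 * k = r + (k + 1) - 1 by omega] at h1
    omega

/-- The two regimes meet at h = ⌊(r + 1)/2⌋. The exponents 2r - h and r + h - 1 found there are the
source of the two floors in κ. -/
lemma annihilatorSum_one (hp : Irreducible p) {r : ℕ} (hr : r ≠ 0)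
    [Fintype (F[X] ⧸ Ideal.span {p ^ r})] :
    (Nat.card F ^ p.natDegree) ^ r + annihilatorSum p r 1 = (Nat.card F ^ p.natDegree) ^ r *
      ((Nat.card F ^ p.natDegree) ^ ((r - 1) / 2) + (Nat.card F ^ p.natDegree) ^ (r / 2)) := by
  have h1 := annihilatorSum_small hp (r := r) (k := 1) (h := (r + 1) / 2) le_rfl (by omega)
    (by omega)
  rw [annihilatorSum_large hp hr (k := (r + 1) / 2) (by omega) (by omega),
    Nat.add_sub_cancel] at h1
  rw [mul_add, ← pow_add, ← pow_add, show r + (r - 1) / 2 = r + (r + 1) / 2 - 1 by omega,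
    show r + r / 2 = 2 * r - (r + 1) / 2 by omega]
  omega

/-- The sum of the numbers of fixed points of the unipotent matrices over `F[T] / 𝔭 ^ r`. -/
lemma sum_card_fixedBy_unip (hp : Irreducible p) {r : ℕ} (hr : r ≠ 0)
    [Fintype (F[X] ⧸ Ideal.span {p ^ r})] :
    ∑ b : F[X] ⧸ Ideal.span {p ^ r},
        Nat.card (MulAction.fixedBy (P1 (F[X] ⧸ Ideal.span {p ^ r})) (unip b)) =
      (Nat.card F ^ p.natDegree) ^ r *
        ((Nat.card F ^ p.natDegree) ^ ((r - 1) / 2) + (Nat.card F ^ p.natDegree) ^ (r / 2)) := by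
  classical
  have := isLocalRing_primePow hp hr
  have key : ∀ b : F[X] ⧸ Ideal.span {p ^ r},
      Nat.card (MulAction.fixedBy (P1 (F[X] ⧸ Ideal.span {p ^ r})) (unip b)) =
        (if b = 0 then (Nat.card F ^ p.natDegree) ^ r else 0) +
          Nat.card {v : IsLocalRing.maximalIdeal (F[X] ⧸ Ideal.span {p ^ r}) //
            b * v.1 ^ 2 = 0} := by
    intro b
    rw [P1.card_fixedBy_local]
    simp only [unip_val, Algebra.algebraMap_self, RingHom.id_apply, Matrix.of_apply,
      Matrix.cons_val_zero, Matrix.cons_val_one, one_mul, zero_mul, zero_add]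
    congr 1
    · split_ifs with hb
      · subst hb
        simp only [add_zero]
        rw [Nat.card_congr (Equiv.subtypeUnivEquiv fun _ => trivial),
          card_quotient_span (pow_ne_zero r hp.ne_zero), natDegree_pow, mul_comm r, pow_mul]
      · rw [Nat.card_eq_zero]
        left
        exact ⟨fun u => hb (by simpa using u.2)⟩
    · refine Nat.card_congr (Equiv.subtypeEquivRight fun v => ?_)
      constructor <;> intro h
      · linear_combination -h
      · linear_combination -h
  rw [← annihilatorSum_one hp hr]
  simp only [key]
  rw [Finset.sum_add_distrib, Finset.sum_ite_eq' Finset.univ 0, if_pos (Finset.mem_univ _)]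
  congr 1
  simp only [Nat.card_eq_fintype_card]
  -- Double counting of the pairs (b, v) with v in the maximal ideal and bv² = 0: summing over v
  -- first gives annihilators of squares.
  rw [← Fintype.card_sigma]
  rw [annihilatorSum]
  simp only [Nat.card_eq_fintype_card]
  rw [← Finset.sum_coe_sort, ← Fintype.card_sigma]
  refine Fintype.card_congr ?_
  refine ⟨fun x => ⟨⟨x.2.1.1, ?_⟩, ⟨x.1, x.2.2⟩⟩, fun y => ⟨y.2.1, ⟨⟨y.1.1, ?_⟩, y.2.2⟩⟩, ?_, ?_⟩
  · exact Finset.mem_filter.mpr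
      ⟨Finset.mem_univ _, (mem_maximalIdeal_primePow hp hr _).mp x.2.1.2⟩
  · exact (mem_maximalIdeal_primePow hp hr _).mpr (Finset.mem_filter.mp y.1.2).2
  · intro x
    rfl
  · intro y
    rfl

end PrimePower

/-! ### When a nonsquare constant becomes a square modulo a prime power. -/

section SquareCriterion

lemma even_geomSum_iff {q : ℕ} (hq : Odd q) (d : ℕ) :
    Even (∑ i ∈ Finset.range d, q ^ i) ↔ Even d := by
  induction d with
  | zero => simp
  | succ d ih =>
    rw [Finset.sum_range_succ, Nat.even_add, ih, Nat.even_add_one]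
    have : ¬ Even (q ^ d) := Nat.not_even_iff_odd.mpr hq.pow
    tauto

/-- This factors the exponent (qᵈ - 1)/2 of Euler's criterion over the extension of degree d through
(q - 1)/2, the exponent over the base field. -/
lemma pow_div_two_eq {q : ℕ} (hq : Odd q) (d : ℕ) :
    q ^ d / 2 = q / 2 * ∑ i ∈ Finset.range d, q ^ i := by
  obtain ⟨m, rfl⟩ := hq
  have h1 : (∑ i ∈ Finset.range d, (2 * m + 1) ^ i) * (2 * m) + 1 = (2 * m + 1) ^ d := by
    have := geom_sum_mul_add (2 * m) d
    simpa using this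
  have h2 : (2 * m + 1) / 2 = m := by omega
  rw [h2, ← h1]
  have h3 : (∑ i ∈ Finset.range d, (2 * m + 1) ^ i) * (2 * m) =
    2 * (m * ∑ i ∈ Finset.range d, (2 * m + 1) ^ i) := by ring
  omega

variable {F : Type u} [Field F] [Fintype F]

/-- A nonsquare of a finite field becomes a square in an extension of odd order exactly when the
degree is even. -/
lemma isSquare_algebraMap_iff {K : Type*} [Field K] [Finite K] [Algebra F K] (h2 : (2 : F) ≠ 0)
    {c : F} (hc : ¬ IsSquare c) : IsSquare (algebraMap F K c) ↔ Even (Module.finrank F K) := by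
  have := Fintype.ofFinite K
  have hc0 : c ≠ 0 := by
    rintro rfl
    exact hc (IsSquare.zero)
  have hF : ringChar F ≠ 2 := fun h => h2 (by
    have := ringChar.Nat.cast_ringChar (R := F)
    rw [h] at this
    exact_mod_cast this)
  have h2K : (2 : K) ≠ 0 := by
    have := (_root_.map_ne_zero (algebraMap F K)).mpr h2
    rwa [map_ofNat] at this
  have hK : ringChar K ≠ 2 := fun h => h2K (by
    have := ringChar.Nat.cast_ringChar (R := K)
    rw [h] at this
    exact_mod_cast this)
  have hodd : Odd (Fintype.card F) := by
    rw [Nat.odd_iff]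
    exact FiniteField.odd_card_of_char_ne_two hF
  have h1 : c ^ (Fintype.card F / 2) = -1 :=
    (FiniteField.pow_dichotomy hF hc0).resolve_left
      (fun h => hc ((FiniteField.isSquare_iff hF hc0).mpr h))
  rw [FiniteField.isSquare_iff hK ((_root_.map_ne_zero _).mpr hc0),
    Module.card_eq_pow_finrank (K := F), pow_div_two_eq hodd, pow_mul, ← map_pow, h1, map_neg,
    map_one, ← even_geomSum_iff hodd]
  rw [neg_one_pow_eq_one_iff_even]
  intro h
  exact h2K (by linear_combination -h)

/-- The criterion holds modulo p by Euler, and square roots lift to pʳ by a Frobenius power in place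
of Hensel's lemma: if p divides c - f², then with N = qʳ its N-th power is c - (f^N)², which is
divisible by p^N and hence by pʳ. -/
lemma isSquare_primePow_iff {p : F[X]} (hp : Irreducible p) {r : ℕ} (hr : r ≠ 0)
    (h2 : (2 : F) ≠ 0) {c : F} (hc : ¬ IsSquare c) :
    IsSquare (algebraMap F (F[X] ⧸ Ideal.span {p ^ r}) c) ↔ Even p.natDegree := by
  have : (Ideal.span {p}).IsMaximal := PrincipalIdealRing.isMaximal_of_irreducible hp
  let : Field (F[X] ⧸ Ideal.span {p}) := Ideal.Quotient.field _
  have := finite_quotient_span hp.ne_zero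
  rw [← finrank_quotient_span_eq_natDegree, ← isSquare_algebraMap_iff h2 hc]
  constructor
  · intro h
    have hle : Ideal.span {p ^ r} ≤ Ideal.span {p} :=
      Ideal.span_singleton_le_span_singleton.mpr (dvd_pow_self p hr)
    exact h.map (Ideal.Quotient.factor hle)
  · rintro ⟨y, hy⟩
    obtain ⟨f, rfl⟩ := Ideal.Quotient.mk_surjective y
    have hd : p ∣ C c - f ^ 2 := by
      rw [← Ideal.mem_span_singleton, ← Ideal.Quotient.eq, map_pow, sq]
      exact hy
    obtain ⟨ℓ, hℓ⟩ := CharP.exists F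
    have : Fact ℓ.Prime := ⟨CharP.char_is_prime F ℓ⟩
    obtain ⟨m, -, hm⟩ := FiniteField.card F ℓ
    set N := Fintype.card F ^ r with hN
    have hfrob : (C c - f ^ 2) ^ N = C c - (f ^ N) ^ 2 := by
      rw [hN, hm, ← pow_mul, sub_pow_char_pow, pow_mul, ← hm, ← C_pow, FiniteField.pow_card_pow,
        ← pow_mul, ← pow_mul, mul_comm 2]
    have hrN : r ≤ N := (Nat.lt_pow_self (Fintype.one_lt_card)).le
    refine ⟨Ideal.Quotient.mk _ (f ^ N), ?_⟩
    rw [← map_mul, ← sq]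
    refine Ideal.Quotient.eq.mpr (Ideal.mem_span_singleton.mpr ?_)
    change p ^ r ∣ C c - (f ^ N) ^ 2
    rw [← hfrob]
    exact (pow_dvd_pow p hrN).trans (pow_dvd_pow_of_dvd hd N)

end SquareCriterion

/-! ### Fixed points on the projective line of level `𝔫` -/

section LevelProduct

variable {F : Type u} [Field F] {s : ℕ} {p : Fin s → F[X]} {r : Fin s → ℕ}

/-- The projection from level `𝔫` to a prime power dividing it. -/
noncomputable def levelProj (p : Fin s → F[X]) (r : Fin s → ℕ) (i : Fin s) :
    (F[X] ⧸ Ideal.span {∏ i, p i ^ r i}) →ₐ[F[X]] (F[X] ⧸ Ideal.span {p i ^ r i}) :=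
  Ideal.Quotient.factorₐ F[X] (Ideal.span_singleton_le_span_singleton.mpr
    (Finset.dvd_prod_of_mem _ (Finset.mem_univ i)))

lemma levelProj_mk (i : Fin s) (f : F[X]) :
    levelProj p r i (Ideal.Quotient.mk _ f) = Ideal.Quotient.mk _ f := rfl

lemma level_ne_zero (hirr : ∀ i, Irreducible (p i)) : ∏ i, p i ^ r i ≠ 0 :=
  Finset.prod_ne_zero_iff.mpr fun i _ => pow_ne_zero _ (hirr i).ne_zero

/-- The Chinese remainder theorem. Distinct monic irreducible polynomials are not associated, which
gives coprimality and injectivity; the rest is a comparison of cardinalities. -/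
lemma bijective_levelProj [Finite F] (hmonic : ∀ i, (p i).Monic) (hirr : ∀ i, Irreducible (p i))
    (hinj : Function.Injective p) :
    Function.Bijective fun (x : F[X] ⧸ Ideal.span {∏ i, p i ^ r i}) (i : Fin s) =>
      levelProj p r i x := by
  have := finite_quotient_span (level_ne_zero (r := r) hirr)
  have := fun i => finite_quotient_span (pow_ne_zero (r i) (hirr i).ne_zero)
  have hcop : Pairwise (Function.onFun IsCoprime fun i => p i ^ r i) := by
    intro i j hij
    refine IsCoprime.pow (((hirr i).coprime_iff_not_dvd).mpr fun h => hij (hinj ?_))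
    exact eq_of_monic_of_associated (hmonic i) (hmonic j)
      ((hirr i).associated_of_dvd (hirr j) h)
  refine (Nat.bijective_iff_injective_and_card _).mpr ⟨?_, ?_⟩
  · intro x y hxy
    obtain ⟨f, rfl⟩ := Ideal.Quotient.mk_surjective x
    obtain ⟨g, rfl⟩ := Ideal.Quotient.mk_surjective y
    rw [Ideal.Quotient.eq, Ideal.mem_span_singleton]
    refine Fintype.prod_dvd_of_coprime hcop fun i => ?_
    have := congrFun hxy i
    simp only [levelProj_mk] at this
    rwa [Ideal.Quotient.eq, Ideal.mem_span_singleton] at this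
  · rw [Nat.card_pi, card_quotient_span (level_ne_zero hirr),
      natDegree_prod _ _ fun i _ => pow_ne_zero _ (hirr i).ne_zero, ← Finset.prod_pow_eq_pow_sum]
    exact Finset.prod_congr rfl fun i _ =>
      (card_quotient_span (pow_ne_zero _ (hirr i).ne_zero)).symm

lemma card_fixedBy_level [Finite F] (hmonic : ∀ i, (p i).Monic) (hirr : ∀ i, Irreducible (p i))
    (hinj : Function.Injective p) (g : GL (Fin 2) F[X]) :
    Nat.card (MulAction.fixedBy (P1 (F[X] ⧸ Ideal.span {∏ i, p i ^ r i})) g) =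
      ∏ i, Nat.card (MulAction.fixedBy (P1 (F[X] ⧸ Ideal.span {p i ^ r i})) g) :=
  P1.card_fixedBy_pi (levelProj p r) (bijective_levelProj hmonic hirr hinj) g

theorem levelEps_eq [Fintype F] (hmonic : ∀ i, (p i).Monic) (hirr : ∀ i, Irreducible (p i))
    (hinj : Function.Injective p) (hr : ∀ i, 1 ≤ r i) :
    levelEps (∏ i, p i ^ r i) = ∏ i, polyAbs (p i) ^ (r i - 1) * (polyAbs (p i) + 1) := by
  rw [levelEps, Nat.card_congr (Equiv.ofBijective _
    (P1.bijective_map_pi (levelProj p r) (bijective_levelProj hmonic hirr hinj))), Nat.card_pi]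
  refine Finset.prod_congr rfl fun i _ => ?_
  rw [card_P1_primePow (hirr i) (Nat.one_le_iff_ne_zero.mp (hr i)), polyAbs,
    Nat.card_eq_fintype_card]

/-- Each prime power contributes 2 or 0 according to whether the discriminant becomes a square
there. For a nonsquare this depends on the parity of the degree, so the product is nonzero only if
all degrees are even. -/
lemma card_fixedBy_level_disc [Fintype F] (hmonic : ∀ i, (p i).Monic)
    (hirr : ∀ i, Irreducible (p i)) (hinj : Function.Injective p) (hr : ∀ i, 1 ≤ r i)
    (h2 : (2 : F) ≠ 0) (g : GL (Fin 2) F) (hg : disc g ≠ 0) [Decidable (IsSquare (disc g))] :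
    Nat.card (MulAction.fixedBy (P1 (F[X] ⧸ Ideal.span {∏ i, p i ^ r i})) g) =
      if IsSquare (disc g) then 2 ^ s else 2 ^ s * levelMe p := by
  classical
  have hfix : ∀ n : F[X], MulAction.fixedBy (P1 (F[X] ⧸ Ideal.span {n})) g =
      MulAction.fixedBy (P1 (F[X] ⧸ Ideal.span {n}))
        (Matrix.GeneralLinearGroup.map (C : F →+* F[X]) g) := by
    intro n
    ext x
    rw [MulAction.mem_fixedBy, MulAction.mem_fixedBy, map_C_smul]
  rw [hfix, card_fixedBy_level hmonic hirr hinj]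
  have key : ∀ i, Nat.card (MulAction.fixedBy (P1 (F[X] ⧸ Ideal.span {p i ^ r i}))
      (Matrix.GeneralLinearGroup.map (C : F →+* F[X]) g)) =
        if IsSquare (disc g) ∨ Even (p i).natDegree then 2 else 0 := by
    intro i
    have hri := Nat.one_le_iff_ne_zero.mp (hr i)
    have := isLocalRing_primePow (hirr i) hri
    have := finite_quotient_span (pow_ne_zero (r i) (hirr i).ne_zero)
    rw [← hfix, P1.card_fixedBy_of_disc_ne_zero h2 g hg]
    refine if_congr ?_ rfl rfl
    by_cases hs : IsSquare (disc g)
    · exact iff_of_true (hs.map _) (Or.inl hs)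
    · rw [isSquare_primePow_iff (hirr i) hri h2 hs]
      exact (or_iff_right hs).symm
  simp only [key]
  split_ifs with hs
  · simp [hs]
  · simp only [hs, false_or, levelMe]
    split_ifs with he
    · simp [he]
    · push Not at he
      obtain ⟨i, hi⟩ := he
      rw [mul_zero]
      exact Finset.prod_eq_zero (Finset.mem_univ i) (if_neg (by simpa using hi))

lemma card_fixedBy_level_upperC [Finite F] (hmonic : ∀ i, (p i).Monic)
    (hirr : ∀ i, Irreducible (p i)) (hinj : Function.Injective p) (hr : ∀ i, 1 ≤ r i)
    {a d : Fˣ} (had : a ≠ d) (b : F[X]) :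
    Nat.card (MulAction.fixedBy (P1 (F[X] ⧸ Ideal.span {∏ i, p i ^ r i})) (upperC a b d)) =
      2 ^ s := by
  rw [card_fixedBy_level hmonic hirr hinj, Finset.prod_congr rfl fun i _ => ?_, Finset.prod_const,
    Finset.card_univ, Fintype.card_fin]
  have hri := Nat.one_le_iff_ne_zero.mp (hr i)
  have := isLocalRing_primePow (hirr i) hri
  have := finite_quotient_span (pow_ne_zero (r i) (hirr i).ne_zero)
  refine P1.card_fixedBy_upper _ (by simp [upperC_val]) ?_
  have h : IsUnit ((d : F) - a) :=
    IsUnit.mk0 _ (sub_ne_zero.mpr fun h => had (Units.ext h.symm))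
  have h' := (h.map (C : F →+* F[X])).map
    (algebraMap F[X] (F[X] ⧸ Ideal.span {p i ^ r i}))
  rwa [map_sub, map_sub] at h'

/-- Both the summation range and the summand factor over the prime powers, so the sum is the product
of the local sums. -/
lemma sum_card_fixedBy_level_unip [Fintype F] (hmonic : ∀ i, (p i).Monic)
    (hirr : ∀ i, Irreducible (p i)) (hinj : Function.Injective p) (hr : ∀ i, 1 ≤ r i)
    [Fintype (F[X] ⧸ Ideal.span {∏ i, p i ^ r i})] :
    ∑ b : F[X] ⧸ Ideal.span {∏ i, p i ^ r i},
        Nat.card (MulAction.fixedBy (P1 (F[X] ⧸ Ideal.span {∏ i, p i ^ r i})) (unip b)) =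
      Fintype.card F ^ (∏ i, p i ^ r i).natDegree * levelKappa p r := by
  classical
  have hfin := fun i => finite_quotient_span (pow_ne_zero (r i) (hirr i).ne_zero)
  have := fun i => Fintype.ofFinite (F[X] ⧸ Ideal.span {p i ^ r i})
  have hfix : ∀ (n b : F[X]),
      MulAction.fixedBy (P1 (F[X] ⧸ Ideal.span {n})) (unip (Ideal.Quotient.mk (Ideal.span {n}) b)) =
      MulAction.fixedBy (P1 (F[X] ⧸ Ideal.span {n})) (unip b) := by
    intro n b
    ext x
    rw [MulAction.mem_fixedBy, MulAction.mem_fixedBy, P1.smul_congr (unip b) (unip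
      (Ideal.Quotient.mk (Ideal.span {n}) b)) _ x]
    intro i j
    fin_cases i <;> fin_cases j <;> simp [unip_val, Ideal.Quotient.algebraMap_eq]
  have key : ∀ b : F[X] ⧸ Ideal.span {∏ i, p i ^ r i},
      Nat.card (MulAction.fixedBy (P1 (F[X] ⧸ Ideal.span {∏ i, p i ^ r i})) (unip b)) =
      ∏ i, Nat.card (MulAction.fixedBy (P1 (F[X] ⧸ Ideal.span {p i ^ r i}))
        (unip (levelProj p r i b))) := by
    intro b
    obtain ⟨b, rfl⟩ := Ideal.Quotient.mk_surjective b
    rw [hfix, card_fixedBy_level hmonic hirr hinj]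
    refine Finset.prod_congr rfl fun i _ => ?_
    rw [levelProj_mk, hfix]
  simp only [key]
  refine ((Equiv.ofBijective _ (bijective_levelProj (r := r) hmonic hirr hinj)).sum_comp
    (fun y : ∀ i, F[X] ⧸ Ideal.span {p i ^ r i} =>
      ∏ i, Nat.card (MulAction.fixedBy (P1 (F[X] ⧸ Ideal.span {p i ^ r i})) (unip (y i))))).trans ?_
  rw [← Fintype.piFinset_univ, ← Finset.prod_univ_sum (fun _ => Finset.univ)
    (fun i (b : F[X] ⧸ Ideal.span {p i ^ r i}) =>
      Nat.card (MulAction.fixedBy (P1 (F[X] ⧸ Ideal.span {p i ^ r i})) (unip b))),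
    natDegree_prod _ _ fun i _ => pow_ne_zero _ (hirr i).ne_zero, ← Finset.prod_pow_eq_pow_sum,
    levelKappa, ← Finset.prod_mul_distrib]
  refine Finset.prod_congr rfl fun i _ => ?_
  rw [sum_card_fixedBy_unip (hirr i) (Nat.one_le_iff_ne_zero.mp (hr i)), polyAbs,
    Nat.card_eq_fintype_card, natDegree_pow, mul_comm (r i), pow_mul]

end LevelProduct

/-! ### Counting orbits -/

section Burnside

lemma sum_card_fixedBy (G X : Type*) [Group G] [MulAction G X] [Fintype G] [Finite X] :
    ∑ g : G, Nat.card (MulAction.fixedBy X g) =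
      Nat.card (MulAction.orbitRel.Quotient G X) * Nat.card G := by
  classical
  have := Fintype.ofFinite X
  have := Fintype.ofFinite (Quotient (MulAction.orbitRel G X))
  have h := MulAction.sum_card_fixedBy_eq_card_orbits_mul_card_group G X
  simp only [Nat.card_eq_fintype_card]
  exact h

lemma card_fixedBy_prod {G X Y : Type*} [Group G] [MulAction G X] [MulAction G Y] (g : G) :
    Nat.card (MulAction.fixedBy (X × Y) g) =
      Nat.card (MulAction.fixedBy X g) * Nat.card (MulAction.fixedBy Y g) := by
  rw [← Nat.card_prod]
  refine Nat.card_congr ⟨fun x => ⟨⟨x.1.1, congrArg Prod.fst x.2⟩, ⟨x.1.2, congrArg Prod.snd x.2⟩⟩,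
    fun y => ⟨(y.1.1, y.2.1), Prod.ext y.1.2 y.2.2⟩, fun _ => rfl, fun _ => rfl⟩

end Burnside

/-! ### The constant group and its action on ℙ¹(F). -/

section ConstGroup

variable {F : Type u} [Field F] {D : Subgroup Fˣ}

/-- The matrix is scalar. -/
def GLTwo.IsScalar (g : GL (Fin 2) F) : Prop := g 0 1 = 0 ∧ g 1 0 = 0 ∧ g 0 0 = g 1 1

lemma GLTwo.IsScalar.disc_eq {g : GL (Fin 2) F} (h : IsScalar g) : disc g = 0 := by
  rw [disc, h.1, h.2.2]
  ring

lemma GLTwo.IsScalar.smul_eq {g : GL (Fin 2) F} (h : IsScalar g) {R : Type*} [CommRing R]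
    [Algebra F R] (x : P1 R) : g • x = x := by
  obtain ⟨u, v, huv, rfl⟩ := P1.exists_mk x
  have h0 : g 0 0 ≠ 0 := by
    intro h0
    have := ((Matrix.isUnit_iff_isUnit_det _).mp g.isUnit).ne_zero
    rw [Matrix.det_fin_two, h0, h.1] at this
    simp at this
  obtain ⟨c, hc⟩ := (IsUnit.mk0 _ h0).map (algebraMap F R)
  symm
  rw [P1.smul_mk]
  refine P1.mk_eq_mk.mpr ⟨c, ?_, ?_⟩
  · rw [h.1, hc]
    simp
  · rw [h.2.1, ← h.2.2, hc]
    simp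

lemma GLTwo.IsScalar.card_fixedBy {g : GL (Fin 2) F} (h : IsScalar g) {R : Type*} [CommRing R]
    [Algebra F R] : Nat.card (MulAction.fixedBy (P1 R) g) = Nat.card (P1 R) :=
  Nat.card_congr (Equiv.subtypeUnivEquiv fun x => h.smul_eq x)

lemma card_maximalIdeal_field : Nat.card (IsLocalRing.maximalIdeal F) = 1 := by
  rw [IsLocalRing.maximalIdeal_eq_bot]
  exact Nat.card_unique

lemma card_P1_field [Finite F] : Nat.card (P1 F) = Nat.card F + 1 := by
  rw [P1.card_local, card_maximalIdeal_field]

lemma P1.card_fixedBy_field_of_disc_eq_zero [Finite F] (h2 : (2 : F) ≠ 0) {g : GL (Fin 2) F}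
    (hg : disc g = 0) (hs : ¬ IsScalar g) : Nat.card (MulAction.fixedBy (P1 F) g) = 1 := by
  by_cases hc : g 1 0 = 0
  · have had : g 0 0 = g 1 1 := by
      rw [disc, hc, mul_zero, mul_zero, add_zero] at hg
      exact (sub_eq_zero.mp (pow_eq_zero_iff two_ne_zero |>.mp hg)).symm
    have hb : g 0 1 ≠ 0 := fun hb => hs ⟨hb, hc, had⟩
    rw [card_fixedBy_local]
    simp only [Algebra.algebraMap_self, RingHom.id_apply, hc, had]
    have h1 : Nat.card {u : F // g 1 1 * u + g 0 1 = (0 * u + g 1 1) * u} = 0 := by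
      rw [Nat.card_eq_zero]
      exact Or.inl ⟨fun u => hb (by linear_combination u.2)⟩
    have hz : ∀ v : IsLocalRing.maximalIdeal F, v.1 = 0 := by
      rintro ⟨v, hv⟩
      rwa [IsLocalRing.maximalIdeal_eq_bot] at hv
    rw [h1, zero_add, Nat.card_congr (Equiv.subtypeUnivEquiv fun v => ?_),
      card_maximalIdeal_field]
    rw [hz v]
    ring
  · rw [card_fixedBy_lower h2 g hc, Algebra.algebraMap_self, RingHom.id_apply, hg,
      Nat.card_eq_one_iff_exists]
    exact ⟨⟨0, by simp⟩, fun y => Subtype.ext (pow_eq_zero_iff two_ne_zero |>.mp y.2)⟩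

lemma mem_constGroup_of_det_eq_one {g : GL (Fin 2) F}
    (h : Matrix.GeneralLinearGroup.det g = 1) : g ∈ constGroup D := by
  rw [constGroup, Subgroup.mem_comap, h]
  exact one_mem _

/-- The constant matrices act transitively on the projective line of the field. -/
lemma exists_smul_eq_infty (x : P1 F) : ∃ g ∈ constGroup D, g • x = P1.infty := by
  obtain ⟨u, v, h, rfl⟩ := P1.exists_mk x
  have hdet : ∀ t : F, Matrix.GeneralLinearGroup.det (lowerUnip t) = 1 := fun t => by
    ext
    simp [lowerUnip_val, Matrix.det_fin_two]
  by_cases hu : u = 0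
  · subst hu
    have hv : v ≠ 0 := by
      rw [isCoprime_zero_left] at h
      exact h.ne_zero
    refine ⟨weyl, mem_constGroup_of_det_eq_one det_weyl, ?_⟩
    rw [P1.smul_mk]
    refine P1.mk_eq_mk.mpr ⟨(Units.mk0 v hv)⁻¹, ?_, ?_⟩ <;> simp [weyl_val, hv]
  · refine ⟨lowerUnip (-(v / u)), mem_constGroup_of_det_eq_one (hdet _), ?_⟩
    rw [P1.smul_mk]
    refine P1.mk_eq_mk.mpr ⟨(Units.mk0 u hu)⁻¹, ?_, ?_⟩
    · simp [lowerUnip_val, hu]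
    · simp [lowerUnip_val, hu]

lemma exists_smul_infty_eq {y : P1 F} (hy : y ≠ P1.infty) :
    ∃ g ∈ constGroup D, g • (P1.infty : P1 F) = P1.infty ∧
      g • y = P1.mk 0 1 isCoprime_one_right := by
  obtain ⟨u, v, h, rfl⟩ := P1.exists_mk y
  have hv : v ≠ 0 := by
    rintro rfl
    rw [isCoprime_zero_right] at h
    exact hy (P1.mk_eq_mk.mpr ⟨h.unit⁻¹, by simp [h.ne_zero], by simp⟩)
  refine ⟨unip (-(u / v)), mem_constGroup_of_det_eq_one (det_unip _), ?_, ?_⟩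
  · rw [P1.smul_infty_eq_iff]
    simp [unip_val]
  · rw [P1.smul_mk]
    refine P1.mk_eq_mk.mpr ⟨(Units.mk0 v hv)⁻¹, ?_, ?_⟩ <;> simp [unip_val, hv]

lemma card_orbits_P1 :
    Nat.card (MulAction.orbitRel.Quotient (constGroup D) (P1 F)) = 1 := by
  rw [Nat.card_eq_one_iff_exists]
  refine ⟨Quotient.mk'' P1.infty, fun x => ?_⟩
  induction x using Quotient.inductionOn' with
  | h x =>
    obtain ⟨g, hg, h⟩ := exists_smul_eq_infty (D := D) x
    symm
    exact Quotient.sound' ⟨⟨g, hg⟩, h⟩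

/-- Double transitivity: the orbits are the diagonal and its complement. -/
lemma card_orbits_P1_prod :
    Nat.card (MulAction.orbitRel.Quotient (constGroup D) (P1 F × P1 F)) = 2 := by
  rw [Nat.card_eq_two_iff]
  have hne : (P1.mk 0 1 isCoprime_one_right : P1 F) ≠ P1.infty := by
    intro h
    obtain ⟨c, h1, h2⟩ := P1.mk_eq_mk.mp h
    simp at h1
  refine ⟨Quotient.mk'' (P1.infty, P1.infty),
    Quotient.mk'' (P1.infty, P1.mk 0 1 isCoprime_one_right), ?_, ?_⟩
  · intro h
    obtain ⟨g, hg⟩ := Quotient.exact' h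
    have h1 : g • (P1.infty : P1 F) = P1.infty := congrArg Prod.fst hg
    have h2 : g • (P1.mk 0 1 isCoprime_one_right : P1 F) = P1.infty := congrArg Prod.snd hg
    exact hne (MulAction.injective g (h2.trans h1.symm))
  · refine Set.eq_univ_of_forall fun z => ?_
    induction z using Quotient.inductionOn' with
    | h z =>
      obtain ⟨x, y⟩ := z
      obtain ⟨g, hg, h⟩ := exists_smul_eq_infty (D := D) x
      by_cases hxy : y = x
      · left
        subst hxy
        symm
        exact Quotient.sound' ⟨⟨g, hg⟩, Prod.ext h h⟩
      · right
        have hy : g • y ≠ P1.infty := fun h' =>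
          hxy (MulAction.injective g (h'.trans h.symm))
        obtain ⟨g', hg', h1, h2⟩ := exists_smul_infty_eq (D := D) hy
        rw [Set.mem_singleton_iff]
        symm
        refine Quotient.sound' ⟨⟨g' * g, mul_mem hg' hg⟩, Prod.ext ?_ ?_⟩
        · change (g' * g) • x = _
          rw [mul_smul, h, h1]
        · change (g' * g) • y = _
          rw [mul_smul, h2]

/-- The orbits of the Borel group on a set are the orbits of the full group on its product with the
projective line. -/
lemma card_orbits_borelGroup (D : Subgroup Fˣ) (n : F[X]) :
    Nat.card (MulAction.orbitRel.Quotient (borelGroup D 1) (P1 (F[X] ⧸ Ideal.span {n}))) =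
      Nat.card (MulAction.orbitRel.Quotient (constGroup D)
        (P1 (F[X] ⧸ Ideal.span {n}) × P1 F)) := by
  have hmem : ∀ g : GL (Fin 2) F, g • (P1.infty : P1 F) = P1.infty ∧ g ∈ constGroup D ↔
      Matrix.GeneralLinearGroup.map (C : F →+* F[X]) g ∈ borelGroup D 1 := by
    intro g
    rw [mem_borel, map_C_mem_detGroup, P1.smul_infty_eq_iff, Algebra.algebraMap_self,
      RingHom.id_apply]
    have h1 : (Matrix.GeneralLinearGroup.map (C : F →+* F[X]) g) 1 0 = C (g 1 0) := rfl
    have h2 : (Matrix.GeneralLinearGroup.map (C : F →+* F[X]) g) 0 1 = C (g 0 1) := rfl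
    rw [h1, h2, C_eq_zero]
    have : (C (g 0 1)).degree < ((1 : ℕ) : WithBot ℕ) :=
      degree_C_le.trans_lt (by exact_mod_cast zero_lt_one)
    tauto
  refine Nat.card_congr (Equiv.ofBijective
    (Quotient.map' (fun x => (x, P1.infty)) ?_) ⟨?_, ?_⟩)
  · rintro x y ⟨⟨h, hh⟩, rfl⟩
    obtain ⟨a, b, d, rfl, hb, had⟩ := id hh
    obtain ⟨g, hg⟩ := exists_map_C (h := upperC a b d) (by
      intro i j
      fin_cases i <;> fin_cases j <;> simp [upperC_val]
      exact Nat.le_zero.mp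
        (natDegree_le_of_degree_le (Order.lt_succ_iff.mp (by exact_mod_cast hb))))
    rw [hg] at hh
    obtain ⟨h1, h2⟩ := (hmem g).mpr hh
    refine ⟨⟨g, h2⟩, Prod.ext ?_ h1⟩
    change g • y = upperC a b d • y
    rw [hg, map_C_smul]
  · intro x y hxy
    induction x using Quotient.inductionOn' with
    | h x =>
    induction y using Quotient.inductionOn' with
    | h y =>
      obtain ⟨⟨g, hg⟩, h⟩ := Quotient.exact' hxy
      have h1 : g • y = x := congrArg Prod.fst h
      have h2 : g • (P1.infty : P1 F) = P1.infty := congrArg Prod.snd h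
      exact Quotient.sound' ⟨⟨_, (hmem g).mp ⟨h2, hg⟩⟩, (map_C_smul g y).trans h1⟩
  · intro z
    induction z using Quotient.inductionOn' with
    | h z =>
      obtain ⟨x, y⟩ := z
      obtain ⟨g, hg, h⟩ := exists_smul_eq_infty (D := D) y
      exact ⟨Quotient.mk'' (g • x), Quotient.sound' ⟨⟨g, hg⟩, Prod.ext rfl h⟩⟩

variable (D) in
/-- The number of scalar matrices with determinant in `D`. -/
noncomputable def scalarCount : ℕ := Nat.card {x : Fˣ // x * x ∈ D}

lemma card_isScalar : Nat.card {g : constGroup D // IsScalar g.1} = scalarCount D := by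
  symm
  refine Nat.card_congr (Equiv.ofBijective
    (fun x => ⟨⟨upper x.1 0 x.1, ?_⟩, ?_⟩) ⟨?_, ?_⟩)
  · rw [constGroup, Subgroup.mem_comap, det_upper]
    exact x.2
  · simp [IsScalar, upper_val]
  · intro x y hxy
    have h := congrArg (fun g : {g : constGroup D // IsScalar g.1} => g.1.1 0 0) hxy
    simp only [upper_val] at h
    exact Subtype.ext (Units.ext (by simpa using h))
  · rintro ⟨⟨g, hg⟩, h⟩
    change IsScalar g at h
    obtain ⟨a, d, hgu⟩ := eq_upper h.2.1
    have had : a = d := by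
      have := h.2.2
      rw [hgu] at this
      exact Units.ext (by simpa [upper_val] using this)
    subst had
    rw [h.1] at hgu
    refine ⟨⟨a, ?_⟩, Subtype.ext (Subtype.ext hgu.symm)⟩
    rw [constGroup, Subgroup.mem_comap, hgu, det_upper] at hg
    exact hg

/-- The determinant is surjective, so the index in GL₂(F) is that of `D` in `Fˣ`, and |GL₂(F)| is
known. -/
lemma card_constGroup [Fintype F] :
    (Nat.card (constGroup D) : ℚ) =
      Nat.card D * Fintype.card F * ((Fintype.card F : ℚ) ^ 2 - 1) := by
  have hsurj : Function.Surjective (Matrix.GeneralLinearGroup.det (n := Fin 2) (R := F)) :=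
    fun a => ⟨upper a 0 1, by rw [det_upper, mul_one]⟩
  have h1 := Subgroup.card_mul_index (constGroup D)
  rw [constGroup, Subgroup.index_comap_of_surjective D hsurj, ← constGroup,
    Matrix.card_GL_field] at h1
  have h2 := Subgroup.card_mul_index D
  have hq : 1 < Fintype.card F := Fintype.one_lt_card
  rw [Nat.card_units, Nat.card_eq_fintype_card (α := F)] at h2
  set q := Fintype.card F
  have h3 : (Nat.card D : ℚ) * D.index = q - 1 := by
    rw [← Nat.cast_mul, h2, Nat.cast_sub hq.le, Nat.cast_one]
  have h4 : (Nat.card (constGroup D) : ℚ) * D.index = ((q : ℚ) ^ 2 - 1) * (q ^ 2 - q) := by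
    rw [← Nat.cast_mul, h1, Fin.prod_univ_two]
    have e1 : q ^ (0 : ℕ) ≤ q ^ 2 := Nat.pow_le_pow_right (by omega) (by omega)
    have e2 : q ^ (1 : ℕ) ≤ q ^ 2 := Nat.pow_le_pow_right (by omega) (by omega)
    simp only [Fin.val_zero, Fin.val_one]
    rw [Nat.cast_mul, Nat.cast_sub e1, Nat.cast_sub e2]
    push_cast
    ring
  have hq1 : (q : ℚ) - 1 ≠ 0 := by
    have : (1 : ℚ) < q := by exact_mod_cast hq
    linarith
  have hi : (D.index : ℚ) ≠ 0 := by
    intro h0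
    rw [h0, mul_zero] at h3
    exact hq1 h3.symm
  apply mul_right_cancel₀ hi
  rw [h4]
  linear_combination -(q : ℚ) * ((q : ℚ) ^ 2 - 1) * h3

end ConstGroup

/-! ### Counting bottom edges, bottom vertices and cusps. -/

section Counting

variable {F : Type u} [Field F] {D : Subgroup Fˣ}
  {s : ℕ} {p : Fin s → F[X]} {r : Fin s → ℕ}

variable (D) in
/-- The diagonal matrices with determinant in `D`. -/
abbrev DiagPair : Type u := {x : Fˣ × Fˣ // x.1 * x.2 ∈ D}

lemma card_diagPair_eq : Nat.card {x : DiagPair D // x.1.1 = x.1.2} = scalarCount D := by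
  refine Nat.card_congr ⟨fun x => ⟨x.1.1.1, ?_⟩, fun y => ⟨⟨(y.1, y.1), y.2⟩, rfl⟩, ?_, ?_⟩
  · have := x.1.2
    rwa [← x.2] at this
  · rintro ⟨⟨⟨a, d⟩, h⟩, had⟩
    obtain rfl : a = d := had
    rfl
  · intro y
    rfl

variable (D) in
/-- The elements of the Borel group of level `𝔫`, in terms of their entries. -/
noncomputable def borelGroupEquiv {n : F[X]} (hn : n ≠ 0) :
    DiagPair D × (F[X] ⧸ Ideal.span {n}) ≃ borelGroup D n.natDegree :=
  Equiv.ofBijective (fun x => ⟨upperC x.1.1.1 (Quotient.out x.2 % n) x.1.1.2,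
    ⟨_, _, _, rfl, by
      rw [← degree_eq_natDegree hn]
      exact EuclideanDomain.mod_lt _ hn, x.1.2⟩⟩) (by
    have hmod : ∀ f : F[X], Ideal.Quotient.mk (Ideal.span {n}) (f % n) =
        Ideal.Quotient.mk (Ideal.span {n}) f := by
      intro f
      rw [Ideal.Quotient.eq, Ideal.mem_span_singleton]
      exact ⟨-(f / n), by linear_combination EuclideanDomain.div_add_mod f n⟩
    have hout : ∀ b : F[X] ⧸ Ideal.span {n},
        Ideal.Quotient.mk (Ideal.span {n}) (Quotient.out b) = b := fun b => Quotient.out_eq b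
    constructor
    · rintro ⟨⟨⟨a, d⟩, h⟩, b⟩ ⟨⟨⟨a', d'⟩, h'⟩, b'⟩ he
      have he' := congrArg (fun g : borelGroup D n.natDegree => g.1.1) he
      simp only [upperC_val] at he'
      have h00 := congrFun (congrFun he' 0) 0
      have h01 := congrFun (congrFun he' 0) 1
      have h11 := congrFun (congrFun he' 1) 1
      simp only [Matrix.of_apply, Matrix.cons_val_zero, Matrix.cons_val_one] at h00 h01 h11
      have ha : a = a' := Units.ext (C_injective h00)
      have hd : d = d' := Units.ext (C_injective h11)
      have hb : b = b' := by rw [← hout b, ← hout b', ← hmod, h01, hmod]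
      subst ha hd hb
      rfl
    · rintro ⟨_, a, b, d, rfl, hb, had⟩
      refine ⟨(⟨(a, d), had⟩, Ideal.Quotient.mk _ b), Subtype.ext ?_⟩
      simp only
      congr 1
      rw [← degree_eq_natDegree hn] at hb
      have h1 : n ∣ Quotient.out (Ideal.Quotient.mk (Ideal.span {n}) b) - b := by
        rw [← Ideal.mem_span_singleton, ← Ideal.Quotient.eq, hout]
      have h2 : Quotient.out (Ideal.Quotient.mk (Ideal.span {n}) b) % n = b % n := by
        have := (EuclideanDomain.mod_eq_zero (a := Quotient.out
          (Ideal.Quotient.mk (Ideal.span {n}) b) - b) (b := n)).mpr h1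
        rw [Polynomial.sub_mod] at this
        exact sub_eq_zero.mp this
      rw [h2]
      exact (mod_eq_self_iff hn).mpr hb)

lemma borelGroupEquiv_smul {n : F[X]} (hn : n ≠ 0) (a d : Fˣ) (h : a * d ∈ D)
    (b : F[X]) (x : P1 (F[X] ⧸ Ideal.span {n})) :
    (borelGroupEquiv D hn (⟨(a, d), h⟩, Ideal.Quotient.mk _ b)).1 • x = upperC a b d • x := by
  refine P1.smul_congr _ _ (fun i j => ?_) x
  change algebraMap _ _ ((upperC a _ d) i j) = _
  fin_cases i <;> fin_cases j <;> simp [upperC_val, Ideal.Quotient.algebraMap_eq]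
  have hout : Ideal.Quotient.mk (Ideal.span {n})
      (Quotient.out (Ideal.Quotient.mk (Ideal.span {n}) b)) = Ideal.Quotient.mk _ b :=
    Quotient.out_eq _
  refine Eq.trans ?_ hout
  rw [Ideal.Quotient.eq, Ideal.mem_span_singleton]
  refine ⟨-(Quotient.out (Ideal.Quotient.mk (Ideal.span {n}) b) / n), ?_⟩
  linear_combination EuclideanDomain.div_add_mod
    (Quotient.out (Ideal.Quotient.mk (Ideal.span {n}) b)) n

variable [Fintype F]

lemma card_diagPair :
    Nat.card (DiagPair D) = (Fintype.card F - 1) * Nat.card D := by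
  have e : DiagPair D ≃ Fˣ × D :=
    ⟨fun x => (x.1.1, ⟨x.1.1 * x.1.2, x.2⟩), fun y => ⟨(y.1, y.1⁻¹ * y.2.1), by simp⟩,
      fun x => by simp, fun y => by simp⟩
  rw [Nat.card_congr e, Nat.card_prod, Nat.card_units, Nat.card_eq_fintype_card (α := F)]

/-- The number of edges minus the number of vertices in the bottom layer. -/
lemma card_edges_sub_card_vertices (hmonic : ∀ i, (p i).Monic)
    (hirr : ∀ i, Irreducible (p i)) (hinj : Function.Injective p) (hr : ∀ i, 1 ≤ r i)
    (h2 : (2 : F) ≠ 0) :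
    ((Nat.card (MulAction.orbitRel.Quotient (borelGroup D 1)
          (P1 (F[X] ⧸ Ideal.span {∏ i, p i ^ r i}))) : ℚ) -
        Nat.card (MulAction.orbitRel.Quotient (constGroup D)
          (P1 (F[X] ⧸ Ideal.span {∏ i, p i ^ r i})))) * Nat.card (constGroup D) =
      levelEps (∏ i, p i ^ r i) * Fintype.card F * scalarCount D +
        2 ^ s * ((Nat.card (constGroup D) -
          scalarCount D * Fintype.card F * (Fintype.card F + 1)) / 2) -
        2 ^ s * levelMe p * ((Nat.card (constGroup D) -
          scalarCount D * Fintype.card F * (Fintype.card F - 1)) / 2) := by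
  classical
  have := finite_quotient_span (level_ne_zero (r := r) hirr)
  have := Fintype.ofFinite (constGroup D)
  set X := P1 (F[X] ⧸ Ideal.span {∏ i, p i ^ r i})
  set q : ℚ := ((Fintype.card F : ℕ) : ℚ)
  let σ (P : GL (Fin 2) F → Prop) (g : constGroup D) : ℚ := if P g.1 then 1 else 0
  let φ (g : constGroup D) : ℚ := Nat.card (MulAction.fixedBy X g)
  let θ (g : constGroup D) : ℚ := Nat.card (MulAction.fixedBy (P1 F) g)
  let sc : constGroup D → ℚ := σ IsScalar
  let un : constGroup D → ℚ := σ fun g => disc g = 0 ∧ ¬ IsScalar g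
  let sq : constGroup D → ℚ := σ fun g => disc g ≠ 0 ∧ IsSquare (disc g)
  let ns : constGroup D → ℚ := σ fun g => disc g ≠ 0 ∧ ¬ IsSquare (disc g)
  -- Scalar, parabolic, split and nonsplit elements. In the parabolic case φ is left undetermined:
  -- there θ = 1, so φ(θ - 1) vanishes.
  have hcases : ∀ g : constGroup D,
      (IsScalar g.1 ∧ θ g = q + 1 ∧ φ g = levelEps (∏ i, p i ^ r i) ∧
        sc g = 1 ∧ un g = 0 ∧ sq g = 0 ∧ ns g = 0) ∨
      (θ g = 1 ∧ sc g = 0 ∧ un g = 1 ∧ sq g = 0 ∧ ns g = 0) ∨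
      (θ g = 2 ∧ φ g = 2 ^ s ∧ sc g = 0 ∧ un g = 0 ∧ sq g = 1 ∧ ns g = 0) ∨
      (θ g = 0 ∧ φ g = 2 ^ s * levelMe p ∧ sc g = 0 ∧ un g = 0 ∧ sq g = 0 ∧ ns g = 1) := by
    intro g
    have hθ : θ g = Nat.card (MulAction.fixedBy (P1 F) g.1) := rfl
    have hφ : φ g = Nat.card (MulAction.fixedBy X g.1) := rfl
    by_cases h1 : IsScalar g.1
    · left
      refine ⟨h1, ?_, ?_, ?_, ?_, ?_, ?_⟩
      · rw [hθ, h1.card_fixedBy, card_P1_field, Nat.card_eq_fintype_card]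
        push_cast
        rfl
      · rw [hφ, h1.card_fixedBy]
        rfl
      all_goals simp [sc, un, sq, ns, σ, h1, h1.disc_eq]
    right
    by_cases h3 : disc g.1 = 0
    · left
      refine ⟨?_, ?_, ?_, ?_, ?_⟩
      · rw [hθ, P1.card_fixedBy_field_of_disc_eq_zero h2 h3 h1, Nat.cast_one]
      all_goals simp [sc, un, sq, ns, σ, h1, h3]
    right
    by_cases h4 : IsSquare (disc g.1)
    · left
      refine ⟨?_, ?_, ?_, ?_, ?_, ?_⟩
      · rw [hθ, P1.card_fixedBy_of_disc_ne_zero h2 g.1 h3, Algebra.algebraMap_self,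
          RingHom.id_apply, if_pos h4]
        norm_num
      · rw [hφ, card_fixedBy_level_disc hmonic hirr hinj hr h2 g.1 h3, if_pos h4]
        push_cast
        rfl
      all_goals simp [sc, un, sq, ns, σ, h1, h3, h4]
    · right
      refine ⟨?_, ?_, ?_, ?_, ?_, ?_⟩
      · rw [hθ, P1.card_fixedBy_of_disc_ne_zero h2 g.1 h3, Algebra.algebraMap_self,
          RingHom.id_apply, if_neg h4]
        norm_num
      · rw [hφ, card_fixedBy_level_disc hmonic hirr hinj hr h2 g.1 h3, if_neg h4]
        push_cast
        rfl
      all_goals simp [sc, un, sq, ns, σ, h1, h3, h4]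
  have hsc : ∑ g, sc g = scalarCount D := by
    rw [← card_isScalar, Nat.card_eq_fintype_card, Fintype.card_subtype]
    simp [sc, σ]
  have e1 : ∑ g : constGroup D, (1 : ℚ) = ∑ g, sc g + ∑ g, un g + ∑ g, sq g + ∑ g, ns g := by
    simp only [← Finset.sum_add_distrib]
    refine Finset.sum_congr rfl fun g _ => ?_
    rcases hcases g with h | h | h | h <;> simp [h]
  have e2 : ∑ g, θ g = (q + 1) * ∑ g, sc g + ∑ g, un g + 2 * ∑ g, sq g := by
    simp only [Finset.mul_sum, ← Finset.sum_add_distrib]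
    refine Finset.sum_congr rfl fun g _ => ?_
    rcases hcases g with h | h | h | h <;> simp [h]
  have e3 : ∑ g, θ g * θ g = (q + 1) ^ 2 * ∑ g, sc g + ∑ g, un g + 4 * ∑ g, sq g := by
    simp only [Finset.mul_sum, ← Finset.sum_add_distrib]
    refine Finset.sum_congr rfl fun g _ => ?_
    rcases hcases g with h | h | h | h <;> simp [h] <;> ring
  have e4 : ∑ g, φ g * θ g - ∑ g, φ g = levelEps (∏ i, p i ^ r i) * q * ∑ g, sc g +
      2 ^ s * ∑ g, sq g - 2 ^ s * levelMe p * ∑ g, ns g := by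
    simp only [Finset.mul_sum, ← Finset.sum_add_distrib, ← Finset.sum_sub_distrib]
    refine Finset.sum_congr rfl fun g _ => ?_
    rcases hcases g with h | h | h | h <;> simp [h] <;> ring
  have b0 : ∑ g : constGroup D, (1 : ℚ) = Nat.card (constGroup D) := by
    simp
  have b1 : ∑ g, θ g = Nat.card (constGroup D) := by
    have := sum_card_fixedBy (constGroup D) (P1 F)
    rw [card_orbits_P1, one_mul] at this
    simp only [θ]
    exact_mod_cast this
  have b2 : ∑ g, θ g * θ g = 2 * Nat.card (constGroup D) := by
    have := sum_card_fixedBy (constGroup D) (P1 F × P1 F)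
    rw [card_orbits_P1_prod] at this
    simp only [card_fixedBy_prod] at this
    simp only [θ]
    exact_mod_cast this
  have b3 : ∑ g, φ g = Nat.card (MulAction.orbitRel.Quotient (constGroup D) X) *
      Nat.card (constGroup D) := by
    simp only [φ]
    exact_mod_cast sum_card_fixedBy (constGroup D) X
  have b4 : ∑ g, φ g * θ g = Nat.card (MulAction.orbitRel.Quotient (borelGroup D 1) X) *
      Nat.card (constGroup D) := by
    have := sum_card_fixedBy (constGroup D) (X × P1 F)
    simp only [card_fixedBy_prod] at this
    rw [card_orbits_borelGroup]
    simp only [φ, θ]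
    exact_mod_cast this
  rw [sub_mul, ← b3, ← b4, e4]
  rw [hsc] at e1 e2 e3 ⊢
  rw [b0] at e1
  rw [b1] at e2
  rw [b2] at e3
  -- The first two moments of θ are known from transitivity and double transitivity; together with
  -- the total count they determine the sizes of the classes.
  have hsq : ∑ g, sq g = ((Nat.card (constGroup D) : ℚ) - scalarCount D * q * (q + 1)) / 2 := by
    linear_combination (e2 - e3) / 2
  have hns : ∑ g, ns g = ((Nat.card (constGroup D) : ℚ) - scalarCount D * q * (q - 1)) / 2 := by
    linear_combination e2 - e1 + hsq
  rw [hsq, hns]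

/-- The number of cusps. -/
lemma card_cusps (hmonic : ∀ i, (p i).Monic)
    (hirr : ∀ i, Irreducible (p i)) (hinj : Function.Injective p) (hr : ∀ i, 1 ≤ r i) :
    (Nat.card (MulAction.orbitRel.Quotient (borelGroup D (∏ i, p i ^ r i).natDegree)
        (P1 (F[X] ⧸ Ideal.span {∏ i, p i ^ r i}))) : ℚ) *
          ((Fintype.card F - 1) * Nat.card D) =
      scalarCount D * levelKappa p r +
        ((Fintype.card F - 1) * Nat.card D - scalarCount D) * 2 ^ s := by
  classical
  have hn := level_ne_zero (r := r) hirr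
  have := finite_quotient_span hn
  have := Fintype.ofFinite (F[X] ⧸ Ideal.span {∏ i, p i ^ r i})
  set n := ∏ i, p i ^ r i with hn_def
  have hq : 1 < Fintype.card F := Fintype.one_lt_card
  have : Fintype (borelGroup D n.natDegree) := Fintype.ofEquiv _ (borelGroupEquiv D hn)
  have hN : (0 : ℚ) < (Fintype.card F : ℚ) ^ n.natDegree := by positivity
  have hcard : Nat.card (F[X] ⧸ Ideal.span {n}) = Fintype.card F ^ n.natDegree := by
    rw [card_quotient_span hn, Nat.card_eq_fintype_card]
  have hcardB : (Nat.card (borelGroup D n.natDegree) : ℚ) =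
      (Fintype.card F - 1) * Nat.card D * (Fintype.card F : ℚ) ^ n.natDegree := by
    rw [← Nat.card_congr (borelGroupEquiv D hn), Nat.card_prod, hcard, card_diagPair]
    push_cast [Nat.cast_sub hq.le]
    ring
  have hfix : ∀ (a d : Fˣ) (h : a * d ∈ D) (b : F[X]),
      Nat.card (MulAction.fixedBy (P1 (F[X] ⧸ Ideal.span {n}))
        (borelGroupEquiv D hn (⟨(a, d), h⟩, Ideal.Quotient.mk _ b))) =
      Nat.card (MulAction.fixedBy (P1 (F[X] ⧸ Ideal.span {n})) (upperC a b d)) := by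
    intro a d h b
    refine Nat.card_congr (Equiv.subtypeEquivRight fun x => ?_)
    rw [MulAction.mem_fixedBy, MulAction.mem_fixedBy, ← borelGroupEquiv_smul hn a d h b x]
    rfl
  have hsum : ∀ x : DiagPair D, ∑ b : F[X] ⧸ Ideal.span {n},
      (Nat.card (MulAction.fixedBy (P1 (F[X] ⧸ Ideal.span {n})) (borelGroupEquiv D hn (x, b))) : ℚ)
        = (Fintype.card F : ℚ) ^ n.natDegree *
          (if x.1.1 = x.1.2 then (levelKappa p r : ℚ) else 2 ^ s) := by
    rintro ⟨⟨a, d⟩, h⟩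
    split_ifs with had
    · simp only at had
      subst had
      -- After removal of the scalar a the matrix is unip(a⁻¹b), and multiplication by a⁻¹ permutes
      -- the residues b.
      have hc : ∀ b : F[X] ⧸ Ideal.span {n},
          Nat.card (MulAction.fixedBy (P1 (F[X] ⧸ Ideal.span {n}))
            (borelGroupEquiv D hn (⟨(a, a), h⟩, b))) =
          Nat.card (MulAction.fixedBy (P1 (F[X] ⧸ Ideal.span {n}))
            (unip (algebraMap F _ (↑a⁻¹ : F) * b))) := by
        intro b
        obtain ⟨b, rfl⟩ := Ideal.Quotient.mk_surjective b
        rw [hfix]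
        refine Nat.card_congr (Equiv.subtypeEquivRight fun x => ?_)
        obtain ⟨u, v, huv, rfl⟩ := P1.exists_mk x
        have : upperC a b a • P1.mk u v huv =
            unip (algebraMap F (F[X] ⧸ Ideal.span {n}) (↑a⁻¹ : F) * Ideal.Quotient.mk _ b) •
              P1.mk u v huv := by
          symm
          rw [P1.smul_mk, P1.smul_mk]
          have haa : algebraMap F (F[X] ⧸ Ideal.span {n}) a * algebraMap F _ (↑a⁻¹ : F) = 1 := by
            rw [← map_mul, Units.mul_inv, map_one]
          have hC : ∀ c : F, algebraMap F[X] (F[X] ⧸ Ideal.span {n}) (C c) =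
            algebraMap F (F[X] ⧸ Ideal.span {n}) c := fun c => rfl
          refine P1.mk_eq_mk.mpr
            ⟨Units.map (algebraMap F (F[X] ⧸ Ideal.span {n}) : F →* _) a, ?_, ?_⟩
          · simp only [upperC_val, unip_val, Matrix.of_apply, Matrix.cons_val_zero,
              Matrix.cons_val_one, Algebra.algebraMap_self, RingHom.id_apply,
              Ideal.Quotient.algebraMap_eq]
            change _ = algebraMap F (F[X] ⧸ Ideal.span {n}) a * _
            linear_combination (-(Ideal.Quotient.mk (Ideal.span {n}) b) * v) * haa
          · simp only [upperC_val, unip_val, Matrix.of_apply, Matrix.cons_val_zero,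
              Matrix.cons_val_one, hC, Algebra.algebraMap_self, RingHom.id_apply, map_zero]
            change _ = algebraMap F (F[X] ⧸ Ideal.span {n}) a * _
            ring
        rw [MulAction.mem_fixedBy, MulAction.mem_fixedBy, this]
      simp only [hc]
      have hu : IsUnit (algebraMap F (F[X] ⧸ Ideal.span {n}) (↑a⁻¹ : F)) :=
        (a⁻¹.isUnit).map _
      have h1 := Equiv.sum_comp (Units.mulLeft hu.unit) fun b : F[X] ⧸ Ideal.span {n} =>
        Nat.card (MulAction.fixedBy (P1 (F[X] ⧸ Ideal.span {n})) (unip b))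
      have h2 := sum_card_fixedBy_level_unip hmonic hirr hinj hr
      exact_mod_cast h1.trans h2
    · have hc : ∀ b : F[X] ⧸ Ideal.span {n},
          Nat.card (MulAction.fixedBy (P1 (F[X] ⧸ Ideal.span {n}))
            (borelGroupEquiv D hn (⟨(a, d), h⟩, b))) = 2 ^ s := by
        intro b
        obtain ⟨b, rfl⟩ := Ideal.Quotient.mk_surjective b
        rw [hfix]
        exact card_fixedBy_level_upperC hmonic hirr hinj hr had b
      simp only [hc]
      rw [Finset.sum_const, Finset.card_univ, ← Nat.card_eq_fintype_card, hcard, nsmul_eq_mul]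
      push_cast
      ring
  have hb : (∑ g : borelGroup D n.natDegree,
      (Nat.card (MulAction.fixedBy (P1 (F[X] ⧸ Ideal.span {n})) g) : ℚ)) =
      Nat.card (MulAction.orbitRel.Quotient (borelGroup D n.natDegree)
        (P1 (F[X] ⧸ Ideal.span {n}))) * Nat.card (borelGroup D n.natDegree) := by
    exact_mod_cast sum_card_fixedBy (borelGroup D n.natDegree) (P1 (F[X] ⧸ Ideal.span {n}))
  have : Fintype (DiagPair D) := Fintype.ofFinite _
  rw [← (borelGroupEquiv D hn).sum_comp, Fintype.sum_prod_type] at hb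
  simp only [hsum] at hb
  rw [← Finset.mul_sum, hcardB] at hb
  have hs1 : ∑ x : DiagPair D, (if x.1.1 = x.1.2 then (levelKappa p r : ℚ) else 2 ^ s) =
      scalarCount D * levelKappa p r +
        ((Fintype.card F - 1) * Nat.card D - scalarCount D) * 2 ^ s := by
    have h1 : ∀ x : DiagPair D, (if x.1.1 = x.1.2 then (levelKappa p r : ℚ) else 2 ^ s) =
        (if x.1.1 = x.1.2 then ((levelKappa p r : ℚ) - 2 ^ s) else 0) + 2 ^ s := by
      intro x
      split_ifs <;> ring
    simp only [h1]
    rw [Finset.sum_add_distrib, ← Finset.sum_filter, Finset.sum_const, Finset.sum_const,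
      ← Fintype.card_subtype, Finset.card_univ, ← Nat.card_eq_fintype_card,
      ← Nat.card_eq_fintype_card, card_diagPair_eq, card_diagPair, nsmul_eq_mul, nsmul_eq_mul]
    push_cast [Nat.cast_sub hq.le]
    ring
  rw [hs1] at hb
  apply mul_left_cancel₀ hN.ne'
  rw [hb]
  ring

/-- The genus of the quotient of the tree by the matrices in `Γ₀(𝔫)` with determinant in `D`. -/
theorem genus_congruenceGroup (D : Subgroup Fˣ) (hmonic : ∀ i, (p i).Monic)
    (hirr : ∀ i, Irreducible (p i)) (hinj : Function.Injective p) (hr : ∀ i, 1 ≤ r i)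
    (h2 : (2 : F) ≠ 0) {q a δ : ℚ} (hq : (Fintype.card F : ℚ) = q) (ha : (scalarCount D : ℚ) = a)
    (hδ : (Nat.card D : ℚ) = δ) :
    ((quotientGraph (congruenceGroup D (∏ i, p i ^ r i))).genus : ℚ) =
      1 + a / δ * (levelEps (∏ i, p i ^ r i) / (q ^ 2 - 1) - levelKappa p r / (q - 1)) -
        2 ^ s / 2 * ((1 - a / (δ * (q - 1))) + levelMe p * (1 - a / (δ * (q + 1)))) := by
  have hn := level_ne_zero (r := r) hirr
  have hg := genus_quotientGraph D hn
  have hg' : ((quotientGraph (congruenceGroup D (∏ i, p i ^ r i))).genus : ℚ) +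
      Nat.card (MulAction.orbitRel.Quotient (constGroup D)
        (P1 (F[X] ⧸ Ideal.span {∏ i, p i ^ r i}))) +
      Nat.card (MulAction.orbitRel.Quotient (borelGroup D (∏ i, p i ^ r i).natDegree)
          (P1 (F[X] ⧸ Ideal.span {∏ i, p i ^ r i}))) =
      Nat.card (MulAction.orbitRel.Quotient (borelGroup D 1)
        (P1 (F[X] ⧸ Ideal.span {∏ i, p i ^ r i}))) + 1 := by exact_mod_cast hg
  have he := card_edges_sub_card_vertices (D := D) hmonic hirr hinj hr h2
  have hc := card_cusps (D := D) hmonic hirr hinj hr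
  rw [card_constGroup (D := D)] at he
  have hq1 : 1 < q := by
    rw [← hq]
    exact_mod_cast Fintype.one_lt_card
  have hδ0 : 0 < δ := by
    rw [← hδ]
    exact_mod_cast Nat.card_pos
  rw [hq, ha, hδ] at he hc
  have h1 : q - 1 ≠ 0 := by linarith
  have h3 : q + 1 ≠ 0 := by linarith
  have h4 : q ^ 2 - 1 ≠ 0 := by nlinarith
  have h5 : q ≠ 0 := by linarith
  have h6 : δ ≠ 0 := hδ0.ne'
  have hc' := eq_div_of_mul_eq (mul_ne_zero h1 h6) hc
  have he' := eq_div_of_mul_eq (mul_ne_zero (mul_ne_zero h6 h5) h4) he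
  have hgen : ((quotientGraph (congruenceGroup D (∏ i, p i ^ r i))).genus : ℚ) =
      1 + (Nat.card (MulAction.orbitRel.Quotient (borelGroup D 1)
        (P1 (F[X] ⧸ Ideal.span {∏ i, p i ^ r i}))) - Nat.card (MulAction.orbitRel.Quotient
        (constGroup D) (P1 (F[X] ⧸ Ideal.span {∏ i, p i ^ r i})))) -
      Nat.card (MulAction.orbitRel.Quotient (borelGroup D (∏ i, p i ^ r i).natDegree)
          (P1 (F[X] ⧸ Ideal.span {∏ i, p i ^ r i}))) := by linear_combination hg'
  rw [hgen, hc', he']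
  rw [show q ^ 2 - 1 = (q - 1) * (q + 1) by ring]
  field_simp
  ring

end Counting

/-! ### The cases of trivial and of arbitrary determinant. -/

section Assembly

variable {F : Type u} [Field F]

lemma congruenceGroup_top (n : F[X]) : congruenceGroup ⊤ n = Gamma0 n := by
  refine inf_eq_left.mpr fun g _ => ?_
  obtain ⟨c, hc⟩ := exists_units_map_C (Matrix.GeneralLinearGroup.det g)
  exact ⟨c, Subgroup.mem_top c, hc.symm⟩

lemma congruenceGroup_bot (n : F[X]) : congruenceGroup ⊥ n = Gamma01 n := by
  rw [congruenceGroup, detGroup, Subgroup.map_bot, MonoidHom.comap_bot, Gamma01]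

lemma scalarCount_top : scalarCount (⊤ : Subgroup Fˣ) = Nat.card Fˣ :=
  Nat.card_congr (Equiv.subtypeUnivEquiv fun _ => Subgroup.mem_top _)

lemma scalarCount_bot (h2 : (2 : F) ≠ 0) : scalarCount (⊥ : Subgroup Fˣ) = 2 := by
  rw [scalarCount, Nat.card_eq_two_iff]
  refine ⟨⟨1, by simp⟩, ⟨-1, by simp⟩, ?_, ?_⟩
  · intro h
    have h' := congrArg (fun x : Fˣ => (x : F)) (congrArg Subtype.val h)
    simp only [Units.val_one, Units.val_neg] at h'
    exact h2 (by linear_combination h')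
  · refine Set.eq_univ_of_forall fun x => ?_
    have hx : (x.1 : F) * x.1 = 1 := by
      have := congrArg Units.val (Subgroup.mem_bot.mp x.2)
      simpa using this
    rcases mul_self_eq_one_iff.mp hx with h | h
    · exact Or.inl (Subtype.ext (Units.ext h))
    · exact Or.inr (Subtype.ext (Units.ext (by simpa using h)))

lemma two_ne_zero_of_odd_card [Fintype F] (h : Odd (Fintype.card F)) : (2 : F) ≠ 0 := by
  refine Ring.two_ne_zero fun h' => ?_
  have := FiniteField.even_card_iff_char_two.mp h'
  have := Nat.odd_iff.mp h
  omega

end Assembly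

theorem mainTheorem1 {F : Type*} [Field F] [Fintype F] (q : ℕ) (hq : Fintype.card F = q)
    (hodd : Odd q) (n : F[X]) (s : ℕ) (p : Fin s → F[X]) (r : Fin s → ℕ)
    (hmonic : ∀ i, (p i).Monic) (hirr : ∀ i, Irreducible (p i)) (hinj : Function.Injective p)
    (hr : ∀ i, 1 ≤ r i) (hn : n = ∏ i, p i ^ r i) :
    Module.Finite ℤ (quotientGraph (Gamma01 n)).H₁ ∧
    Module.Finite ℤ (quotientGraph (Gamma0 n)).H₁ ∧
    levelEps n = ∏ i, polyAbs (p i) ^ (r i - 1) * (polyAbs (p i) + 1) ∧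
    ((quotientGraph (Gamma01 n)).genus : ℚ) =
      1 + 2 / ((q : ℚ) ^ 2 - 1) * levelEps n - 2 / ((q : ℚ) - 1) * levelKappa p r
        + (2 : ℚ) ^ ((s : ℤ) - 1) *
          ((3 - (q : ℚ)) / (q - 1) + (1 - (q : ℚ)) / (q + 1) * levelMe p) ∧
    ((quotientGraph (Gamma01 n)).genus : ℚ) =
      2 * (quotientGraph (Gamma0 n)).genus - 1 + (2 : ℚ) ^ ((s : ℤ) - 1) * (1 + levelMe p) := by
  subst hn hq
  have hn := level_ne_zero (r := r) hirr
  have h2 : (2 : F) ≠ 0 := two_ne_zero_of_odd_card hodd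
  have hq1 : (1 : ℚ) < Fintype.card F := by exact_mod_cast Fintype.one_lt_card
  have hunits : (Nat.card Fˣ : ℚ) = Fintype.card F - 1 := by
    rw [Nat.card_units, Nat.card_eq_fintype_card, Nat.cast_sub Fintype.card_pos, Nat.cast_one]
  -- For determinant 1 the admissible scalars are ±1, so a/δ = 2. For arbitrary determinant all q -
  -- 1 scalars occur and a/δ = 1; this ratio explains the factor 2 between the main terms of the
  -- genera.
  have h1 := genus_congruenceGroup ⊥ hmonic hirr hinj hr h2 rfl
    (a := 2) (δ := 1) (by rw [scalarCount_bot h2]; norm_num) (by simp)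
  have h0 := genus_congruenceGroup ⊤ hmonic hirr hinj hr h2 rfl
    (a := Fintype.card F - 1) (δ := Fintype.card F - 1) (by rw [scalarCount_top, hunits])
    (by rw [Subgroup.card_top, hunits])
  rw [congruenceGroup_bot] at h1
  rw [congruenceGroup_top] at h0
  -- The exponent is an integer, so that s = 0 gives 1/2.
  have hpow : (2 : ℚ) ^ ((s : ℤ) - 1) = 2 ^ s / 2 := by
    rw [zpow_sub_one₀ two_ne_zero, zpow_natCast, div_eq_mul_inv]
  have hm : (Fintype.card F : ℚ) - 1 ≠ 0 := by linarith
  have hp : (Fintype.card F : ℚ) + 1 ≠ 0 := by linarith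
  have hmp : (Fintype.card F : ℚ) ^ 2 - 1 = (Fintype.card F - 1) * (Fintype.card F + 1) := by ring
  refine ⟨?_, ?_, levelEps_eq hmonic hirr hinj hr, ?_, ?_⟩
  · rw [← congruenceGroup_bot]
    exact finite_homology_quotientGraph ⊥ hn
  · rw [← congruenceGroup_top]
    exact finite_homology_quotientGraph ⊤ hn
  · rw [h1, hpow, hmp]
    field_simp
    ring
  · rw [h1, h0, hpow, hmp]
    field_simp
    ring
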